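/- Let $\mathbb{K}$ be a semiring and $\mathcal{A}=\langle I,E,T\rangle$ a $\mathbb{K}$-automaton over $A^*$ with finite state set $Q$, $n=|Q|$: $I,T\colon Q\to\mathbb{K}$, $E\colon Q\times A\times Q\to\mathbb{K}$, with $m<\infty$ transitions (triples $(p,a,q)$ with $E(p,a,q)\neq 0$). A surjective map $\varphi\colon Q\to R$ is a morphism of $\mathcal{A}$ onto $\mathcal{B}=\langle J,F,U\rangle$ if its $0/1$ matrix $X_\varphi$ satisfies $I X_\varphi=J$, $E X_\varphi=X_\varphi F$, $T=X_\varphi U$; then $\mathcal{B}$ is a quotient of $\mathcal{A}$. The minimal quotient of $\mathcal{A}$ is the quotient that is a quotient of every quotient of $\mathcal{A}$ and has the least number of states. The augmented automaton has two more states $i,t$ and a new letter $\$$, with transitions $i\to p$ of label $\$$ and weight $I_p$ (if $I_p\neq0$), and $p\to t$ of label $\$$ and weight $T_p$ (if $T_p\neq0$). The signature of a state $p$ with respect to a set $D$ of states is the map $a\mapsto\sum_{q\in D}E(p,a,q)$. Two algorithms refine the partition $\{\{i\},Q,\{t\}\}$ of its states. Domain Split Algorithm (DSA): a queue contains at first the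 class $Q$; an iteration extracts a class $C$, splits it according to the signatures of its states with respect to all the classes of the current partition, and inserts the resulting classes (or $C$ itself) other than singletons. A round processes the classes that are in the queue at its beginning, and the algorithm halts after a round without split. Predecessor Class Split Algorithm (PCSA): a queue contains at first $Q$ and $\{t\}$; an iteration extracts a class $D$ and splits every class of the current partition according to the signatures of its states with respect to $D$; whenever a class is split, the resulting classes are inserted into the queue, where they replace that class if it was there. The algorithm halts when the queue is empty. Both algorithms are implemented, with weak sorts by linked hash maps, as fixed programs for a sequential machine on which operations on states, letters, integers, list cells and weights (addition in $\mathbb{K}$, comparison, hashing of an atom) take constant time, and hashing a list takes time linear in its size. At the end, the transitions of the quotient are read off one representative of each class of the final partition. Theorem. There is a constant $c$, independent of $\mathbb{K}$, $A$ and $\mathcal{A}$, such that for every $\mathcal{A}$, given by lists in any order of its states and of the transitions of its augmented automaton, DSA and PCSA both halt after at most $c\cdot\max(1,n(m+n))$ steps, that is, in time $O(n(m+n))$, and the automaton that they compute is the minimal quotient of $\mathcal{A}$; the computed map from states to classes is a morphism onto it. -/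

import Mathlib

open scoped Matrix

universe u v w x

/-! ## Weighted automata, morphisms, minimal quotients -/

/-- A `K`-automaton of dimension `Q` over `A*`: initial function `I`, final function `T`, and
`E a p q`, the weight of the transition from `p` to `q` with label `a` (`0` if there is none). -/
structure KAutomaton (K : Type u) (A : Type v) (Q : Type w) where
  I : Q → K
  E : A → Matrix Q Q K
  T : Q → K

namespace KAutomaton

variable {K : Type u} {A : Type v} {Q : Type w} {R : Type x} [Semiring K]

/-- Number of transitions, that is, of triples `(p, a, q)` with a nonzero weight. -/
noncomputable def numTransitions (𝒜 : KAutomaton K A Q) : ℕ :=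
  Set.ncard {e : Q × A × Q | 𝒜.E e.2.1 e.1 e.2.2 ≠ 0}

/-- `𝒜` is conjugate to `ℬ` by the transfer matrix `X`. -/
structure Conjugate [Fintype Q] [Fintype R] (𝒜 : KAutomaton K A Q) (ℬ : KAutomaton K A R)
    (X : Matrix Q R K) : Prop where
  initial : 𝒜.I ᵥ* X = ℬ.I
  transition : ∀ a, 𝒜.E a * X = X * ℬ.E a
  final : 𝒜.T = X *ᵥ ℬ.T

/-- The amalgamation matrix of a map. -/
def amalgamation (K : Type u) [Semiring K] [DecidableEq R] (φ : Q → R) : Matrix Q R K :=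
  Matrix.of fun q r => if φ q = r then 1 else 0

/-- A morphism from `𝒜` onto `ℬ`: a surjective map whose amalgamation matrix conjugates
`𝒜` to `ℬ`. -/
def IsMorphism [Fintype Q] [Fintype R] [DecidableEq R] (𝒜 : KAutomaton K A Q)
    (ℬ : KAutomaton K A R) (φ : Q → R) : Prop :=
  Function.Surjective φ ∧ Conjugate 𝒜 ℬ (amalgamation K φ)

/-- `ℬ` is a quotient of `𝒜`. -/
def IsQuotient [Fintype Q] [Fintype R] [DecidableEq R] (𝒜 : KAutomaton K A Q)
    (ℬ : KAutomaton K A R) : Prop :=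
  ∃ φ : Q → R, IsMorphism 𝒜 ℬ φ

/-- `ℬ` is the minimal quotient of `𝒜`: a quotient of `𝒜` which is a quotient of every quotient
of `𝒜` and has the least number of states among them. -/
structure IsMinimalQuotient [Fintype Q] [Fintype R] [DecidableEq R] (𝒜 : KAutomaton K A Q)
    (ℬ : KAutomaton K A R) : Prop where
  quotient : IsQuotient 𝒜 ℬ
  universal : ∀ (S : Type w) [Fintype S] [DecidableEq S] (𝒞 : KAutomaton K A S),
    IsQuotient 𝒜 𝒞 → IsQuotient 𝒞 ℬ
  card_le : ∀ (S : Type w) [Fintype S] [DecidableEq S] (𝒞 : KAutomaton K A S),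
    IsQuotient 𝒜 𝒞 → Fintype.card R ≤ Fintype.card S

end KAutomaton

/-! ## The augmented automaton -/

/-- States of the augmented automaton: the true states and the two new states. -/
inductive AugState (Q : Type w) where
  | ini : AugState Q
  | tru (q : Q) : AugState Q
  | fin : AugState Q
deriving DecidableEq

/-- Transition weights of the augmented automaton; the marker `$` is the letter `none`. -/
def KAutomaton.augE {K : Type u} {A : Type v} {Q : Type w} [Semiring K] (𝒜 : KAutomaton K A Q) :
    AugState Q → Option A → AugState Q → K
  | .tru p, some a, .tru q => 𝒜.E a p q
  | .ini, none, .tru q => 𝒜.I q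
  | .tru p, none, .fin => 𝒜.T p
  | _, _, _ => 0

/-! ## The machine

A sequential machine with finitely many registers and with linked hash maps. A register holds a
value: an atom (number, state, letter, weight, `nil`) or a pointer to an immutable pair. Every
elementary operation is charged at least one unit: elementary operations on atoms and pairs,
additions and zero tests in `K` cost one unit each, a hash map access costs in addition the size
of the value which is hashed, and an equality test the sizes of both values. -/

inductive Val (K : Type u) (A : Type v) (Q : Type w) where
  | nil : Val K A Q
  | num (n : ℕ) : Val K A Q
  | state (p : AugState Q) : Val K A Q
  | letter (a : Option A) : Val K A Q
  | weight (k : K) : Val K A Q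
  | cons (x y : Val K A Q) : Val K A Q
deriving DecidableEq

namespace Val

variable {K : Type u} {A : Type v} {Q : Type w}

def size : Val K A Q → ℕ
  | cons x y => 1 + x.size + y.size
  | _ => 1

def car : Val K A Q → Val K A Q
  | cons x _ => x
  | _ => nil

def cdr : Val K A Q → Val K A Q
  | cons _ y => y
  | _ => nil

def succ : Val K A Q → Val K A Q
  | num n => num (n + 1)
  | _ => nil

def add [Semiring K] : Val K A Q → Val K A Q → Val K A Q
  | weight k, weight l => weight (k + l)
  | _, _ => nil

/-- The weight stored in a value, `0` if there is none. -/
def toWeight [Semiring K] : Val K A Q → K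
  | weight k => k
  | _ => 0

/-- The elements of the list `cons x₁ (cons x₂ … nil)`. -/
def elems : Val K A Q → List (Val K A Q)
  | cons x y => x :: y.elems
  | _ => []

def ofList : List (Val K A Q) → Val K A Q
  | [] => nil
  | x :: l => cons x (ofList l)

end Val

/-- A linked hash map: its keys in order of insertion and the value of every key
(`nil` for the absent ones). -/
structure LMap (K : Type u) (A : Type v) (Q : Type w) where
  keys : List (Val K A Q)
  val : Val K A Q → Val K A Q

namespace LMap

variable {K : Type u} {A : Type v} {Q : Type w}

def empty : LMap K A Q := ⟨[], fun _ => .nil⟩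

variable [DecidableEq K] [DecidableEq A] [DecidableEq Q]

def put (M : LMap K A Q) (k v : Val K A Q) : LMap K A Q :=
  ⟨if k ∈ M.keys then M.keys else M.keys ++ [k], Function.update M.val k v⟩

def del (M : LMap K A Q) (k : Val K A Q) : LMap K A Q :=
  ⟨M.keys.erase k, Function.update M.val k .nil⟩

end LMap

/-- Register names. The input is in `states` and `trans`. -/
inductive Reg where
  | states | trans | fresh | split | C | D | p | q | a | k | e | l | w | g | s | key | adj
deriving DecidableEq

/-- Names of the (families of) linked hash maps:
`out`, `inn`: lists of the outgoing and incoming transitions of every state;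
`cls`: the class of every state; `mem`: the family, indexed by classes, of the sets of members;
`que`: the queue of classes; `meet`, `sig`: the maps from which signatures are computed;
`bkt`: buckets of states with the same class and signature;
`don`, `edg`: the classes already treated and the transitions of the computed quotient. -/
inductive Tab where
  | out | inn | cls | mem | que | meet | sig | bkt | don | edg
deriving DecidableEq

structure Store (K : Type u) (A : Type v) (Q : Type w) where
  reg : Reg → Val K A Q
  /-- `tab T i` is the map of index `i` in the family `T` (a single map has index `nil`). -/
  tab : Tab → Val K A Q → LMap K A Q

namespace Store

variable {K : Type u} {A : Type v} {Q : Type w}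
variable [DecidableEq K] [DecidableEq A] [DecidableEq Q]

def setReg (σ : Store K A Q) (r : Reg) (z : Val K A Q) : Store K A Q :=
  { σ with reg := Function.update σ.reg r z }

def setTab (σ : Store K A Q) (T : Tab) (i : Val K A Q) (M : LMap K A Q) : Store K A Q :=
  { σ with tab := Function.update σ.tab T (Function.update (σ.tab T) i M) }

end Store

inductive Expr where
  | reg (r : Reg)
  | nil
  | num (n : ℕ)
  | ini
  | fin
  | cons (e f : Expr)
  | car (e : Expr)
  | cdr (e : Expr)
  | succ (e : Expr)
  | add (e f : Expr)

namespace Expr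

/-- The number of operations in an expression. -/
def cost : Expr → ℕ
  | cons e f => 1 + e.cost + f.cost
  | add e f => 1 + e.cost + f.cost
  | car e => 1 + e.cost
  | cdr e => 1 + e.cost
  | succ e => 1 + e.cost
  | _ => 1

def eval {K : Type u} {A : Type v} {Q : Type w} [Semiring K] (ρ : Reg → Val K A Q) :
    Expr → Val K A Q
  | reg r => ρ r
  | nil => .nil
  | num n => .num n
  | ini => .state .ini
  | fin => .state .fin
  | cons e f => .cons (e.eval ρ) (f.eval ρ)
  | car e => (e.eval ρ).car
  | cdr e => (e.eval ρ).cdr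
  | succ e => (e.eval ρ).succ
  | add e f => (e.eval ρ).add (f.eval ρ)

end Expr

inductive Test where
  | isNil (e : Expr)
  | isZero (e : Expr)
  | eq (e f : Expr)
  | isEmpty (T : Tab) (i : Expr)
  | hasKey (T : Tab) (i k : Expr)
  | not (b : Test)

inductive Cmd where
  | skip
  /-- `r := e` -/
  | set (r : Reg) (e : Expr)
  /-- `r := T[i][k]` -/
  | get (r : Reg) (T : Tab) (i k : Expr)
  /-- `T[i][k] := e` -/
  | put (T : Tab) (i k e : Expr)
  /-- removal of the key `k` from `T[i]` -/
  | del (T : Tab) (i k : Expr)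
  /-- extraction of the first key of `T[i]`, which is stored in `r` -/
  | pop (r : Reg) (T : Tab) (i : Expr)
  /-- `T[i]` becomes a new empty map -/
  | clear (T : Tab) (i : Expr)
  | seq (c d : Cmd)
  | ite (b : Test) (c d : Cmd)
  /-- iteration over the elements of the list `e` -/
  | forList (r : Reg) (e : Expr) (c : Cmd)
  /-- iteration over the keys which `T[i]` has when the loop starts -/
  | forKeys (r : Reg) (T : Tab) (i : Expr) (c : Cmd)
  | loop (b : Test) (c : Cmd)

section Semantics

variable {K : Type u} {A : Type v} {Q : Type w}

/-- Sequential composition; the costs add up. -/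
def andThen (r : Option (Store K A Q × ℕ)) (f : Store K A Q → Option (Store K A Q × ℕ)) :
    Option (Store K A Q × ℕ) :=
  r.bind fun y => (f y.1).map fun z => (z.1, y.2 + z.2)

theorem andThen_eq_some {r : Option (Store K A Q × ℕ)}
    {f : Store K A Q → Option (Store K A Q × ℕ)} {z : Store K A Q × ℕ} :
    andThen r f = some z ↔ ∃ y y', r = some y ∧ f y.1 = some y' ∧ (y'.1, y.2 + y'.2) = z := by
  simp only [andThen, Option.bind_eq_some_iff, Option.map_eq_some_iff]
  constructor
  · rintro ⟨y, h, y', h', e⟩; exact ⟨y, y', h, h', e⟩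
  · rintro ⟨y, y', h, h', e⟩; exact ⟨y, h, y', h', e⟩

/-- Iteration over a list; every iteration costs one unit more than its body. -/
def forLoop (body : Store K A Q → Option (Store K A Q × ℕ)) (r : Reg) :
    List (Val K A Q) → Store K A Q → Option (Store K A Q × ℕ)
  | [], σ => some (σ, 0)
  | z :: l, σ => andThen (andThen (some (σ.setReg r z, 1)) body) (forLoop body r l)

/-- Conditional iteration, `none` if it is not finished after `fuel` evaluations of the test. -/
def whileLoop (test : Store K A Q → Bool) (cost : Store K A Q → ℕ)
    (body : Store K A Q → Option (Store K A Q × ℕ)) :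
    ℕ → Store K A Q → Option (Store K A Q × ℕ)
  | 0, _ => none
  | fuel + 1, σ =>
    if test σ then
      andThen (andThen (some (σ, cost σ)) body) (whileLoop test cost body fuel)
    else some (σ, cost σ)

variable [Semiring K] [DecidableEq K] [DecidableEq A] [DecidableEq Q]

def Test.holds (σ : Store K A Q) : Test → Bool
  | isNil e => e.eval σ.reg = .nil
  | isZero e => e.eval σ.reg = .weight 0
  | eq e f => e.eval σ.reg = f.eval σ.reg
  | isEmpty T i => (σ.tab T (i.eval σ.reg)).keys.isEmpty
  | hasKey T i k => k.eval σ.reg ∈ (σ.tab T (i.eval σ.reg)).keys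
  | not b => !(b.holds σ)

/-- Evaluation of `e`, and then hashing of its value. -/
def hashCost (σ : Store K A Q) (e : Expr) : ℕ := e.cost + (e.eval σ.reg).size

def Test.cost (σ : Store K A Q) : Test → ℕ
  | isNil e => 1 + e.cost
  | isZero e => 1 + e.cost
  | eq e f => 1 + hashCost σ e + hashCost σ f
  | isEmpty _ i => 1 + hashCost σ i
  | hasKey _ i k => 1 + hashCost σ i + hashCost σ k
  | not b => 1 + b.cost σ

/-- `c.run fuel σ` is the final store and the running time of the execution of `c` from `σ`, or
`none` if some loop is not finished after `fuel` evaluations of its test. -/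
def Cmd.run (fuel : ℕ) : Cmd → Store K A Q → Option (Store K A Q × ℕ)
  | skip, σ => some (σ, 1)
  | set r e, σ => some (σ.setReg r (e.eval σ.reg), 1 + e.cost)
  | get r T i k, σ =>
    some (σ.setReg r ((σ.tab T (i.eval σ.reg)).val (k.eval σ.reg)),
      1 + hashCost σ i + hashCost σ k)
  | put T i k e, σ =>
    some (σ.setTab T (i.eval σ.reg)
        ((σ.tab T (i.eval σ.reg)).put (k.eval σ.reg) (e.eval σ.reg)),
      1 + hashCost σ i + hashCost σ k + e.cost)
  | del T i k, σ =>
    some (σ.setTab T (i.eval σ.reg) ((σ.tab T (i.eval σ.reg)).del (k.eval σ.reg)),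
      1 + hashCost σ i + hashCost σ k)
  | pop r T i, σ =>
    let z := (σ.tab T (i.eval σ.reg)).keys.headD .nil
    some ((σ.setTab T (i.eval σ.reg) ((σ.tab T (i.eval σ.reg)).del z)).setReg r z,
      1 + hashCost σ i + z.size)
  | clear T i, σ => some (σ.setTab T (i.eval σ.reg) LMap.empty, 1 + hashCost σ i)
  | seq c d, σ => andThen (c.run fuel σ) (d.run fuel)
  | ite b c d, σ =>
    andThen (some (σ, b.cost σ)) (if b.holds σ then c.run fuel else d.run fuel)
  | forList r e c, σ =>
    andThen (some (σ, 1 + e.cost)) (forLoop (c.run fuel) r (e.eval σ.reg).elems)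
  | forKeys r T i c, σ =>
    andThen (some (σ, 1 + hashCost σ i))
      (forLoop (c.run fuel) r (σ.tab T (i.eval σ.reg)).keys)
  | loop b c, σ => whileLoop (fun τ => b.holds τ) (fun τ => b.cost τ) (c.run fuel) fuel σ

/-- The execution of `c` from `σ` halts in the store `τ` after time `t`. -/
def Cmd.Halts (c : Cmd) (σ τ : Store K A Q) (t : ℕ) : Prop :=
  ∃ fuel, c.run fuel σ = some (τ, t)

theorem Cmd.run_mono {f g : ℕ} (hfg : f ≤ g) (c : Cmd) :
    ∀ (σ : Store K A Q) (z), c.run f σ = some z → c.run g σ = some z := by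
  have hfor : ∀ (b b' : Store K A Q → Option (Store K A Q × ℕ)) (r : Reg),
      (∀ σ z, b σ = some z → b' σ = some z) →
      ∀ l σ z, forLoop b r l σ = some z → forLoop b' r l σ = some z := by
    intro b b' r hb l
    induction l with
    | nil => intro σ z h; exact h
    | cons y l ih =>
      intro σ z h
      simp only [forLoop, andThen_eq_some] at h ⊢
      obtain ⟨y1, y2, ⟨y3, y4, h1, h2, h3⟩, h4, h5⟩ := h
      exact ⟨y1, y2, ⟨y3, y4, h1, hb _ _ h2, h3⟩, ih _ _ h4, h5⟩
  induction c with
  | seq c d ihc ihd =>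
    intro σ z h
    simp only [Cmd.run, andThen_eq_some] at h ⊢
    obtain ⟨y, y', h1, h2, h3⟩ := h
    exact ⟨y, y', ihc _ _ h1, ihd _ _ h2, h3⟩
  | ite b c d ihc ihd =>
    intro σ z h
    simp only [Cmd.run, andThen_eq_some] at h ⊢
    obtain ⟨y, y', h1, h2, h3⟩ := h
    refine ⟨y, y', h1, ?_, h3⟩
    split at h2
    · rw [if_pos ‹_›]; exact ihc _ _ h2
    · rw [if_neg ‹_›]; exact ihd _ _ h2
  | forList r e c ih =>
    intro σ z h
    simp only [Cmd.run, andThen_eq_some] at h ⊢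
    obtain ⟨y, y', h1, h2, h3⟩ := h
    exact ⟨y, y', h1, hfor _ _ r ih _ _ _ h2, h3⟩
  | forKeys r T i c ih =>
    intro σ z h
    simp only [Cmd.run, andThen_eq_some] at h ⊢
    obtain ⟨y, y', h1, h2, h3⟩ := h
    exact ⟨y, y', h1, hfor _ _ r ih _ _ _ h2, h3⟩
  | loop b c ih =>
    have key : ∀ (m k : ℕ), m ≤ k → ∀ (σ : Store K A Q) (z),
        whileLoop (fun τ => b.holds τ) (fun τ => b.cost τ) (c.run f) m σ = some z →
        whileLoop (fun τ => b.holds τ) (fun τ => b.cost τ) (c.run g) k σ = some z := by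
      intro m
      induction m with
      | zero => intro k _ σ z h; simp [whileLoop] at h
      | succ m ihm =>
        intro k hk σ z h
        obtain ⟨k, rfl⟩ : ∃ k', k = k' + 1 := ⟨k - 1, by omega⟩
        simp only [whileLoop] at h ⊢
        split at h
        · rw [if_pos ‹_›]
          simp only [andThen_eq_some] at h ⊢
          obtain ⟨y1, y2, ⟨y3, y4, h1, h2, h3⟩, h4, h5⟩ := h
          exact ⟨y1, y2, ⟨y3, y4, h1, ih _ _ h2, h3⟩, ihm k (by omega) _ _ h4, h5⟩
        · rw [if_neg ‹_›]; exact h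
    intro σ z h
    exact key f g hfg σ z h
  | _ => intro σ z h; exact h

/-- The machine is deterministic: the final store and the running time are unique. -/
theorem Cmd.Halts.unique {c : Cmd} {σ τ τ' : Store K A Q} {t t' : ℕ}
    (h : c.Halts σ τ t) (h' : c.Halts σ τ' t') : τ = τ' ∧ t = t' := by
  obtain ⟨f, hf⟩ := h
  obtain ⟨g, hg⟩ := h'
  have h1 := Cmd.run_mono (le_max_left f g) c σ _ hf
  have h2 := Cmd.run_mono (le_max_right f g) c σ _ hg
  rw [h1] at h2
  simpa using h2

end Semantics

/-! ## The two algorithms -/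

namespace Cmd

open Expr (reg car cdr cons)

def block : List Cmd → Cmd
  | [] => skip
  | [c] => c
  | c :: l => seq c (block l)

/-- Adjacency lists and initial partition: the class `0` is `{i}`, the class `1` is the set of true
states, and the class `2` is `{t}`. A transition of the input is a tuple `(p, a, k, q)`. -/
def build : Cmd := block [
  put .cls .nil .ini (.num 0),
  put .mem (.num 0) .ini .nil,
  put .cls .nil .fin (.num 2),
  put .mem (.num 2) .fin .nil,
  set .fresh (.num 3),
  forList .p (reg .states) (block [
    put .cls .nil (reg .p) (.num 1),
    put .mem (.num 1) (reg .p) .nil]),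
  forList .e (reg .trans) (block [
    set .p (car (reg .e)),
    set .a (car (cdr (reg .e))),
    set .k (car (cdr (cdr (reg .e)))),
    set .q (cdr (cdr (cdr (reg .e)))),
    get .l .out .nil (reg .p),
    put .out .nil (reg .p) (cons (cons (reg .a) (cons (reg .k) (reg .q))) (reg .l)),
    get .l .inn .nil (reg .q),
    put .inn .nil (reg .q) (cons (cons (reg .a) (cons (reg .k) (reg .p))) (reg .l))])]

/-- Special insertion of `(z, k)` into the list `T[key]`: if the last inserted pair is `(z, k')`,
it is replaced by `(z, k' + k)`, and removed if `k' + k` is zero. -/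
def specialInsert (T : Tab) (key z : Expr) : Cmd := block [
  get .l T .nil key,
  ite (.eq (car (car (reg .l))) z)
    (block [
      set .w (.add (cdr (car (reg .l))) (reg .k)),
      ite (.isZero (reg .w))
        (put T .nil key (cdr (reg .l)))
        (put T .nil key (cons (cons z (reg .w)) (cdr (reg .l))))])
    (put T .nil key (cons (cons z (reg .k)) (reg .l)))]

/-- Insertion of the state `p`, of class `C` and signature `s`, into its bucket. -/
def toBucket : Cmd := block [
  get .g .bkt .nil (cons (reg .C) (reg .s)),
  put .bkt .nil (cons (reg .C) (reg .s)) (cons (reg .p) (reg .g))]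

/-- For every bucket, its states are removed from their class `C`. If nothing remains in `C`, they
are put back, and `kept` is executed; otherwise they form a new class `D`, and `moved` is
executed. -/
def splitBuckets (kept moved : Cmd) : Cmd :=
  forKeys .key .bkt .nil (block [
    set .C (car (reg .key)),
    get .g .bkt .nil (reg .key),
    forList .p (reg .g) (del .mem (reg .C) (reg .p)),
    ite (.isEmpty .mem (reg .C))
      (block [
        forList .p (reg .g) (put .mem (reg .C) (reg .p) .nil),
        kept])
      (block [
        set .D (reg .fresh),
        set .fresh (.succ (reg .fresh)),
        forList .p (reg .g) (block [
          put .mem (reg .D) (reg .p) .nil,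
          put .cls .nil (reg .p) (reg .D)]),
        moved])])

/-- The quotient by the final partition: for every class, the outgoing transitions of one
representative, gathered by label and class of the destination. -/
def emitClass : Cmd := block [
  get .C .cls .nil (reg .p),
  ite (.hasKey .don .nil (reg .C)) skip (block [
    put .don .nil (reg .C) .nil,
    get .adj .out .nil (reg .p),
    forList .e (reg .adj) (block [
      set .a (car (reg .e)),
      set .k (car (cdr (reg .e))),
      set .q (cdr (cdr (reg .e))),
      get .D .cls .nil (reg .q),
      set .key (cons (reg .C) (cons (reg .a) (reg .D))),
      get .w .edg .nil (reg .key),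
      ite (.isNil (reg .w))
        (put .edg .nil (reg .key) (reg .k))
        (put .edg .nil (reg .key) (.add (reg .w) (reg .k)))])])]

def emit : Cmd := block [
  set .p .ini,
  emitClass,
  forList .p (reg .states) emitClass]

/-- Global signatures of the states of `C`. -/
def dsaSignatures : Cmd := block [
  clear .meet .nil,
  forKeys .p .mem (reg .C) (block [
    get .adj .out .nil (reg .p),
    forList .e (reg .adj) (block [
      set .a (car (reg .e)),
      set .k (car (cdr (reg .e))),
      set .q (cdr (cdr (reg .e))),
      get .D .cls .nil (reg .q),
      specialInsert .meet (cons (reg .a) (reg .D)) (reg .p)])]),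
  clear .sig .nil,
  forKeys .key .meet .nil (block [
    get .adj .meet .nil (reg .key),
    forList .e (reg .adj) (block [
      set .p (car (reg .e)),
      get .s .sig .nil (reg .p),
      put .sig .nil (reg .p) (cons (cons (reg .key) (cdr (reg .e))) (reg .s))])])]

/-- Insertion into the queue of the class with list of states `g`, unless it is a singleton. -/
def enqueue (c : Expr) : Cmd :=
  ite (.isNil (cdr (reg .g))) skip (put .que .nil c .nil)

/-- An iteration of the Domain Split Algorithm: extraction and split of the class `C`. -/
def dsaIteration : Cmd := block [
  del .que .nil (reg .C),
  dsaSignatures,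
  clear .bkt .nil,
  forKeys .p .mem (reg .C) (block [
    get .s .sig .nil (reg .p),
    toBucket]),
  splitBuckets
    (enqueue (reg .C))
    (block [set .split (.num 1), enqueue (reg .D)])]

/-- The Domain Split Algorithm. Each execution of the body of the loop is a round; the
algorithm halts after a round without split. -/
def dsa : Cmd := block [
  build,
  put .que .nil (.num 1) .nil,
  set .split (.num 1),
  loop (.not (.isNil (reg .split))) (block [
    set .split .nil,
    forKeys .C .que .nil dsaIteration]),
  emit]

/-- Signatures, with respect to `D`, of the predecessors of states of `D`. -/
def pcsaSignatures : Cmd := block [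
  clear .meet .nil,
  forKeys .q .mem (reg .D) (block [
    get .adj .inn .nil (reg .q),
    forList .e (reg .adj) (block [
      set .a (car (reg .e)),
      set .k (car (cdr (reg .e))),
      set .p (cdr (cdr (reg .e))),
      get .l .meet .nil (reg .a),
      put .meet .nil (reg .a) (cons (cons (reg .p) (reg .k)) (reg .l))])]),
  clear .sig .nil,
  forKeys .a .meet .nil (block [
    get .adj .meet .nil (reg .a),
    forList .e (reg .adj) (block [
      set .p (car (reg .e)),
      set .k (cdr (reg .e)),
      specialInsert .sig (reg .p) (reg .a)])])]

/-- An iteration of the Predecessor Class Split Algorithm: extraction of a class `D` and split of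
the classes by `D`. Only the states with a nonzero signature are moved. -/
def pcsaIteration : Cmd := block [
  pop .D .que .nil,
  pcsaSignatures,
  clear .bkt .nil,
  forKeys .p .sig .nil (block [
    get .s .sig .nil (reg .p),
    ite (.isNil (reg .s)) skip (block [
      get .C .cls .nil (reg .p),
      toBucket])]),
  splitBuckets
    skip
    (block [
      put .que .nil (reg .D) .nil,
      put .que .nil (reg .C) .nil])]

/-- The Predecessor Class Split Algorithm. -/
def pcsa : Cmd := block [
  build,
  put .que .nil (.num 1) .nil,
  put .que .nil (.num 2) .nil,
  loop (.not (.isEmpty .que .nil)) pcsaIteration,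
  emit]

end Cmd

/-! ## Input and output -/

section InputOutput

variable {K : Type u} {A : Type v} {Q : Type w}

/-- `states` and `trans` list, without repetition and in any order, the true states and the
transitions `(p, a, k, q)` of the augmented automaton of `𝒜`. -/
structure KAutomaton.IsListing [Semiring K] (𝒜 : KAutomaton K A Q) (states : List Q)
    (trans : List (AugState Q × Option A × K × AugState Q)) : Prop where
  states_nodup : states.Nodup
  mem_states : ∀ q, q ∈ states
  trans_nodup : trans.Nodup
  mem_trans : ∀ p a k q, (p, a, k, q) ∈ trans ↔ k = 𝒜.augE p a q ∧ k ≠ 0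

/-- The initial store: the lists in the two input registers, and nothing elsewhere. -/
def inputStore (states : List Q) (trans : List (AugState Q × Option A × K × AugState Q)) :
    Store K A Q where
  reg
    | .states => .ofList (states.map fun q => .state (.tru q))
    | .trans => .ofList (trans.map fun e =>
        .cons (.state e.1) (.cons (.letter e.2.1) (.cons (.weight e.2.2.1) (.state e.2.2.2))))
    | _ => .nil
  tab _ _ := LMap.empty

namespace Store

/-- The computed class of a state. -/
def classOf (σ : Store K A Q) (p : AugState Q) : Val K A Q := (σ.tab .cls .nil).val (.state p)

/-- The states of the computed automaton: the computed classes of the true states. -/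
abbrev OutState (σ : Store K A Q) : Type (max u v w) :=
  {z : Val K A Q // z ∈ Set.range fun q : Q => σ.classOf (.tru q)}

/-- The map which sends every state to its computed class. -/
def outMap (σ : Store K A Q) (q : Q) : σ.OutState := ⟨σ.classOf (.tru q), q, rfl⟩

/-- The weight which the map `edg` of computed transitions contains at `(c, a, d)`. -/
def edge [Semiring K] (σ : Store K A Q) (c : Val K A Q) (a : Option A) (d : Val K A Q) : K :=
  ((σ.tab .edg .nil).val (.cons c (.cons (.letter a) d))).toWeight

/-- The computed automaton, read in the final store. -/
def outAutomaton [Semiring K] (σ : Store K A Q) : KAutomaton K A σ.OutState where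
  I c := σ.edge (σ.classOf .ini) none c.1
  E a c d := σ.edge c.1 (some a) d.1
  T c := σ.edge c.1 none (σ.classOf .fin)

instance [Fintype Q] [DecidableEq K] [DecidableEq A] [DecidableEq Q] (σ : Store K A Q) :
    Fintype σ.OutState :=
  Set.fintypeRange _

end Store

end InputOutput

/-! ## Weakest preconditions -/

namespace Val

variable {K : Type u} {A : Type v} {Q : Type w}

/-! Call a partition of the augmented states stable if, for every letter, the states of a class have
the same total weight into each class. Among the refinements of `{{i}, Q, {t}}`, stability is what
makes the transitions of one representative define a quotient (`isMorphism_outMap`). Conversely, the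
kernel of a morphism, completed by equality on `i` and `t`, is a congruence: related states have
equal weights into every union of its blocks (`isCongruence`). Both algorithms only separate states
whose weights into some current class differ. As long as the partition is coarser than a congruence,
its classes are unions of congruence blocks, so congruent states are never separated
(`Between.split`). A stable partition reached in this way is therefore coarser than the kernel of
every morphism. Hence `outMap` factors through every morphism, and the factor is itself a morphism
(`IsMorphism.of_comp`); this is universality, and surjectivity of the factor gives the least number
of states.

A signature is computed as a list of pairs. The lists of all states are filled key by key, in the
insertion order of one linked map, and zero sums are removed; hence equal signatures give identical
lists (`nzList_eq_iff`), which can serve as hash keys for buckets. Every pair of the list comes from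
at least one arc, so signatures are no longer than the arcs they summarise. An iteration is thus
linear in the states of the extracted class and their outgoing (DSA) or incoming (PCSA) arcs; see
`wp_dsaSignatures`, `wp_pcsaSignatures` and `wp_splitBuckets`.

For DSA, the classes treated in a round are disjoint, so a round takes time `O(n + m)`; each round
but the last creates a class, so there are `O(n)` rounds (`wp_dsa`). For PCSA the count is
amortised. Give each state the size of its class, plus one if the class is queued. Extraction lowers
this number by one for the states scanned, and a split never raises it, since the loss of at least
one state pays for the return to the queue (`rank_le_of_splitBy`). Each state, with its incoming
arcs, is thus scanned `O(n)` times (`potential_del_split`).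

Halting, correctness and running time are proved together: `wp` asserts a terminating run whose
final store and exact cost satisfy a postcondition. -/

@[simp] theorem elems_ofList (l : List (Val K A Q)) : (ofList l).elems = l := by
  induction l with
  | nil => rfl
  | cons x l ih => simp [ofList, elems, ih]

end Val

namespace LMap

variable {K : Type u} {A : Type v} {Q : Type w}

/-- The keys are distinct, and the absent keys have the value `nil`. -/
def WF (M : LMap K A Q) : Prop := M.keys.Nodup ∧ ∀ k, k ∉ M.keys → M.val k = .nil

theorem wf_empty : (empty : LMap K A Q).WF := ⟨List.nodup_nil, fun _ _ => rfl⟩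

@[simp] theorem keys_empty : (empty : LMap K A Q).keys = [] := rfl

@[simp] theorem val_empty (k : Val K A Q) : (empty : LMap K A Q).val k = .nil := rfl

variable [DecidableEq K] [DecidableEq A] [DecidableEq Q]

@[simp] theorem mem_keys_put (M : LMap K A Q) (k v z : Val K A Q) :
    z ∈ (M.put k v).keys ↔ z = k ∨ z ∈ M.keys := by
  unfold put
  by_cases h : k ∈ M.keys
  · simp only [h, if_true]
    constructor
    · exact Or.inr
    · rintro (rfl | h') <;> assumption
  · simp only [h, if_false, List.mem_append, List.mem_singleton]
    tauto

theorem val_put (M : LMap K A Q) (k v z : Val K A Q) :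
    (M.put k v).val z = if z = k then v else M.val z := by
  simp [put, Function.update_apply]

theorem length_keys_put_le (M : LMap K A Q) (k v : Val K A Q) :
    (M.put k v).keys.length ≤ M.keys.length + 1 := by
  unfold put
  by_cases h : k ∈ M.keys <;> simp [h]

theorem WF.put {M : LMap K A Q} (h : M.WF) (k v : Val K A Q) : (M.put k v).WF := by
  constructor
  · unfold LMap.put
    by_cases hk : k ∈ M.keys
    · simpa [hk] using h.1
    · simp only [hk, if_false]
      exact List.nodup_append.2 ⟨h.1, by simp, by
        intro a ha b hb; simp at hb; subst hb; rintro rfl; exact hk ha⟩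
  · intro z hz
    rw [mem_keys_put, not_or] at hz
    rw [val_put, if_neg hz.1, h.2 _ hz.2]

theorem WF.mem_keys_del {M : LMap K A Q} (h : M.WF) (k z : Val K A Q) :
    z ∈ (M.del k).keys ↔ z ≠ k ∧ z ∈ M.keys := by
  simp [del, h.1.mem_erase_iff]

theorem WF.del {M : LMap K A Q} (h : M.WF) (k : Val K A Q) : (M.del k).WF := by
  constructor
  · exact h.1.erase _
  · intro z hz
    rw [h.mem_keys_del] at hz
    simp only [LMap.del, Function.update_apply]
    split_ifs with hzk
    · rfl
    · exact h.2 z (by tauto)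

end LMap

namespace Store

variable {K : Type u} {A : Type v} {Q : Type w}

/-- All the maps of the store are well-formed. -/
def WF (σ : Store K A Q) : Prop := ∀ T i, (σ.tab T i).WF

@[simp] theorem reg_setReg (σ : Store K A Q) (r r' : Reg) (z : Val K A Q) :
    (σ.setReg r z).reg r' = if r' = r then z else σ.reg r' := by
  simp [setReg, Function.update_apply]

@[simp] theorem tab_setReg (σ : Store K A Q) (r : Reg) (z : Val K A Q) :
    (σ.setReg r z).tab = σ.tab := rfl

theorem WF.setReg {σ : Store K A Q} (h : σ.WF) (r : Reg) (z : Val K A Q) : (σ.setReg r z).WF := h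

variable [DecidableEq K] [DecidableEq A] [DecidableEq Q]

@[simp] theorem reg_setTab (σ : Store K A Q) (T : Tab) (i : Val K A Q) (M : LMap K A Q) :
    (σ.setTab T i M).reg = σ.reg := rfl

@[simp] theorem tab_setTab (σ : Store K A Q) (T U : Tab) (i j : Val K A Q) (M : LMap K A Q) :
    (σ.setTab T i M).tab U j = if U = T ∧ j = i then M else σ.tab U j := by
  simp only [setTab, Function.update_apply]
  by_cases h : U = T
  · subst h; simp [Function.update_apply]
  · simp [h]

theorem WF.setTab {σ : Store K A Q} (h : σ.WF) (T : Tab) (i : Val K A Q) {M : LMap K A Q}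
    (hM : M.WF) : (σ.setTab T i M).WF := by
  intro U j
  rw [tab_setTab]
  split_ifs
  · exact hM
  · exact h U j

end Store

/-! ### Frames, and rules for total correctness with running time -/

namespace Cmd

/-- The registers which a command may change. -/
def writesReg : Cmd → Reg → Bool
  | set r _, r' => r' = r
  | get r _ _ _, r' => r' = r
  | pop r _ _, r' => r' = r
  | seq c d, r' => c.writesReg r' || d.writesReg r'
  | ite _ c d, r' => c.writesReg r' || d.writesReg r'
  | forList r _ c, r' => r' = r || c.writesReg r'
  | forKeys r _ _ c, r' => r' = r || c.writesReg r'
  | loop _ c, r' => c.writesReg r'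
  | _, _ => false

/-- The families of maps which a command may change. -/
def writesTab : Cmd → Tab → Bool
  | put T _ _ _, U => U = T
  | del T _ _, U => U = T
  | pop _ T _, U => U = T
  | clear T _, U => U = T
  | seq c d, U => c.writesTab U || d.writesTab U
  | ite _ c d, U => c.writesTab U || d.writesTab U
  | forList _ _ c, U => c.writesTab U
  | forKeys _ _ _ c, U => c.writesTab U
  | loop _ c, U => c.writesTab U
  | _, _ => false

variable {K : Type u} {A : Type v} {Q : Type w}

/-- `τ` differs from `σ` only where `c` may write, and is well-formed if `σ` is. -/
structure Frame (c : Cmd) (σ τ : Store K A Q) : Prop where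
  reg : ∀ r, c.writesReg r = false → τ.reg r = σ.reg r
  tab : ∀ T, c.writesTab T = false → τ.tab T = σ.tab T
  wf : σ.WF → τ.WF

theorem Frame.refl (c : Cmd) (σ : Store K A Q) : c.Frame σ σ :=
  ⟨fun _ _ => rfl, fun _ _ => rfl, id⟩

theorem Frame.trans {c : Cmd} {σ τ ρ : Store K A Q} (h : c.Frame σ τ) (h' : c.Frame τ ρ) :
    c.Frame σ ρ :=
  ⟨fun r hr => (h'.reg r hr).trans (h.reg r hr), fun T hT => (h'.tab T hT).trans (h.tab T hT),
    fun hσ => h'.wf (h.wf hσ)⟩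

theorem Frame.mono {c d : Cmd} {σ τ : Store K A Q} (h : c.Frame σ τ)
    (hr : ∀ r, d.writesReg r = false → c.writesReg r = false)
    (ht : ∀ T, d.writesTab T = false → c.writesTab T = false) : d.Frame σ τ :=
  ⟨fun r h' => h.reg r (hr r h'), fun T h' => h.tab T (ht T h'), h.wf⟩

theorem frame_setReg {c : Cmd} {r : Reg} (hr : c.writesReg r = true) (σ : Store K A Q)
    (z : Val K A Q) : c.Frame σ (σ.setReg r z) :=
  ⟨fun r' hr' => by
    rw [Store.reg_setReg, if_neg]; rintro rfl; simp [hr] at hr',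
    fun _ _ => rfl, fun h => h.setReg r z⟩

theorem frame_forLoop {c : Cmd} {b : Store K A Q → Option (Store K A Q × ℕ)} {r : Reg}
    (hr : c.writesReg r = true) (hb : ∀ σ y, b σ = some y → c.Frame σ y.1) :
    ∀ l σ y, forLoop b r l σ = some y → c.Frame σ y.1 := by
  intro l
  induction l with
  | nil => intro σ y h; simp only [forLoop, Option.some.injEq] at h; subst h; exact Frame.refl _ _
  | cons z l ih =>
    intro σ y h
    simp only [forLoop, andThen_eq_some] at h
    obtain ⟨y1, y2, ⟨y3, y4, h1, h2, h3⟩, h4, h5⟩ := h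
    cases h1; subst h3; subst h5
    exact ((frame_setReg hr σ z).trans (hb _ _ h2)).trans (ih _ y2 h4)

variable [DecidableEq K] [DecidableEq A] [DecidableEq Q]

theorem frame_setTab {c : Cmd} {T : Tab} (hT : c.writesTab T = true) (σ : Store K A Q)
    (i : Val K A Q) {M : LMap K A Q} (hM : σ.WF → M.WF) : c.Frame σ (σ.setTab T i M) :=
  ⟨fun _ _ => rfl, fun U hU => by
    funext j
    rw [Store.tab_setTab, if_neg]
    rintro ⟨rfl, _⟩; simp [hT] at hU,
    fun h => h.setTab T i (hM h)⟩

variable [Semiring K]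

/-- What a command may change is read off its syntax, so the preservation of a given register or map
across a whole subprogram reduces to a Boolean computation closed by `decide`. Invariants then only
need to mention what their loop modifies. -/
theorem frame_of_run (f : ℕ) (c : Cmd) :
    ∀ (σ : Store K A Q) (y), c.run f σ = some y → c.Frame σ y.1 := by
  induction c with
  | skip => intro σ y h; cases h; exact Frame.refl _ _
  | set r e => intro σ y h; cases h; exact frame_setReg (by simp [writesReg]) _ _
  | get r T i k => intro σ y h; cases h; exact frame_setReg (by simp [writesReg]) _ _
  | put T i k e =>
    intro σ y h; cases h
    exact frame_setTab (by simp [writesTab]) _ _ fun h => (h _ _).put _ _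
  | del T i k =>
    intro σ y h; cases h
    exact frame_setTab (by simp [writesTab]) _ _ fun h => (h _ _).del _
  | pop r T i =>
    intro σ y h; cases h
    exact (frame_setTab (by simp [writesTab]) _ _ fun h => (h _ _).del _).trans
      (frame_setReg (by simp [writesReg]) _ _)
  | clear T i =>
    intro σ y h; cases h
    exact frame_setTab (by simp [writesTab]) _ _ fun _ => LMap.wf_empty
  | seq c d ihc ihd =>
    intro σ z h
    simp only [Cmd.run, andThen_eq_some] at h
    obtain ⟨y, y', h1, h2, rfl⟩ := h
    exact ((ihc _ _ h1).mono (by simp +contextual [writesReg])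
      (by simp +contextual [writesTab])).trans
      ((ihd _ _ h2).mono (by simp +contextual [writesReg]) (by simp +contextual [writesTab]))
  | ite b c d ihc ihd =>
    intro σ z h
    simp only [Cmd.run, andThen_eq_some] at h
    obtain ⟨y, y', h1, h2, rfl⟩ := h
    cases h1
    split at h2
    · exact (ihc _ _ h2).mono (by simp +contextual [writesReg]) (by simp +contextual [writesTab])
    · exact (ihd _ _ h2).mono (by simp +contextual [writesReg]) (by simp +contextual [writesTab])
  | forList r e c ih =>
    intro σ z h
    simp only [Cmd.run, andThen_eq_some] at h
    obtain ⟨y, y', h1, h2, rfl⟩ := h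
    cases h1
    exact frame_forLoop (r := r) (by simp [writesReg]) (fun τ y hy => (ih _ _ hy).mono
      (by simp +contextual [writesReg]) (by simp +contextual [writesTab])) _ σ y' h2
  | forKeys r T i c ih =>
    intro σ z h
    simp only [Cmd.run, andThen_eq_some] at h
    obtain ⟨y, y', h1, h2, rfl⟩ := h
    cases h1
    exact frame_forLoop (r := r) (by simp [writesReg]) (fun τ y hy => (ih _ _ hy).mono
      (by simp +contextual [writesReg]) (by simp +contextual [writesTab])) _ σ y' h2
  | loop b c ih =>
    have key : ∀ (m : ℕ) (σ : Store K A Q) (z),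
        whileLoop (fun τ => b.holds τ) (fun τ => b.cost τ) (c.run f) m σ = some z →
        c.Frame σ z.1 := by
      intro m
      induction m with
      | zero => intro σ z h; simp [whileLoop] at h
      | succ m ihm =>
        intro σ z h
        simp only [whileLoop] at h
        split at h
        · simp only [andThen_eq_some] at h
          obtain ⟨y1, y2, ⟨y3, y4, h1, h2, h3⟩, h4, h5⟩ := h
          cases h1; subst h3; subst h5
          exact (ih _ _ h2).trans (ihm _ y2 h4)
        · cases h; exact Frame.refl _ _
    intro σ z h
    exact (key f σ z h).mono (fun _ h => h) (fun _ h => h)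

/-- The execution of `c` from `σ` halts, and its final store and running time satisfy `P`. -/
def wp (c : Cmd) (σ : Store K A Q) (P : Store K A Q → ℕ → Prop) : Prop :=
  ∃ τ t, c.Halts σ τ t ∧ P τ t

theorem wp_mono {c : Cmd} {σ : Store K A Q} {P P' : Store K A Q → ℕ → Prop} (h : c.wp σ P)
    (hP : ∀ τ t, c.Frame σ τ → P τ t → P' τ t) : c.wp σ P' := by
  obtain ⟨τ, t, ⟨f, hf⟩, ht⟩ := h
  exact ⟨τ, t, ⟨f, hf⟩, hP τ t (frame_of_run f c σ _ hf) ht⟩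

/-- A command without loops has the same run for every fuel; determinism of the machine upgrades the
implication to an equivalence, so that it can serve as a rewriting rule. -/
theorem wp_of_run {c : Cmd} {σ τ : Store K A Q} {t : ℕ} (h : ∀ f, c.run f σ = some (τ, t))
    (P : Store K A Q → ℕ → Prop) : c.wp σ P ↔ P τ t := by
  constructor
  · rintro ⟨τ', t', h', hP⟩
    obtain ⟨rfl, rfl⟩ := h'.unique ⟨0, h 0⟩
    exact hP
  · exact fun hP => ⟨τ, t, ⟨0, h 0⟩, hP⟩

section Rules

variable (σ : Store K A Q) (P : Store K A Q → ℕ → Prop)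

@[simp] theorem wp_skip : skip.wp σ P ↔ P σ 1 := wp_of_run (fun _ => rfl) P

@[simp] theorem wp_set (r : Reg) (e : Expr) :
    (set r e).wp σ P ↔ P (σ.setReg r (e.eval σ.reg)) (1 + e.cost) := wp_of_run (fun _ => rfl) P

@[simp] theorem wp_get (r : Reg) (T : Tab) (i k : Expr) : (get r T i k).wp σ P ↔
    P (σ.setReg r ((σ.tab T (i.eval σ.reg)).val (k.eval σ.reg)))
      (1 + hashCost σ i + hashCost σ k) := wp_of_run (fun _ => rfl) P

@[simp] theorem wp_put (T : Tab) (i k e : Expr) : (put T i k e).wp σ P ↔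
    P (σ.setTab T (i.eval σ.reg)
        ((σ.tab T (i.eval σ.reg)).put (k.eval σ.reg) (e.eval σ.reg)))
      (1 + hashCost σ i + hashCost σ k + e.cost) := wp_of_run (fun _ => rfl) P

@[simp] theorem wp_del (T : Tab) (i k : Expr) : (del T i k).wp σ P ↔
    P (σ.setTab T (i.eval σ.reg) ((σ.tab T (i.eval σ.reg)).del (k.eval σ.reg)))
      (1 + hashCost σ i + hashCost σ k) := wp_of_run (fun _ => rfl) P

@[simp] theorem wp_pop (r : Reg) (T : Tab) (i : Expr) : (pop r T i).wp σ P ↔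
    P ((σ.setTab T (i.eval σ.reg) ((σ.tab T (i.eval σ.reg)).del
        ((σ.tab T (i.eval σ.reg)).keys.headD .nil))).setReg r
        ((σ.tab T (i.eval σ.reg)).keys.headD .nil))
      (1 + hashCost σ i + ((σ.tab T (i.eval σ.reg)).keys.headD .nil).size) :=
  wp_of_run (fun _ => rfl) P

@[simp] theorem wp_clear (T : Tab) (i : Expr) : (clear T i).wp σ P ↔
    P (σ.setTab T (i.eval σ.reg) LMap.empty) (1 + hashCost σ i) := wp_of_run (fun _ => rfl) P

@[simp] theorem wp_seq (c d : Cmd) : (seq c d).wp σ P ↔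
    c.wp σ fun τ t => d.wp τ fun τ' t' => P τ' (t + t') := by
  constructor
  · rintro ⟨τ, t, ⟨f, hf⟩, hP⟩
    simp only [Cmd.run, andThen_eq_some] at hf
    obtain ⟨y, y', h1, h2, h3⟩ := hf
    cases h3
    exact ⟨_, _, ⟨f, h1⟩, _, _, ⟨f, h2⟩, hP⟩
  · rintro ⟨τ, t, ⟨f, hf⟩, τ', t', ⟨g, hg⟩, hP⟩
    refine ⟨τ', t + t', ⟨max f g, ?_⟩, hP⟩
    simp only [Cmd.run, andThen_eq_some]
    exact ⟨_, _, run_mono (le_max_left f g) c σ _ hf, run_mono (le_max_right f g) d _ _ hg, rfl⟩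

@[simp] theorem wp_ite (b : Test) (c d : Cmd) : (ite b c d).wp σ P ↔
    if b.holds σ then c.wp σ fun τ t => P τ (b.cost σ + t)
    else d.wp σ fun τ t => P τ (b.cost σ + t) := by
  by_cases hb : b.holds σ
  · simp only [hb, if_true]
    constructor
    · rintro ⟨τ, t, ⟨f, hf⟩, hP⟩
      simp only [Cmd.run, andThen_eq_some, hb, if_true] at hf
      obtain ⟨y, y', h1, h2, h3⟩ := hf
      cases h1; cases h3
      exact ⟨_, _, ⟨f, h2⟩, hP⟩
    · rintro ⟨τ, t, ⟨f, hf⟩, hP⟩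
      refine ⟨τ, _, ⟨f, ?_⟩, hP⟩
      simp only [Cmd.run, andThen_eq_some, hb, if_true]
      exact ⟨_, _, rfl, hf, rfl⟩
  · simp only [hb]
    constructor
    · rintro ⟨τ, t, ⟨f, hf⟩, hP⟩
      simp only [Cmd.run, andThen_eq_some, hb] at hf
      obtain ⟨y, y', h1, h2, h3⟩ := hf
      cases h1; cases h3
      exact ⟨_, _, ⟨f, h2⟩, hP⟩
    · rintro ⟨τ, t, ⟨f, hf⟩, hP⟩
      refine ⟨τ, _, ⟨f, ?_⟩, hP⟩
      simp only [Cmd.run, andThen_eq_some, hb]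
      exact ⟨_, _, rfl, hf, rfl⟩

end Rules

/-- Induction on the part of the list still to be treated. Frames are taken with respect to the
enclosing loop `cc`, which also writes the loop register, so that the two kinds of list iteration
share the argument. The fuels of the body and of the rest are merged by monotonicity. -/
theorem forLoop_rule {α : Type*} {c : Cmd} {r : Reg} (g : α → Val K A Q) {cc : Cmd}
    (hr : cc.writesReg r = true)
    (hcr : ∀ r', cc.writesReg r' = false → c.writesReg r' = false)
    (hct : ∀ T, cc.writesTab T = false → c.writesTab T = false)
    (I : List α → Store K A Q → ℕ → Prop) (σ : Store K A Q) :
    ∀ (rest done : List α) (τ : Store K A Q) (t : ℕ), I done τ t → cc.Frame σ τ →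
      (∀ (d : List α) (z : α) (e : List α), done ++ rest = d ++ z :: e →
        ∀ (ρ : Store K A Q) (t : ℕ), I d ρ t → cc.Frame σ ρ →
        c.wp (ρ.setReg r (g z)) fun ρ' t' => I (d ++ [z]) ρ' (t + 1 + t')) →
      ∃ f τ' t', forLoop (c.run f) r (rest.map g) τ = some (τ', t') ∧
        I (done ++ rest) τ' (t + t') := by
  have hfor : ∀ (f f' : ℕ), f ≤ f' → ∀ l (σ : Store K A Q) z,
      forLoop (c.run f) r l σ = some z → forLoop (c.run f') r l σ = some z := by
    intro f f' hff l
    induction l with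
    | nil => intro σ z h; exact h
    | cons y l ih =>
      intro σ z h
      simp only [forLoop, andThen_eq_some] at h ⊢
      obtain ⟨y1, y2, ⟨y3, y4, h1, h2, h3⟩, h4, h5⟩ := h
      exact ⟨y1, y2, ⟨y3, y4, h1, run_mono hff c _ _ h2, h3⟩, ih _ _ h4, h5⟩
  intro rest
  induction rest with
  | nil =>
    intro done τ t hI _ _
    exact ⟨0, τ, 0, rfl, by simpa using hI⟩
  | cons z rest ih =>
    intro done τ t hI hF hstep
    obtain ⟨ρ, t1, ⟨f, hf⟩, h1⟩ := hstep done z rest rfl τ t hI hF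
    have hF' : cc.Frame σ ρ := (hF.trans (frame_setReg hr τ (g z))).trans
      ((frame_of_run _ _ _ _ hf).mono hcr hct)
    obtain ⟨f', τ', t', h2, h3⟩ := ih (done ++ [z]) ρ (t + 1 + t1) h1 hF'
      (by simpa only [List.append_assoc, List.singleton_append] using hstep)
    refine ⟨max f f', τ', 1 + t1 + t', ?_, ?_⟩
    · simp only [List.map_cons, forLoop, andThen_eq_some]
      exact ⟨_, _, ⟨_, _, rfl, run_mono (le_max_left f f') c _ _ hf, rfl⟩,
        hfor _ _ (le_max_right f f') _ _ _ h2, rfl⟩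
    · simpa only [List.append_assoc, List.singleton_append, add_assoc] using h3

/-- Rule for the iteration over a list: `I d τ t` is the invariant, where `d` is the list of the
elements already treated and `t` the time spent. -/
theorem wp_forList {α : Type*} {c : Cmd} {r : Reg} {e : Expr} {σ : Store K A Q}
    {P : Store K A Q → ℕ → Prop} (g : α → Val K A Q) (l : List α)
    (hl : e.eval σ.reg = .ofList (l.map g))
    (I : List α → Store K A Q → ℕ → Prop) (h0 : I [] σ 0)
    (hstep : ∀ (d : List α) (z : α) (d' : List α), l = d ++ z :: d' →
      ∀ (ρ : Store K A Q) (t : ℕ), I d ρ t → (forList r e c).Frame σ ρ →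
      c.wp (ρ.setReg r (g z)) fun ρ' t' => I (d ++ [z]) ρ' (t + 1 + t'))
    (hP : ∀ τ t, (forList r e c).Frame σ τ → I l τ t → P τ (1 + e.cost + t)) :
    (forList r e c).wp σ P := by
  obtain ⟨f, τ, t, h1, h2⟩ := forLoop_rule (c := c) (r := r) (cc := forList r e c) g
    (by simp [writesReg]) (by simp +contextual [writesReg]) (by simp +contextual [writesTab])
    I σ l [] σ 0 h0 (Frame.refl _ _) hstep
  have hrun : (forList r e c).run f σ = some (τ, 1 + e.cost + t) := by
    simp only [Cmd.run, andThen_eq_some]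
    exact ⟨_, (τ, t), rfl, by simpa only [hl, Val.elems_ofList] using h1, rfl⟩
  exact ⟨τ, _, ⟨f, hrun⟩, hP _ _ (frame_of_run _ _ _ _ hrun) (by simpa using h2)⟩

/-- Rule for the iteration over the keys of a map. -/
theorem wp_forKeys {α : Type*} {c : Cmd} {r : Reg} {T : Tab} {i : Expr} {σ : Store K A Q}
    {P : Store K A Q → ℕ → Prop} (g : α → Val K A Q) (l : List α)
    (hl : (σ.tab T (i.eval σ.reg)).keys = l.map g)
    (I : List α → Store K A Q → ℕ → Prop) (h0 : I [] σ 0)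
    (hstep : ∀ (d : List α) (z : α) (d' : List α), l = d ++ z :: d' →
      ∀ (ρ : Store K A Q) (t : ℕ), I d ρ t → (forKeys r T i c).Frame σ ρ →
      c.wp (ρ.setReg r (g z)) fun ρ' t' => I (d ++ [z]) ρ' (t + 1 + t'))
    (hP : ∀ τ t, (forKeys r T i c).Frame σ τ → I l τ t → P τ (1 + hashCost σ i + t)) :
    (forKeys r T i c).wp σ P := by
  obtain ⟨f, τ, t, h1, h2⟩ := forLoop_rule (c := c) (r := r) (cc := forKeys r T i c) g
    (by simp [writesReg]) (by simp +contextual [writesReg]) (by simp +contextual [writesTab])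
    I σ l [] σ 0 h0 (Frame.refl _ _) hstep
  have hrun : (forKeys r T i c).run f σ = some (τ, 1 + hashCost σ i + t) := by
    simp only [Cmd.run, andThen_eq_some]
    exact ⟨_, (τ, t), rfl, by simpa only [hl] using h1, rfl⟩
  exact ⟨τ, _, ⟨f, hrun⟩, hP _ _ (frame_of_run _ _ _ _ hrun) (by simpa using h2)⟩

/-- The fuel bounds both the tests of this loop and those of inner loops, so monotonicity is needed
in the two arguments separately; one extra unit pays for the first test. -/
theorem Halts.loop_step {b : Test} {c : Cmd} {σ τ ρ : Store K A Q} {t t' : ℕ}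
    (hb : b.holds σ = true) (h : c.Halts σ τ t) (h' : (loop b c).Halts τ ρ t') :
    (loop b c).Halts σ ρ (b.cost σ + t + t') := by
  obtain ⟨f, hf⟩ := h
  obtain ⟨g, hg⟩ := h'
  have hmono : ∀ (f g m : ℕ), f ≤ g → ∀ (σ : Store K A Q) z,
      whileLoop (fun τ => b.holds τ) (fun τ => b.cost τ) (c.run f) m σ = some z →
      whileLoop (fun τ => b.holds τ) (fun τ => b.cost τ) (c.run g) m σ = some z := by
    intro f g m hfg
    induction m with
    | zero => intro σ z h; simp [whileLoop] at h
    | succ m ih =>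
      intro σ z h
      simp only [whileLoop] at h ⊢
      split at h
      · rw [if_pos ‹_›]
        simp only [andThen_eq_some] at h ⊢
        obtain ⟨y1, y2, ⟨y3, y4, h1, h2, h3⟩, h4, h5⟩ := h
        exact ⟨y1, y2, ⟨y3, y4, h1, run_mono hfg c _ _ h2, h3⟩, ih _ _ h4, h5⟩
      · rw [if_neg ‹_›]; exact h
  refine ⟨max f g + 1, ?_⟩
  simp only [Cmd.run, whileLoop, hb, if_true, andThen_eq_some]
  refine ⟨_, _, ⟨_, _, rfl, run_mono ((le_max_left f g).trans (Nat.le_succ _)) c _ _ hf, rfl⟩,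
    hmono (max f g) _ _ (Nat.le_succ _) _ _ (run_mono (le_max_right f g) (loop b c) _ _ hg), rfl⟩

/-- Rule for conditional iteration: `I k τ t` is the invariant, where `k` is a number which
decreases and `t` the time spent. -/
theorem wp_loop {b : Test} {c : Cmd} {P : Store K A Q → ℕ → Prop}
    (I : ℕ → Store K A Q → ℕ → Prop)
    (hstep : ∀ k σ t, I k σ t → b.holds σ = true →
      c.wp σ fun τ t' => ∃ k' < k, I k' τ (t + (b.cost σ + t')))
    (k : ℕ) (σ : Store K A Q) (t : ℕ) (hI : I k σ t)
    (hP : ∀ k τ t', I k τ t' → b.holds τ = false → ∀ t'', t + t'' = t' + b.cost τ → P τ t'') :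
    (loop b c).wp σ P := by
  induction k using Nat.strong_induction_on generalizing σ t P with
  | _ k ih =>
    cases hb : b.holds σ with
    | false =>
      refine ⟨σ, b.cost σ, ⟨1, ?_⟩, hP k σ t hI hb _ rfl⟩
      simp [Cmd.run, whileLoop, hb]
    | true =>
      obtain ⟨τ, t1, h1, k', hk, h2⟩ := hstep k σ t hI hb
      -- The invariant counts time from the first entry into the loop, the postcondition from the
      -- current test; the induction hypothesis is used with a postcondition shifted by the cost of
      -- one turn.
      obtain ⟨ρ, t2, h3, h4⟩ := ih k' hk (P := fun ρ t2 => P ρ (b.cost σ + t1 + t2)) τ _ h2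
        (fun k τ t' hI' hb' t'' ht => hP k τ t' hI' hb' _ (by omega))
      exact ⟨ρ, _, Halts.loop_step hb h1 h3, h4⟩

end Cmd

/-! ## Encodings -/

attribute [simp] Expr.eval Expr.cost hashCost Test.holds Test.cost Val.size Val.car Val.cdr
  Val.add Val.succ Cmd.block

section Encodings

variable {K : Type u} {A : Type v} {Q : Type w}

/-- An element of an adjacency list: label, weight, other end. -/
abbrev Arc (K : Type u) (A : Type v) (Q : Type w) := Option A × K × AugState Q

def encArc (e : Arc K A Q) : Val K A Q := .cons (.letter e.1) (.cons (.weight e.2.1) (.state e.2.2))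

def encPairs (l : List (Val K A Q × K)) : Val K A Q :=
  .ofList (l.map fun y => .cons y.1 (.weight y.2))

theorem Val.ofList_injective : Function.Injective (Val.ofList : List (Val K A Q) → Val K A Q) :=
  Function.LeftInverse.injective Val.elems_ofList

/-- This is why comparing or hashing encoded signatures amounts to comparing the signatures. -/
theorem encPairs_injective : Function.Injective (encPairs : List (Val K A Q × K) → Val K A Q) := by
  refine Val.ofList_injective.comp (List.map_injective_iff.2 ?_)
  rintro ⟨y, k⟩ ⟨y', k'⟩ h
  simpa using h

/-- Adds the pair `(z, k)` in front of a list if `k` is not zero. -/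
def insertNZ [Zero K] [DecidableEq K] (z : Val K A Q) (k : K) (l : List (Val K A Q × K)) :
    List (Val K A Q × K) :=
  if k = 0 then l else (z, k) :: l

variable [DecidableEq Q]

/-- The outgoing transitions of `p`, in the order of the adjacency lists built by the programs. -/
def outArcs (trans : List (AugState Q × Option A × K × AugState Q)) (p : AugState Q) :
    List (Arc K A Q) :=
  ((trans.filter fun e => e.1 = p).map fun e => e.2).reverse

def inArcs (trans : List (AugState Q × Option A × K × AugState Q)) (q : AugState Q) :
    List (Arc K A Q) :=
  ((trans.filter fun e => e.2.2.2 = q).map fun e => (e.2.1, e.2.2.1, e.1)).reverse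

end Encodings

namespace Store

variable {K : Type u} {A : Type v} {Q : Type w}

/-- The store represents the partition of the states into the fibres of `cl`, and the first
unused class is `f`. -/
structure Part (σ : Store K A Q) (cl : AugState Q → ℕ) (f : ℕ) : Prop where
  cls : ∀ p, (σ.tab .cls .nil).val (.state p) = .num (cl p)
  mem : ∀ c z, z ∈ (σ.tab .mem (.num c)).keys ↔ ∃ p, z = .state p ∧ cl p = c
  fresh : σ.reg .fresh = .num f
  lt : ∀ p, cl p < f

theorem Part.congr {σ τ : Store K A Q} {cl : AugState Q → ℕ} {f : ℕ} (h : σ.Part cl f)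
    (hc : τ.tab .cls = σ.tab .cls) (hm : τ.tab .mem = σ.tab .mem)
    (hf : τ.reg .fresh = σ.reg .fresh) : τ.Part cl f :=
  ⟨by rw [hc]; exact h.cls, by rw [hm]; exact h.mem, by rw [hf]; exact h.fresh, h.lt⟩

variable [DecidableEq Q]

/-- The store contains the adjacency lists. -/
structure Adj (σ : Store K A Q) (trans : List (AugState Q × Option A × K × AugState Q)) :
    Prop where
  out : ∀ p, (σ.tab .out .nil).val (.state p) = .ofList ((outArcs trans p).map encArc)
  inn : ∀ p, (σ.tab .inn .nil).val (.state p) = .ofList ((inArcs trans p).map encArc)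

theorem Adj.congr {σ τ : Store K A Q} {trans : List (AugState Q × Option A × K × AugState Q)}
    (h : σ.Adj trans) (ho : τ.tab .out = σ.tab .out) (hi : τ.tab .inn = σ.tab .inn) :
    τ.Adj trans :=
  ⟨by rw [ho]; exact h.out, by rw [hi]; exact h.inn⟩

end Store

/-! ### Special insertion, adjacency lists and initial partition -/

namespace Cmd

variable {K : Type u} {A : Type v} {Q : Type w}
theorem wf_inputStore (states : List Q) (trans : List (AugState Q × Option A × K × AugState Q)) :
    (inputStore states trans).WF := fun _ _ => LMap.wf_empty

variable [DecidableEq K] [DecidableEq A] [DecidableEq Q] [Semiring K]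

/-- `s` is the partial sum attached to `x`, and `l` holds the pairs of other names. Looking at the
head only is enough because the insertions for one name into one list are consecutive. The
hypotheses `hy` and `hx` say that `key` and `z` do not read the scratch registers; the sizes in `hl`
and `hxs` bound the cost of the equality test. -/
theorem wp_specialInsert {T : Tab} {key z : Expr} {σ : Store K A Q} {y x : Val K A Q} {s k : K}
    {l : List (Val K A Q × K)}
    (hy : ∀ ρ : Reg → Val K A Q, (∀ r, r ≠ .l → r ≠ .w → ρ r = σ.reg r) → key.eval ρ = y)
    (hx : ∀ ρ : Reg → Val K A Q, (∀ r, r ≠ .l → r ≠ .w → ρ r = σ.reg r) → z.eval ρ = x)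
    (hval : (σ.tab T .nil).val y = encPairs (insertNZ x s l))
    (hl : ∀ e ∈ l, e.1 ≠ x ∧ e.1.size = 1) (hxn : x ≠ .nil) (hxs : x.size = 1)
    (hk : σ.reg .k = .weight k) (hk0 : k ≠ 0) :
    (specialInsert T key z).wp σ fun τ t =>
      τ.tab = (σ.setTab T .nil ((σ.tab T .nil).put y (encPairs (insertNZ x (s + k) l)))).tab ∧
      t ≤ 30 + 2 * key.cost + 2 * y.size + 2 * z.cost := by
  have hy0 := hy σ.reg (fun _ _ _ => rfl)
  have hy1 : ∀ v, key.eval (σ.setReg .l v).reg = y := fun v => hy _ (by simp +contextual)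
  have hy2 : ∀ v v', key.eval ((σ.setReg .l v).setReg .w v').reg = y :=
    fun v v' => hy _ (by simp +contextual)
  have hx1 : ∀ v, z.eval (σ.setReg .l v).reg = x := fun v => hx _ (by simp +contextual)
  have hx2 : ∀ v v', z.eval ((σ.setReg .l v).setReg .w v').reg = x :=
    fun v v' => hx _ (by simp +contextual)
  simp only [specialInsert, block, wp_seq, wp_get, wp_ite, wp_set, wp_put, Test.holds, hashCost,
    Expr.eval, hy0, hval, hy1, hx1, hy2, hx2, Test.cost, Expr.cost, Store.tab_setReg]
  -- With a zero partial sum no pair for `x` is present: the head is another name, or `nil` for an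
  -- empty list, which is why `x ≠ nil` is required. The pair inserted is then legitimate because `k
  -- ≠ 0`.
  by_cases hs : s = 0
  · subst hs
    have h1 : insertNZ x 0 l = l := by simp [insertNZ]
    have h2 : insertNZ x (0 + k) l = (x, k) :: l := by simp [insertNZ, hk0]
    have h3 : (encPairs l).car.car ≠ x := by
      cases l with
      | nil => simpa [encPairs, Val.ofList] using hxn.symm
      | cons e l => simpa [encPairs, Val.ofList] using (hl e (by simp)).1
    have h4 : (encPairs l).car.car.size = 1 := by
      cases l with
      | nil => simp [encPairs, Val.ofList]
      | cons e l => simpa [encPairs, Val.ofList] using (hl e (by simp)).2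
    simp only [h1, h2, Store.reg_setReg, if_true, h3, decide_false, h4, hxs]
    simp only [Bool.false_eq_true, if_false]
    constructor
    · simp [hk, encPairs, Val.ofList, Store.setTab, Store.setReg]
    · simp; omega
  · have h1 : insertNZ x s l = (x, s) :: l := by simp [insertNZ, hs]
    simp only [h1, Store.reg_setReg, if_true, encPairs, Val.ofList, List.map_cons, Val.car, Val.cdr,
      decide_true, hk, reduceCtorEq, if_false, hxs, Val.add]
    by_cases hsk : s + k = 0
    · simp only [hsk, decide_true, if_true, insertNZ]
      constructor
      · simp [Store.setTab, Store.setReg]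
      · simp; omega
    · simp only [insertNZ, hsk, if_false]
      simp only [Val.weight.injEq, hsk, decide_false, Bool.false_eq_true, if_false]
      constructor
      · simp [Store.setTab, Store.setReg, Val.ofList]
      · simp; omega

/-- The initial partition. -/
def initCls : AugState Q → ℕ
  | .ini => 0
  | .tru _ => 1
  | .fin => 2

def encTrans (e : AugState Q × Option A × K × AugState Q) : Val K A Q :=
  .cons (.state e.1) (.cons (.letter e.2.1) (.cons (.weight e.2.2.1) (.state e.2.2.2)))

theorem wp_build (states : List Q) (trans : List (AugState Q × Option A × K × AugState Q))
    (hs : ∀ q, q ∈ states) :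
    build.wp (inputStore states trans) fun τ t =>
      τ.Part initCls 3 ∧ τ.Adj trans ∧ t ≤ 100 * (1 + states.length + trans.length) := by
  simp only [build, block, wp_seq, wp_put, wp_set]
  refine wp_forList (fun q => .state (.tru q)) states rfl
    (fun d τ t => t ≤ 20 * d.length ∧
      (∀ p, (τ.tab .cls .nil).val (.state p) = match p with
        | .ini => .num 0
        | .fin => .num 2
        | .tru q => if q ∈ d then .num 1 else .nil) ∧
      (∀ c z, z ∈ (τ.tab .mem (.num c)).keys ↔ (c = 0 ∧ z = .state .ini) ∨
        (c = 2 ∧ z = .state .fin) ∨ (c = 1 ∧ ∃ q ∈ d, z = .state (.tru q)))) ?_ ?_ ?_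
  · refine ⟨by simp, ?_, ?_⟩
    · intro p
      cases p <;> simp [inputStore, LMap.val_put]
    · intro c z
      by_cases h0 : c = 0 <;> by_cases h2 : c = 2 <;> simp [inputStore, h0, h2]
  · rintro d q d' - ρ t ⟨ht, h1, h2⟩ hF
    simp only [wp_seq, wp_put]
    refine ⟨by simp; omega, ?_, ?_⟩
    · intro p
      have := h1 p
      cases p <;> simp_all [LMap.val_put]
      split_ifs <;> simp_all
    · intro c z
      have := h2 c z
      by_cases h0 : c = 1 <;> simp_all
      grind
  · rintro σ t1 hF1 ⟨ht1, hcls, hmem⟩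
    have hl : σ.reg .trans = .ofList (trans.map encTrans) := by
      rw [hF1.reg _ (by decide)]
      simp [inputStore]
      rfl
    refine wp_forList encTrans trans hl
      (fun d τ t => t ≤ 60 * d.length ∧ τ.Adj d) ?_ ?_ ?_
    · refine ⟨by simp, ?_⟩
      constructor
      · intro p
        rw [hF1.tab _ (by decide)]
        simp [inputStore, outArcs, Val.ofList]
      · intro p
        rw [hF1.tab _ (by decide)]
        simp [inputStore, inArcs, Val.ofList]
    · rintro d ⟨p, a, k, q⟩ d' - ρ t ⟨ht, hA⟩ hF
      simp only [wp_seq, wp_put, wp_set, wp_get]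
      refine ⟨by simp [encTrans]; omega, ?_, ?_⟩
      · intro p'
        have := hA.out p'
        by_cases hp : p' = p
        · subst hp
          simp [encTrans, LMap.val_put, this, outArcs, Val.ofList, encArc]
        · have hp' : ¬ p = p' := fun h => hp h.symm
          simp [encTrans, LMap.val_put, hp, this, outArcs, hp']
      · intro p'
        have := hA.inn p'
        by_cases hp : p' = q
        · subst hp
          simp [encTrans, LMap.val_put, this, inArcs, Val.ofList, encArc]
        · have hp' : ¬ q = p' := fun h => hp h.symm
          simp [encTrans, LMap.val_put, hp, this, inArcs, hp']
    · rintro τ t hF ⟨ht, hA⟩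
      refine ⟨⟨?_, ?_, ?_, ?_⟩, hA, ?_⟩
      · intro p
        rw [hF.tab _ (by decide), hcls]
        cases p <;> simp [initCls, hs]
      · intro c z
        rw [hF.tab _ (by decide), hmem]
        constructor
        · rintro (⟨rfl, rfl⟩ | ⟨rfl, rfl⟩ | ⟨rfl, q, -, rfl⟩) <;> simp [initCls]
        · rintro ⟨p, rfl, rfl⟩
          cases p <;> simp [initCls, hs]
      · rw [hF.reg _ (by decide), hF1.reg _ (by decide)]
        simp
      · intro p; cases p <;> simp [initCls]
      · simp; omega

end Cmd

/-! ## Output of the quotient -/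

section ArcWeight

variable {K : Type u} {A : Type v} {Q : Type w} [Semiring K] [DecidableEq A]

/-- Sum of the weights of the arcs of `l` with label `a` which lead to the class `c`. -/
def arcWeight (cl : AugState Q → ℕ) (l : List (Arc K A Q)) (a : Option A) (c : ℕ) : K :=
  ((l.filter fun e => e.1 = a ∧ cl e.2.2 = c).map fun e => e.2.1).sum

@[simp] theorem arcWeight_nil (cl : AugState Q → ℕ) (a : Option A) (c : ℕ) :
    arcWeight cl ([] : List (Arc K A Q)) a c = 0 := rfl

theorem arcWeight_append_singleton (cl : AugState Q → ℕ) (l : List (Arc K A Q)) (e : Arc K A Q)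
    (a : Option A) (c : ℕ) : arcWeight cl (l ++ [e]) a c =
      if e.1 = a ∧ cl e.2.2 = c then arcWeight cl l a c + e.2.1 else arcWeight cl l a c := by
  unfold arcWeight
  by_cases h : e.1 = a ∧ cl e.2.2 = c <;> simp [List.filter_append, h]

end ArcWeight

/-- The key under which the computed weight from class `c` to class `d` with label `a` is stored. -/
def edgeKey {K : Type u} {A : Type v} {Q : Type w} (c : ℕ) (a : Option A) (d : ℕ) : Val K A Q :=
  .cons (.num c) (.cons (.letter a) (.num d))

/-- The transitions out of the classes listed in `don` are those of a representative. -/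
def Store.Emitted {K : Type u} {A : Type v} {Q : Type w} [Semiring K] [DecidableEq A]
    [DecidableEq Q] (σ : Store K A Q) (cl : AugState Q → ℕ)
    (trans : List (AugState Q × Option A × K × AugState Q)) : Prop :=
  ∀ c, (.num c ∈ (σ.tab .don .nil).keys → ∃ p, cl p = c ∧ ∀ a d,
      ((σ.tab .edg .nil).val (edgeKey c a d)).toWeight = arcWeight cl (outArcs trans p) a d) ∧
    (.num c ∉ (σ.tab .don .nil).keys → ∀ a d, (σ.tab .edg .nil).val (edgeKey c a d) = .nil)

namespace Cmd

variable {K : Type u} {A : Type v} {Q : Type w}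
variable [DecidableEq K] [DecidableEq A] [DecidableEq Q] [Semiring K]
variable {σ : Store K A Q} {cl : AugState Q → ℕ} {f : ℕ}
  {trans : List (AugState Q × Option A × K × AugState Q)}

/-- The bound also holds when the class was already treated, so running through all states costs at
most the number of states plus the number of arcs. -/
theorem wp_emitClass (hσ : σ.Part cl f) (hA : σ.Adj trans) (hE : σ.Emitted cl trans)
    {p : AugState Q} (hp : σ.reg .p = .state p) :
    emitClass.wp σ fun τ t => τ.Emitted cl trans ∧ .num (cl p) ∈ (τ.tab .don .nil).keys ∧
      (∀ z ∈ (σ.tab .don .nil).keys, z ∈ (τ.tab .don .nil).keys) ∧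
      t ≤ 100 * (1 + (outArcs trans p).length) := by
  simp only [emitClass, block, wp_seq, wp_get, wp_ite]
  by_cases hd : .num (cl p) ∈ (σ.tab .don .nil).keys
  · simp only [Test.holds, Expr.eval, Store.reg_setReg, hp, hσ.cls, if_true, Store.tab_setReg, hd,
      decide_true, wp_skip]
    refine ⟨hE, by simp, by simp [hp]; omega⟩
  · simp only [Test.holds, Expr.eval, Store.reg_setReg, hp, hσ.cls, if_true, Store.tab_setReg, hd,
      decide_false, Bool.false_eq_true, if_false, wp_put]
    -- A key is absent before the first arc that uses it, and may hold the weight zero after a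
    -- cancellation; both cases are read as the same weight by `toWeight`.
    refine wp_forList encArc (outArcs trans p) (by simp [hp, hA.out])
      (fun d τ t => t ≤ 80 * d.length ∧
        (∀ c a b, c ≠ cl p → (τ.tab .edg .nil).val (edgeKey c a b) =
          (σ.tab .edg .nil).val (edgeKey c a b)) ∧
        (∀ a b, ((τ.tab .edg .nil).val (edgeKey (cl p) a b) = .nil ∧
            arcWeight cl d a b = 0) ∨
          (τ.tab .edg .nil).val (edgeKey (cl p) a b) = .weight (arcWeight cl d a b))) ?_ ?_ ?_
    · refine ⟨by simp, by simp, ?_⟩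
      intro a b
      left
      simpa using (hE (cl p)).2 hd a b
    · rintro d ⟨a, k, q⟩ d' - ρ t ⟨ht, h1, h2⟩ hF
      have hcls : ρ.tab .cls = σ.tab .cls := hF.tab _ (by decide)
      have hC : ρ.reg .C = .num (cl p) := by rw [hF.reg _ (by decide)]; simp
      have hw := h2 a (cl q)
      simp only [edgeKey] at hw
      simp only [wp_seq, wp_put, wp_set, wp_get, wp_ite]
      rcases hw with ⟨hw, hw0⟩ | hw
      · simp only [encArc, Test.holds, Expr.eval, Store.reg_setReg, Store.tab_setReg, Val.car,
          Val.cdr, if_true, reduceCtorEq, if_false, hcls, hσ.cls, hC, hw, decide_true]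
        refine ⟨by simp; omega, ?_, ?_⟩
        · intro c a' b' hc
          simp [LMap.val_put, edgeKey, hc]
          exact h1 c a' b' hc
        · intro a' b'
          rw [arcWeight_append_singleton]
          by_cases hab : a = a' ∧ cl q = b'
          · right
            obtain ⟨rfl, rfl⟩ := hab
            simp [LMap.val_put, edgeKey, hw0]
          · have hab' : ¬ (a' = a ∧ b' = cl q) := fun h => hab ⟨h.1.symm, h.2.symm⟩
            simpa [LMap.val_put, edgeKey, hab, hab'] using h2 a' b'
      · simp only [encArc, Test.holds, Expr.eval, Store.reg_setReg, Store.tab_setReg, Val.car,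
          Val.cdr, if_true, reduceCtorEq, if_false, hcls, hσ.cls, hC, hw, decide_false,
          Bool.false_eq_true, Val.add]
        refine ⟨by simp; omega, ?_, ?_⟩
        · intro c a' b' hc
          simp [LMap.val_put, edgeKey, hc]
          exact h1 c a' b' hc
        · intro a' b'
          rw [arcWeight_append_singleton]
          by_cases hab : a = a' ∧ cl q = b'
          · right
            obtain ⟨rfl, rfl⟩ := hab
            simp [LMap.val_put, edgeKey]
          · have hab' : ¬ (a' = a ∧ b' = cl q) := fun h => hab ⟨h.1.symm, h.2.symm⟩
            simpa [LMap.val_put, edgeKey, hab, hab'] using h2 a' b'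
    · rintro τ t hF ⟨ht, h1, h2⟩
      have hdon : ∀ z, z ∈ (τ.tab .don .nil).keys ↔
          z = .num (cl p) ∨ z ∈ (σ.tab .don .nil).keys := by
        intro z
        rw [hF.tab _ (by decide)]
        simp
      refine ⟨?_, by simp [hdon], by simp +contextual [hdon], by simp [hp]; omega⟩
      intro c
      by_cases hc : c = cl p
      · subst hc
        refine ⟨fun _ => ⟨p, rfl, fun a d => ?_⟩, fun h => absurd ((hdon _).2 (Or.inl rfl)) h⟩
        rcases h2 a d with h | h
        · rw [h.1, h.2]; rfl
        · rw [h]; rfl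
      · simp only [hdon, Val.num.injEq, hc, false_or, h1 c _ _ hc]
        exact hE c

theorem wp_emit (hσ : σ.Part cl f) (hA : σ.Adj trans) {states : List Q}
    (hs : σ.reg .states = .ofList (states.map fun q => .state (.tru q)))
    (hdon : σ.tab .don .nil = LMap.empty) (hedg : σ.tab .edg .nil = LMap.empty) :
    emit.wp σ fun τ t => τ.Part cl f ∧
      (∀ p, (p = .ini ∨ ∃ q ∈ states, p = .tru q) → ∃ p', cl p' = cl p ∧ ∀ a d,
        ((τ.tab .edg .nil).val (edgeKey (cl p) a d)).toWeight =
          arcWeight cl (outArcs trans p') a d) ∧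
      t ≤ 200 * (1 + (outArcs trans .ini).length +
        (states.map fun q => 1 + (outArcs trans (.tru q)).length).sum) := by
  simp only [emit, block, wp_seq, wp_set]
  have hE : σ.Emitted cl trans := by
    intro c
    simp [hdon, hedg]
  refine wp_mono (wp_emitClass (σ := σ.setReg .p (.state .ini)) (hσ.congr rfl rfl (by simp))
    (hA.congr rfl rfl) hE (p := .ini) (by simp)) ?_
  rintro τ t hF ⟨h1, h2, h3, h4⟩
  have hP : τ.Part cl f := hσ.congr (hF.tab _ (by decide)) (hF.tab _ (by decide))
    (by rw [hF.reg _ (by decide)]; simp)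
  have hA' : τ.Adj trans := hA.congr (hF.tab _ (by decide)) (hF.tab _ (by decide))
  refine wp_forList (fun q => .state (.tru q)) states
    (by simp only [Expr.eval]; rw [hF.reg _ (by decide)]; simpa using hs)
    (fun d ρ t => t ≤ (d.map fun q => 101 * (1 + (outArcs trans (.tru q)).length)).sum ∧
      ρ.Emitted cl trans ∧ .num (cl .ini) ∈ (ρ.tab .don .nil).keys ∧
      ∀ q ∈ d, .num (cl (.tru q)) ∈ (ρ.tab .don .nil).keys) ?_ ?_ ?_
  · exact ⟨by simp, h1, h2, by simp⟩
  · rintro d q d' - ρ s ⟨g1, g2, g3, g4⟩ hF'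
    have hP' : ρ.Part cl f := hP.congr (hF'.tab _ (by decide)) (hF'.tab _ (by decide))
      (by rw [hF'.reg _ (by decide)])
    have hA'' : ρ.Adj trans := hA'.congr (hF'.tab _ (by decide)) (hF'.tab _ (by decide))
    refine wp_mono (wp_emitClass (σ := ρ.setReg .p (.state (.tru q)))
      (hP'.congr rfl rfl (by simp)) (hA''.congr rfl rfl) g2 (p := .tru q) (by simp)) ?_
    rintro ρ' s' hF'' ⟨k1, k2, k3, k4⟩
    refine ⟨by simp; omega, k1, k3 _ g3, ?_⟩
    intro q' hq'
    simp only [List.mem_append, List.mem_singleton] at hq'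
    rcases hq' with hq' | rfl
    · exact k3 _ (g4 _ hq')
    · exact k2
  · rintro ρ s hF' ⟨g1, g2, g3, g4⟩
    refine ⟨hP.congr (hF'.tab _ (by decide)) (hF'.tab _ (by decide))
      (by rw [hF'.reg _ (by decide)]), ?_, ?_⟩
    · rintro p (rfl | ⟨q, hq, rfl⟩)
      · exact (g2 _).1 g3
      · exact (g2 _).1 (g4 q hq)
    · rw [List.sum_map_mul_left] at g1
      simp only [Expr.cost]
      omega

end Cmd

/-! ## Splitting classes -/

/-- Decodes the keys of a map into mathematical objects, over which the loop rules can then range.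
-/
theorem List.exists_eq_map_of_forall {α β : Type*} (g : α → β) (l : List β)
    (h : ∀ z ∈ l, ∃ y, z = g y) : ∃ l', l = List.map g l' := by
  induction l with
  | nil => exact ⟨[], rfl⟩
  | cons z l ih =>
    obtain ⟨y, rfl⟩ := h z (by simp)
    obtain ⟨l', rfl⟩ := ih fun z hz => h z (by simp [hz])
    exact ⟨y :: l', rfl⟩

/-- Distinct values have disjoint fibres. Every linear bound on work spread over classes, buckets,
labels or states rests on this. -/
theorem List.sum_fibers_le {α β : Type*} [DecidableEq β] (f : α → β) (g : α → ℕ) (ks : List β)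
    (hks : ks.Nodup) (E : List α) :
    (ks.map fun k => ((E.filter fun e => f e = k).map g).sum).sum ≤ (E.map g).sum := by
  induction ks generalizing E with
  | nil => simp
  | cons k ks ih =>
    rw [List.nodup_cons] at hks
    have h1 : ∀ E : List α, (E.map g).sum = ((E.filter fun e => f e = k).map g).sum +
        ((E.filter fun e => f e ≠ k).map g).sum := by
      intro E
      induction E with
      | nil => simp
      | cons e E ihE => by_cases h : f e = k <;> simp [h] at ihE ⊢ <;> omega
    have h2 : ∀ k' ∈ ks, (E.filter fun e => f e = k') =
        ((E.filter fun e => f e ≠ k).filter fun e => f e = k') := by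
      intro k' hk'
      rw [List.filter_filter]
      refine List.filter_congr fun e _ => ?_
      have : k' ≠ k := fun h => hks.1 (h ▸ hk')
      by_cases h : f e = k' <;> simp [h, this]
    have h3 : (ks.map fun k' => ((E.filter fun e => f e = k').map g).sum) =
        ks.map fun k' => (((E.filter fun e => f e ≠ k).filter fun e => f e = k').map g).sum :=
      List.map_congr_left fun k' hk' => by rw [h2 k' hk']
    rw [List.map_cons, List.sum_cons, h1 E, h3]
    exact Nat.add_le_add_left (ih hks.2 _) _

section SplitBy

variable {S V : Type*}

/-- The partition `cl'`, with first unused class `f'`, results from the partition `cl`, with first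
unused class `f`, by the split of every class according to the marks `μ`. -/
structure SplitBy (cl : S → ℕ) (f : ℕ) (μ : S → Option V) (cl' : S → ℕ) (f' : ℕ) : Prop where
  ker : ∀ p p', cl' p = cl' p' ↔ cl p = cl p' ∧ μ p = μ p'
  unmarked : ∀ p, μ p = none → cl' p = cl p
  moved : ∀ p, cl' p = cl p ∨ f ≤ cl' p
  le : f ≤ f'
  old : ∀ p, ∃ p', cl' p' = cl p
  new : ∀ c, f ≤ c → c < f' → ∃ p, cl' p = c

theorem SplitBy.refl (cl : S → ℕ) (f : ℕ) : SplitBy cl f (fun _ => (none : Option V)) cl f :=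
  ⟨fun _ _ => by simp, fun _ _ => rfl, fun _ => Or.inl rfl, le_rfl, fun p => ⟨p, rfl⟩,
    fun c h h' => absurd h (by omega)⟩

variable [DecidableEq S]

/-- The marking `μ`, and the mark `v` for the states in `B`. -/
def markWith (μ : S → Option V) (B : List S) (v : V) (p : S) : Option V :=
  if p ∈ B then some v else μ p

variable {cl : S → ℕ} {f : ℕ} {μ : S → Option V} {cl' : S → ℕ} {f' : ℕ} {C : ℕ} {v : V}
  {B : List S}

/-- `B` is all that remains of the class `C`, the other buckets having been moved away. Marking it
changes no class, and the new mark agrees with `ker` because no other state of the original class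
bears the mark `v`. -/
theorem SplitBy.kept (h : SplitBy cl f μ cl' f') (hB : ∀ p, cl' p = C ↔ p ∈ B)
    (hC : ∀ p ∈ B, cl p = C) (hv : ∀ p, p ∉ B → cl p = C → μ p ≠ some v) :
    SplitBy cl f (markWith μ B v) cl' f' := by
  refine ⟨?_, ?_, h.moved, h.le, h.old, h.new⟩
  · intro p p'
    unfold markWith
    by_cases hp : p ∈ B <;> by_cases hp' : p' ∈ B
    · simp [hp, hp', (hB p).2 hp, (hB p').2 hp', hC p hp, hC p' hp']
    · simp only [hp, hp', if_true, if_false, (hB p).2 hp, hC p hp]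
      constructor
      · intro h; exact absurd ((hB p').1 h.symm) hp'
      · rintro ⟨h1, h2⟩; exact absurd h2.symm (hv p' hp' h1.symm)
    · simp only [hp, hp', if_true, if_false, (hB p').2 hp', hC p' hp']
      constructor
      · intro h; exact absurd ((hB p).1 h) hp
      · rintro ⟨h1, h2⟩; exact absurd h2 (hv p hp h1)
    · simp [hp, hp', h.ker]
  · intro p hp
    unfold markWith at hp
    split_ifs at hp
    exact h.unmarked p hp

/-- The state `r` stays behind, so the number `C` remains in use; since `B` is not empty, the number
`f'` is used as well. Hence no class number is lost, and the count of numbers issued controls the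
number of classes. -/
theorem SplitBy.move (h : SplitBy cl f μ cl' f') (hlt : ∀ p, cl' p < f')
    (hC : ∀ p ∈ B, cl p = C) (hC' : ∀ p ∈ B, cl' p = C)
    (hv : ∀ p, p ∉ B → cl p = C → μ p ≠ some v)
    {r : S} (hr : r ∉ B) (hrC : cl' r = C) (hne : B ≠ []) :
    SplitBy cl f (markWith μ B v) (fun p => if p ∈ B then f' else cl' p) (f' + 1) := by
  refine ⟨?_, ?_, ?_, by have := h.le; omega, ?_, ?_⟩
  · intro p p'
    unfold markWith
    by_cases hp : p ∈ B <;> by_cases hp' : p' ∈ B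
    · simp [hp, hp', hC p hp, hC p' hp']
    · simp only [hp, hp', if_true, if_false, hC p hp]
      constructor
      · intro h; exact absurd h.symm (hlt p').ne
      · rintro ⟨h1, h2⟩; exact absurd h2.symm (hv p' hp' h1.symm)
    · simp only [hp, hp', if_true, if_false, hC p' hp']
      constructor
      · intro h; exact absurd h (hlt p).ne
      · rintro ⟨h1, h2⟩; exact absurd h2 (hv p hp h1)
    · simp [hp, hp', h.ker]
  · intro p hp
    unfold markWith at hp
    split_ifs at hp with hpB
    simpa [hpB] using h.unmarked p hp
  · intro p
    by_cases hp : p ∈ B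
    · simp [hp, h.le]
    · simpa [hp] using h.moved p
  · intro p
    obtain ⟨p', hp'⟩ := h.old p
    by_cases hpB : p' ∈ B
    · exact ⟨r, by simp [hr, hrC, ← hp', hC' p' hpB]⟩
    · exact ⟨p', by simp [hpB, hp']⟩
  · intro c hc hc'
    by_cases hcf : c = f'
    · obtain ⟨b, hb⟩ := List.exists_mem_of_ne_nil B hne
      exact ⟨b, by simp [hb, hcf]⟩
    · obtain ⟨p, hp⟩ := h.new c hc (by omega)
      by_cases hpB : p ∈ B
      · exact ⟨r, by simp [hr, hrC, ← hp, hC' p hpB]⟩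
      · exact ⟨p, by simp [hpB, hp]⟩

end SplitBy

/-- The buckets contain the states of `ps`, according to their classes and signatures. -/
structure Store.Buckets {K : Type u} {A : Type v} {Q : Type w} [DecidableEq K] [DecidableEq A]
    [DecidableEq Q] (σ : Store K A Q) (cl : AugState Q → ℕ) (ps : List (AugState Q))
    (s : AugState Q → Val K A Q) : Prop where
  keys : ∀ z, z ∈ (σ.tab .bkt .nil).keys ↔ ∃ p ∈ ps, z = .cons (.num (cl p)) (s p)
  val : ∀ c v, (σ.tab .bkt .nil).val (.cons (.num c) v) =
    .ofList (((ps.filter fun p => (cl p, s p) = (c, v)).reverse).map .state)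

namespace Cmd

variable {K : Type u} {A : Type v} {Q : Type w}
variable [DecidableEq K] [DecidableEq A] [DecidableEq Q] [Semiring K]
variable {σ : Store K A Q} {cl : AugState Q → ℕ} {f : ℕ}
  {trans : List (AugState Q × Option A × K × AugState Q)}
  {ps : List (AugState Q)} {s : AugState Q → Val K A Q}

theorem wp_toBucket (h : σ.Buckets cl ps s) {p : AugState Q} (hp : σ.reg .p = .state p)
    (hC : σ.reg .C = .num (cl p)) (hs : σ.reg .s = s p) :
    toBucket.wp σ fun τ t => τ.Buckets cl (ps ++ [p]) s ∧ t ≤ 20 + 2 * (s p).size := by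
  simp only [toBucket, block, wp_seq, wp_get, wp_put, Expr.eval, Store.reg_setReg, hp, hC, hs,
    reduceCtorEq, if_false, if_true, h.val, Store.tab_setReg]
  refine ⟨⟨?_, ?_⟩, by simp [hC, hs]; omega⟩
  · intro z
    simp [h.keys, or_and_right, exists_or, or_comm]
  · intro c v
    by_cases hcv : cl p = c ∧ s p = v
    · obtain ⟨rfl, rfl⟩ := hcv
      simp [LMap.val_put, List.filter_append, Val.ofList]
    · have hcv' : ¬ (c = cl p ∧ v = s p) := fun h => hcv ⟨h.1.symm, h.2.symm⟩
      simp only [Store.tab_setTab, and_self, if_true, LMap.val_put, Val.cons.injEq,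
        Val.num.injEq, hcv', if_false, List.filter_append, h.val]
      simp [hcv]

/-- The marks of the states whose buckets are in `d`. -/
def bucketMark (cl : AugState Q → ℕ) (ps : List (AugState Q)) (s : AugState Q → Val K A Q)
    (d : List (ℕ × Val K A Q)) (p : AugState Q) : Option (Val K A Q) :=
  if p ∈ ps ∧ (cl p, s p) ∈ d then some (s p) else none

/-- `J` is a caller's invariant on the queue and the split flag, carried along the successive
intermediate partitions. A bucket of a class is moved as long as something else remains in it; the
unmarked states, or else the last bucket, keep the old number. So the final kernel is exactly that
of the pair (old class, mark). -/
theorem wp_splitBuckets (hσ : σ.Part cl f) (hwf : σ.WF) (hB : σ.Buckets cl ps s)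
    {kept moved : Cmd}
    (hkr : ∀ r, r ≠ .split → kept.writesReg r = false)
    (hkt : ∀ T, T ≠ .que → kept.writesTab T = false)
    (hmr : ∀ r, r ≠ .split → moved.writesReg r = false)
    (hmt : ∀ T, T ≠ .que → moved.writesTab T = false)
    (J : (AugState Q → ℕ) → ℕ → (AugState Q → Option (Val K A Q)) → LMap K A Q → Val K A Q → Prop)
    (h0 : J cl f (fun _ => none) (σ.tab .que .nil) (σ.reg .split))
    (hkept : ∀ (ρ : Store K A Q) cl' f' μ C v B, SplitBy cl f μ cl' f' →
      J cl' f' μ (ρ.tab .que .nil) (ρ.reg .split) → (∀ p, cl' p < f') →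
      ρ.reg .C = .num C → ρ.reg .g = .ofList (B.map .state) → B ≠ [] → B.Nodup →
      (∀ p, cl' p = C ↔ p ∈ B) → (∀ p ∈ B, cl p = C) → ρ.WF →
      kept.wp ρ fun τ t => t ≤ 20 ∧
        J cl' f' (markWith μ B v) (τ.tab .que .nil) (τ.reg .split))
    (hmoved : ∀ (ρ : Store K A Q) cl' f' μ C v B r, SplitBy cl f μ cl' f' →
      J cl' f' μ (ρ.tab .que .nil) (ρ.reg .split) → (∀ p, cl' p < f') →
      ρ.reg .C = .num C → ρ.reg .D = .num f' → ρ.reg .g = .ofList (B.map .state) → B ≠ [] →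
      B.Nodup → (∀ p ∈ B, cl p = C) → (∀ p ∈ B, cl' p = C) → r ∉ B → cl' r = C → ρ.WF →
      moved.wp ρ fun τ t => t ≤ 20 ∧ J (fun p => if p ∈ B then f' else cl' p) (f' + 1)
        (markWith μ B v) (τ.tab .que .nil) (τ.reg .split))
    (hps : ps.Nodup) :
    (splitBuckets kept moved).wp σ fun τ t => ∃ cl' f', τ.Part cl' f' ∧
      SplitBy cl f (fun p => if p ∈ ps then some (s p) else none) cl' f' ∧
      J cl' f' (fun p => if p ∈ ps then some (s p) else none) (τ.tab .que .nil) (τ.reg .split) ∧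
      t ≤ 10 + (ps.map fun p => 200 + (s p).size).sum := by
  obtain ⟨ks, hks⟩ := List.exists_eq_map_of_forall
    (fun y : ℕ × Val K A Q => Val.cons (.num y.1) y.2) (σ.tab .bkt .nil).keys (by
      intro z hz
      obtain ⟨p, -, rfl⟩ := (hB.keys z).1 hz
      exact ⟨(cl p, s p), rfl⟩)
  have hnd : ks.Nodup := by
    have := (hwf .bkt .nil).1
    rw [hks] at this
    exact this.of_map
  have hmem : ∀ y, y ∈ ks ↔ ∃ p ∈ ps, y = (cl p, s p) := by
    intro y
    have := hB.keys (.cons (.num y.1) y.2)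
    rw [hks, List.mem_map] at this
    constructor
    · intro hy
      obtain ⟨p, hp, h⟩ := this.1 ⟨y, hy, rfl⟩
      simp only [Val.cons.injEq, Val.num.injEq] at h
      exact ⟨p, hp, Prod.ext h.1 h.2⟩
    · rintro ⟨p, hp, rfl⟩
      obtain ⟨y, hy, h⟩ := this.2 ⟨p, hp, rfl⟩
      simp only [Val.cons.injEq, Val.num.injEq] at h
      rwa [show y = (cl p, s p) from Prod.ext h.1 h.2] at hy
  refine wp_forKeys (fun y : ℕ × Val K A Q => Val.cons (.num y.1) y.2) ks (by simpa using hks)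
    (fun d τ t => (∃ cl' f', τ.Part cl' f' ∧ SplitBy cl f (bucketMark cl ps s d) cl' f' ∧
        J cl' f' (bucketMark cl ps s d) (τ.tab .que .nil) (τ.reg .split)) ∧
      t ≤ (d.map fun y => ((ps.filter fun p => (cl p, s p) = y).map
        fun p => 200 + (s p).size).sum).sum) ?_ ?_ ?_
  · have hnil : bucketMark cl ps s [] = fun _ => none := by
      funext p; simp [bucketMark]
    refine ⟨⟨cl, f, hσ, ?_, ?_⟩, by simp⟩
    · rw [hnil]; exact SplitBy.refl cl f
    · rw [hnil]; exact h0
  · rintro d ⟨C, v⟩ d' hd ρ t ⟨⟨cl', f', hP, hS, hJ⟩, ht⟩ hF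
    have hρwf : ρ.WF := hF.wf hwf
    have hbkt : ρ.tab .bkt = σ.tab .bkt := hF.tab _ (by simp [writesTab, hkt, hmt])
    set B := (ps.filter fun p => (cl p, s p) = (C, v)).reverse with hBdef
    have hBmem : ∀ p, p ∈ B ↔ p ∈ ps ∧ cl p = C ∧ s p = v := by
      intro p; simp [hBdef]
    have hBne : B ≠ [] := by
      obtain ⟨p, hp, h⟩ := (hmem (C, v)).1 (by rw [hd]; simp)
      simp only [Prod.mk.injEq] at h
      exact List.ne_nil_of_mem ((hBmem p).2 ⟨hp, h.1.symm, h.2.symm⟩)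
    have hBnd : B.Nodup := List.nodup_reverse.2 (hps.filter _)
    have hnotd : (C, v) ∉ d := by
      rw [hd, List.nodup_append] at hnd
      intro h
      exact hnd.2.2 _ h _ (List.mem_cons_self) rfl
    have hmark : bucketMark cl ps s (d ++ [(C, v)]) = markWith (bucketMark cl ps s d) B v := by
      funext p
      unfold bucketMark markWith
      by_cases hp : p ∈ B
      · have := (hBmem p).1 hp
        simp [hp, this]
      · have : ¬ (p ∈ ps ∧ (cl p, s p) = (C, v)) := by
          intro h
          rw [Prod.mk.injEq] at h
          exact hp ((hBmem p).2 h)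
        simp only [hp, if_false, List.mem_append, List.mem_singleton]
        congr 1
        simp only [eq_iff_iff]
        tauto
    have hBnone : ∀ p ∈ B, bucketMark cl ps s d p = none := by
      intro p hp
      have := (hBmem p).1 hp
      simp [bucketMark, this, hnotd]
    have hBC : ∀ p ∈ B, cl p = C := fun p hp => ((hBmem p).1 hp).2.1
    have hBC' : ∀ p ∈ B, cl' p = C := fun p hp => by
      rw [hS.unmarked p (hBnone p hp), hBC p hp]
    have hv : ∀ p, p ∉ B → cl p = C → bucketMark cl ps s d p ≠ some v := by
      intro p hp hpC h
      unfold bucketMark at h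
      split_ifs at h with h'
      exact hp ((hBmem p).2 ⟨h'.1, hpC, by simpa using h⟩)
    -- The key is hashed a bounded number of times per bucket, whereas the bound charges its size to
    -- every member; the nonempty bucket absorbs the constant 150.
    have hcost : 150 + v.size + 40 * B.length ≤
        ((ps.filter fun p => (cl p, s p) = (C, v)).map fun p => 200 + (s p).size).sum := by
      have h1 : ((ps.filter fun p => (cl p, s p) = (C, v)).map fun p => 200 + (s p).size) =
          (ps.filter fun p => (cl p, s p) = (C, v)).map fun p => 200 + v.size := by
        refine List.map_congr_left fun p hp => ?_
        simp only [List.mem_filter, decide_eq_true_eq, Prod.mk.injEq] at hp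
        rw [hp.2.2]
      have h2 : (ps.filter fun p => (cl p, s p) = (C, v)).length = B.length := by simp [hBdef]
      rw [h1, List.map_const', List.sum_replicate, h2, smul_eq_mul]
      have : 1 ≤ B.length := List.length_pos_iff.2 hBne
      nlinarith [Nat.zero_le v.size]
    simp only [List.map_append, List.map_cons, List.map_nil, List.sum_append, List.sum_cons,
      List.sum_nil, add_zero, hmark]
    have hval : (ρ.tab .bkt .nil).val (.cons (.num C) v) = .ofList (B.map .state) := by
      rw [hbkt, hB.val]
    simp only [block, wp_seq, wp_set, wp_get, Expr.eval, Store.reg_setReg, Val.car, if_true,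
      Store.tab_setReg, reduceCtorEq, if_false, hval]
    refine wp_forList .state B (by simp)
      (fun e τ t => t ≤ 10 * e.length ∧ ∀ c z, z ∈ (τ.tab .mem (.num c)).keys ↔
        z ∈ (ρ.tab .mem (.num c)).keys ∧ ¬ (c = C ∧ ∃ p ∈ e, z = .state p)) ?_ ?_ ?_
    · exact ⟨by simp, by simp⟩
    · rintro e p e' - τ t ⟨h1, h2⟩ hF1
      have hC1 : τ.reg .C = .num C := by rw [hF1.reg _ (by decide)]; simp
      have hwf1 : τ.WF := hF1.wf hρwf
      simp only [wp_del, Expr.eval, Store.reg_setReg, reduceCtorEq, if_false, hC1, if_true]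
      refine ⟨by simp [hC1]; omega, ?_⟩
      intro c z
      by_cases hc : c = C
      · subst hc
        have := (hwf1 .mem (.num c)).mem_keys_del (.state p) z
        simp [this, h2]
        grind
      · simp [hc, h2]
    · rintro τ t1 hF1 ⟨ht1, hmem1⟩
      have hC1 : τ.reg .C = .num C := by rw [hF1.reg _ (by decide)]; simp
      have hg1 : τ.reg .g = .ofList (B.map .state) := by rw [hF1.reg _ (by decide)]; simp
      have hfr1 : τ.reg .fresh = .num f' := by
        rw [hF1.reg _ (by decide)]; simpa using hP.fresh
      have hcls1 : τ.tab .cls = ρ.tab .cls := hF1.tab _ (by decide)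
      have hque1 : τ.tab .que = ρ.tab .que := hF1.tab _ (by decide)
      have hspl1 : τ.reg .split = ρ.reg .split := by rw [hF1.reg _ (by decide)]; simp
      have hwf1 : τ.WF := hF1.wf hρwf
      rw [wp_ite]
      by_cases hemp : ∀ p, cl' p = C → p ∈ B
      · have hE : (τ.tab .mem (.num C)).keys = [] := by
          rw [List.eq_nil_iff_forall_not_mem]
          intro z hz
          rw [hmem1, hP.mem] at hz
          obtain ⟨⟨p, rfl, hp⟩, h⟩ := hz
          exact h ⟨rfl, p, hemp p hp, rfl⟩
        simp only [Test.holds, Expr.eval, hC1, hE, List.isEmpty_nil, if_true, wp_seq]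
        refine wp_forList .state B (by simp [hg1])
          (fun e τ' t => t ≤ 10 * e.length ∧ ∀ c z, z ∈ (τ'.tab .mem (.num c)).keys ↔
            z ∈ (τ.tab .mem (.num c)).keys ∨ (c = C ∧ ∃ p ∈ e, z = .state p)) ?_ ?_ ?_
        · exact ⟨by simp, by simp⟩
        · rintro e p e' - τ' t' ⟨h1, h2⟩ hF2
          have hC2 : τ'.reg .C = .num C := by rw [hF2.reg _ (by decide)]; exact hC1
          simp only [wp_put, Expr.eval, Store.reg_setReg, reduceCtorEq, if_false, hC2, if_true]
          refine ⟨by simp [hC2]; omega, ?_⟩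
          intro c z
          by_cases hc : c = C
          · subst hc
            simp [h2]
            grind
          · simp [hc, h2]
        · rintro τ2 t2 hF2 ⟨ht2, hmem2⟩
          have hB' : ∀ p, cl' p = C ↔ p ∈ B := fun p => ⟨hemp p, hBC' p⟩
          refine wp_mono (hkept τ2 cl' f' _ C v B hS ?_ hP.lt ?_ ?_ hBne hBnd hB' hBC
            (hF2.wf hwf1)) ?_
          · rw [hF2.tab _ (by decide), hF2.reg _ (by decide), hque1, hspl1]; exact hJ
          · rw [hF2.reg _ (by decide), hC1]
          · rw [hF2.reg _ (by decide), hg1]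
          · rintro τ3 t3 hF3 ⟨ht3, hJ3⟩
            refine ⟨⟨cl', f', ⟨?_, ?_, ?_, hP.lt⟩, hS.kept hB' hBC hv, hJ3⟩, ?_⟩
            · rw [hF3.tab _ (hkt _ (by decide)), hF2.tab _ (by decide), hcls1]; exact hP.cls
            · intro c z
              rw [hF3.tab _ (hkt _ (by decide)), hmem2, hmem1, hP.mem]
              by_cases hc : c = C
              · subst hc
                grind
              · simp [hc]
            · rw [hF3.reg _ (hkr _ (by decide)), hF2.reg _ (by decide), hfr1]
            · simp only [Test.cost, hashCost, Expr.cost, Expr.eval, Val.size, Store.reg_setReg, hC1,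
                reduceCtorEq, if_false, if_true]
              omega
      -- Some state `r` of the current class lies outside the bucket, so `C` is not emptied and the
      -- bucket becomes a new class.
      · push Not at hemp
        obtain ⟨r, hrC, hrB⟩ := hemp
        have hE : (τ.tab .mem (.num C)).keys ≠ [] := by
          refine List.ne_nil_of_mem (a := .state r) ?_
          rw [hmem1, hP.mem]
          refine ⟨⟨r, rfl, hrC⟩, ?_⟩
          rintro ⟨-, p, hp, h⟩
          simp only [Val.state.injEq] at h
          exact hrB (h ▸ hp)
        have hE' : (τ.tab .mem (.num C)).keys.isEmpty = false := by simpa using hE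
        simp only [Test.holds, Expr.eval, hC1, hE', Bool.false_eq_true, if_false, wp_seq, wp_set,
          Store.reg_setReg, reduceCtorEq, hfr1, Val.succ]
        refine wp_forList .state B (by simp [hg1])
          (fun e τ' t => t ≤ 30 * e.length ∧ (∀ c z, z ∈ (τ'.tab .mem (.num c)).keys ↔
            z ∈ (τ.tab .mem (.num c)).keys ∨ (c = f' ∧ ∃ p ∈ e, z = .state p)) ∧
            ∀ p, (τ'.tab .cls .nil).val (.state p) =
              .num (if p ∈ e then f' else cl' p)) ?_ ?_ ?_
        · exact ⟨by simp, by simp, by simp [hcls1, hP.cls]⟩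
        · rintro e p e' - τ' t' ⟨h1, h2, h3⟩ hF2
          have hD2 : τ'.reg .D = .num f' := by rw [hF2.reg _ (by decide)]; simp
          simp only [wp_seq, wp_put, Expr.eval, Store.reg_setReg, reduceCtorEq, if_false, hD2,
            if_true]
          refine ⟨by simp [hD2]; omega, ?_, ?_⟩
          · intro c z
            by_cases hc : c = f'
            · subst hc
              simp [h2]
              grind
            · simp [hc, h2]
          · intro p'
            by_cases hpp : p' = p <;> simp [hpp, LMap.val_put, h3, hD2]
        · rintro τ2 t2 hF2 ⟨ht2, hmem2, hcls2⟩
          refine wp_mono (hmoved τ2 cl' f' _ C v B r hS ?_ hP.lt ?_ ?_ ?_ hBne hBnd hBC hBC'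
            hrB hrC (hF2.wf hwf1)) ?_
          · rw [hF2.tab _ (by decide), hF2.reg _ (by decide)]
            simp only [Store.tab_setReg, Store.reg_setReg, reduceCtorEq, if_false]
            rw [hque1, hspl1]; exact hJ
          · rw [hF2.reg _ (by decide)]; simp [hC1]
          · rw [hF2.reg _ (by decide)]; simp
          · rw [hF2.reg _ (by decide)]; simp [hg1]
          · rintro τ3 t3 hF3 ⟨ht3, hJ3⟩
            refine ⟨⟨_, f' + 1, ⟨?_, ?_, ?_, ?_⟩,
              hS.move hP.lt hBC hBC' hv hrB hrC hBne, hJ3⟩, ?_⟩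
            · rw [hF3.tab _ (hmt _ (by decide))]; exact hcls2
            · intro c z
              rw [hF3.tab _ (hmt _ (by decide)), hmem2, hmem1, hP.mem]
              have hlt := hP.lt
              by_cases hc : c = f'
              · subst hc
                have : ∀ p, cl' p ≠ c := fun p => (hlt p).ne
                grind
              · grind
            · rw [hF3.reg _ (hmr _ (by decide)), hF2.reg _ (by decide)]; simp
            · intro p
              have := hP.lt p
              split_ifs <;> omega
            · simp only [Test.cost, hashCost, Expr.cost, Expr.eval, Val.size, Store.reg_setReg, hC1,
                reduceCtorEq, if_false, if_true]
              omega
  · rintro τ t hF ⟨⟨cl', f', hP, hS, hJ⟩, ht⟩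
    have hall : bucketMark cl ps s ks = fun p => if p ∈ ps then some (s p) else none := by
      funext p
      unfold bucketMark
      by_cases hp : p ∈ ps
      · simp only [hp, true_and, (hmem _).2 ⟨p, hp, rfl⟩]
      · simp [hp]
    rw [hall] at hS hJ
    refine ⟨cl', f', hP, hS, hJ, ?_⟩
    have := List.sum_fibers_le (fun p => (cl p, s p)) (fun p => 200 + (s p).size) ks hnd ps
    simp only [hashCost, Expr.cost, Expr.eval, Val.size]
    omega

end Cmd

/-! ## Signatures in the Domain Split Algorithm -/

section NzList

variable {K : Type u} {A : Type v} {Q : Type w}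

theorem size_encPairs_le {B : ℕ} (l : List (Val K A Q × K)) (h : ∀ e ∈ l, e.1.size ≤ B) :
    (encPairs l).size ≤ 1 + (3 + B) * l.length := by
  induction l with
  | nil => simp [encPairs, Val.ofList]
  | cons e l ih =>
    have h1 := ih fun e he => h e (by simp [he])
    have h2 := h e (by simp)
    simp only [encPairs, List.map_cons, Val.ofList, Val.size, List.length_cons] at h1 ⊢
    ring_nf at h1 ⊢
    omega

variable [Semiring K] [DecidableEq K] {α : Type*}

/-- The nonzero values of `W` on the list `d`, each with the name `g` of its argument, the last
first. -/
def nzList (g : α → Val K A Q) (W : α → K) (d : List α) : List (Val K A Q × K) :=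
  (d.filter fun y => W y ≠ 0).reverse.map fun y => (g y, W y)

theorem nzList_append_singleton (g : α → Val K A Q) (W : α → K) (d : List α) (y : α) :
    nzList g W (d ++ [y]) = insertNZ (g y) (W y) (nzList g W d) := by
  unfold nzList insertNZ
  by_cases h : W y = 0 <;> simp [List.filter_append, h]

/-- Both lists follow the common order of `d`. A nonzero value occurs in the first list with its
name, hence in the second with the same value; a value that occurs in neither list is zero for both
functions. -/
theorem nzList_eq_iff {g : α → Val K A Q} (hg : Function.Injective g) {W W' : α → K}
    {d : List α} : nzList g W d = nzList g W' d ↔ ∀ y ∈ d, W y = W' y := by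
  have key : ∀ W W' : α → K, nzList g W d = nzList g W' d → ∀ y ∈ d, W y ≠ 0 → W y = W' y := by
    intro W W' h y hy h0
    have h1 : (g y, W y) ∈ nzList g W d := by
      simp only [nzList, List.mem_map, List.mem_reverse, List.mem_filter, decide_eq_true_eq]
      exact ⟨y, ⟨hy, h0⟩, rfl⟩
    rw [h] at h1
    simp only [nzList, List.mem_map, List.mem_reverse, List.mem_filter, decide_eq_true_eq,
      Prod.mk.injEq] at h1
    obtain ⟨y', -, h2, h3⟩ := h1
    rw [← h3, hg h2]
  constructor
  · intro h y hy
    by_cases h0 : W y = 0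
    · by_cases h0' : W' y = 0
      · rw [h0, h0']
      · exact (key W' W h.symm y hy h0').symm
    · exact key W W' h y hy h0
  · intro h
    unfold nzList
    rw [List.filter_congr (q := fun y => decide (W' y ≠ 0)) (fun y hy => by rw [h y hy])]
    refine List.map_congr_left fun y hy => ?_
    simp only [List.mem_reverse, List.mem_filter] at hy
    rw [h y hy.1]

theorem encPairs_nzList (g : α → Val K A Q) (W : α → K) (d : List α) :
    encPairs (nzList g W d) = .ofList ((d.filter fun y => W y ≠ 0).reverse.map fun y =>
      .cons (g y) (.weight (W y))) := by
  simp [encPairs, nzList, Function.comp_def]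

end NzList

/-- Double counting: the entries of `meet` are counted by key when they are scanned and by state
when they are bounded. -/
theorem List.sum_length_filter_comm {α β : Type*} (R : α → β → Bool) (l : List α) (m : List β) :
    (m.map fun y => (l.filter fun x => R x y).length).sum =
      (l.map fun x => (m.filter fun y => R x y).length).sum := by
  have h1 : ∀ y, (l.filter fun x => R x y).length = (l.map fun x => if R x y then 1 else 0).sum := by
    intro y
    induction l with
    | nil => simp
    | cons x l ih => by_cases h : R x y <;> simp [h, ih]; omega
  induction m with
  | nil => simp
  | cons y m ih =>
    rw [List.map_cons, List.sum_cons, ih, h1, ← List.sum_map_add]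
    congr 1
    refine List.map_congr_left fun x _ => ?_
    by_cases h : R x y <;> simp [h]; omega

namespace Cmd

variable {K : Type u} {A : Type v} {Q : Type w}

theorem arcs_weight_ne_zero [DecidableEq Q] [Zero K]
    {trans : List (AugState Q × Option A × K × AugState Q)} (h : ∀ e ∈ trans, e.2.2.1 ≠ 0)
    (p : AugState Q) :
    (∀ e ∈ outArcs trans p, e.2.1 ≠ 0) ∧ ∀ e ∈ inArcs trans p, e.2.1 ≠ 0 := by
  constructor
  · intro e he
    simp only [outArcs, List.mem_reverse, List.mem_map, List.mem_filter] at he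
    obtain ⟨e', he', rfl⟩ := he
    exact h e' he'.1
  · intro e he
    simp only [inArcs, List.mem_reverse, List.mem_map, List.mem_filter] at he
    obtain ⟨e', he', rfl⟩ := he
    exact h e' he'.1

/-- The key of `(a, c)` in the map `meet`. -/
def meetKey (y : Option A × ℕ) : Val K A Q := .cons (.letter y.1) (.num y.2)

theorem meetKey_injective : Function.Injective (meetKey : Option A × ℕ → Val K A Q) := by
  rintro ⟨a, c⟩ ⟨a', c'⟩ h
  simpa [meetKey] using h

variable [DecidableEq A] [DecidableEq Q] [Semiring K]
variable {σ : Store K A Q} {cl : AugState Q → ℕ} {f : ℕ}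
  {trans : List (AugState Q × Option A × K × AugState Q)}

/-- The weight of the state `p` with respect to the label and the class in `y`. -/
def outWeight (cl : AugState Q → ℕ) (trans : List (AugState Q × Option A × K × AugState Q))
    (p : AugState Q) (y : Option A × ℕ) : K :=
  arcWeight cl (outArcs trans p) y.1 y.2

theorem exists_arc_of_outWeight_ne_zero {p : AugState Q} {y : Option A × ℕ}
    (h : outWeight cl trans p y ≠ 0) : ∃ e ∈ outArcs trans p, y = (e.1, cl e.2.2) := by
  by_contra hcon
  push Not at hcon
  apply h
  unfold outWeight arcWeight
  rw [List.filter_eq_nil_iff.2]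
  · rfl
  · intro e he h'
    simp only [decide_eq_true_eq] at h'
    exact hcon e he (Prod.ext h'.1.symm h'.2.symm)

variable [DecidableEq K]

/-- A nonzero sum has at least one term, and different pairs (label, class) come from different
arcs. -/
theorem length_filter_outWeight_le {ks : List (Option A × ℕ)} (hks : ks.Nodup) (p : AugState Q) :
    (ks.filter fun y => outWeight cl trans p y ≠ 0).length ≤ (outArcs trans p).length := by
  rw [← List.length_map (as := outArcs trans p) fun e => (e.1, cl e.2.2)]
  refine ((hks.filter _).subperm fun y hy => ?_).length_le
  simp only [List.mem_filter, decide_eq_true_eq] at hy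
  obtain ⟨e, he, rfl⟩ := exists_arc_of_outWeight_ne_zero hy.2
  exact List.mem_map_of_mem he

/-- The first loop groups weights by (label, class of destination), each group listing the states
with a nonzero sum; the second loop redistributes the groups to the states. Since the second loop
follows one order of the keys for all states, equality of values is equality of signatures. Only
comparisons inside the class `C` are asserted. -/
theorem wp_dsaSignatures (hσ : σ.Part cl f) (hA : σ.Adj trans) (hwf : σ.WF)
    (hnz : ∀ e ∈ trans, e.2.2.1 ≠ 0) {C : ℕ} (hC : σ.reg .C = .num C) {lp : List (AugState Q)}
    (hlp : (σ.tab .mem (.num C)).keys = lp.map .state) (hnd : lp.Nodup) :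
    dsaSignatures.wp σ fun τ t => ∃ s : AugState Q → Val K A Q,
      (∀ p ∈ lp, (τ.tab .sig .nil).val (.state p) = s p) ∧
      (∀ p ∈ lp, ∀ p' ∈ lp, s p = s p' ↔
        ∀ y, outWeight cl trans p y = outWeight cl trans p' y) ∧
      (∀ p, (s p).size ≤ 1 + 6 * (outArcs trans p).length) ∧
      t ≤ 300 * (1 + (lp.map fun p => 1 + (outArcs trans p).length).sum) := by
  simp only [dsaSignatures, block, wp_seq, wp_clear]
  refine wp_forKeys .state lp (by simpa [hC] using hlp)
    (fun d τ t => t ≤ (d.map fun p => 100 * (1 + (outArcs trans p).length)).sum ∧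
      (∀ y, (τ.tab .meet .nil).val (meetKey y) =
        encPairs (nzList .state (fun p => outWeight cl trans p y) d)) ∧
      (∀ z, z ∈ (τ.tab .meet .nil).keys ↔
        ∃ p ∈ d, ∃ e ∈ outArcs trans p, z = meetKey (e.1, cl e.2.2))) ?_ ?_ ?_
  · exact ⟨by simp, by simp [nzList, encPairs, Val.ofList], by simp⟩
  · rintro d p d' hd ρ t ⟨ht, hv, hk⟩ hF
    have hpd : p ∉ d := by
      rw [hd, List.nodup_append] at hnd
      intro h
      exact hnd.2.2 _ h _ (List.mem_cons_self) rfl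
    have hout : ρ.tab .out = σ.tab .out := hF.tab _ (by decide)
    have hcls : ρ.tab .cls = σ.tab .cls := hF.tab _ (by decide)
    simp only [wp_seq, wp_get]
    -- While `p` is treated, its partial sum, if not zero, sits at the head of every list; the tails
    -- hold the states treated before, none of which is `p`.
    refine wp_forList encArc (outArcs trans p) (by simp [hout, hA.out])
      (fun dd τ t => t ≤ 90 * dd.length ∧
        (∀ y, (τ.tab .meet .nil).val (meetKey y) =
          encPairs (insertNZ (.state p) (arcWeight cl dd y.1 y.2)
            (nzList .state (fun p => outWeight cl trans p y) d))) ∧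
        (∀ z, z ∈ (τ.tab .meet .nil).keys ↔
          (∃ p ∈ d, ∃ e ∈ outArcs trans p, z = meetKey (e.1, cl e.2.2)) ∨
          ∃ e ∈ dd, z = meetKey (e.1, cl e.2.2))) ?_ ?_ ?_
    · refine ⟨by simp, ?_, ?_⟩
      · intro y
        simpa [insertNZ] using hv y
      · intro z
        simpa using hk z
    · rintro dd ⟨a, k, q⟩ dd' hdd τ t' ⟨ht', hv', hk'⟩ hF'
      have hp : τ.reg .p = .state p := by rw [hF'.reg _ (by decide)]; simp
      have hcls' : τ.tab .cls = σ.tab .cls := by rw [hF'.tab _ (by decide)]; exact hcls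
      have hk0 : k ≠ 0 := (arcs_weight_ne_zero hnz p).1 (a, k, q) (by rw [hdd]; simp)
      simp only [wp_seq, wp_get, wp_set, encArc, Expr.eval, Store.reg_setReg, if_true,
        reduceCtorEq, if_false, Val.car, Val.cdr, Store.tab_setReg, hcls', hσ.cls]
      refine wp_mono (wp_specialInsert (y := meetKey (a, cl q)) (x := .state p)
        (s := arcWeight cl dd a (cl q)) (k := k)
        (l := nzList .state (fun p => outWeight cl trans p (a, cl q)) d) ?_ ?_ ?_ ?_ ?_ ?_ ?_ hk0) ?_
      · intro ρ hρ
        simp [hρ, meetKey]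
      · intro ρ hρ
        simp [hρ, hp]
      · exact hv' (a, cl q)
      · intro e he
        simp only [nzList, List.mem_map, List.mem_reverse, List.mem_filter] at he
        obtain ⟨p', hp', rfl⟩ := he
        refine ⟨?_, rfl⟩
        simp only [ne_eq, Val.state.injEq]
        rintro rfl
        exact hpd hp'.1
      · simp
      · simp
      · simp
      · rintro τ2 t2 - ⟨h1, h2⟩
        simp only [h1]
        refine ⟨?_, ?_, ?_⟩
        · simp [meetKey] at h2 ⊢; omega
        · intro y
          rw [arcWeight_append_singleton]
          by_cases hy : y = (a, cl q)
          · subst hy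
            simp [LMap.val_put]
          · have hy1 : (meetKey y : Val K A Q) ≠ meetKey (a, cl q) :=
              fun h => hy (meetKey_injective h)
            have hy2 : ¬ (a = y.1 ∧ cl q = y.2) := fun h => hy (Prod.ext h.1.symm h.2.symm)
            simp [LMap.val_put, hy1, hv', hy2]
        · intro z
          simp only [Store.tab_setTab, and_self, if_true, LMap.mem_keys_put, Store.tab_setReg, hk',
            List.mem_append, List.mem_singleton, or_and_right, exists_or, exists_eq_left]
          rw [or_comm, or_assoc]
    · rintro τ t' hF' ⟨ht', hv', hk'⟩
      refine ⟨by simp; omega, ?_, ?_⟩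
      · intro y
        rw [hv', nzList_append_singleton, outWeight]
      · intro z
        rw [hk']
        simp [or_and_right, exists_or]
  · rintro τ1 t1 hF1 ⟨ht1, hv1, hk1⟩
    have hwf1 : τ1.WF := hF1.wf (hwf.setTab _ _ LMap.wf_empty)
    simp only [Expr.eval]
    obtain ⟨ks, hks⟩ := List.exists_eq_map_of_forall meetKey (τ1.tab .meet .nil).keys (by
      intro z hz
      obtain ⟨p, -, e, -, rfl⟩ := (hk1 z).1 hz
      exact ⟨_, rfl⟩)
    have hknd : ks.Nodup := by
      have := (hwf1 .meet .nil).1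
      rw [hks] at this
      exact this.of_map
    have hkmem : ∀ y, y ∈ ks ↔ ∃ p ∈ lp, ∃ e ∈ outArcs trans p, y = (e.1, cl e.2.2) := by
      intro y
      have := hk1 (meetKey y)
      rw [hks, List.mem_map_of_injective meetKey_injective] at this
      simpa only [meetKey_injective.eq_iff] using this
    refine wp_forKeys meetKey ks (by simpa using hks)
      (fun d τ t => t ≤ (d.map fun y => 30 + 30 * (lp.filter fun p =>
          outWeight cl trans p y ≠ 0).length).sum ∧
        ∀ p ∈ lp, (τ.tab .sig .nil).val (.state p) =
          encPairs (nzList meetKey (outWeight cl trans p) d)) ?_ ?_ ?_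
    · refine ⟨by simp, ?_⟩
      intro p hp
      simp [nzList, encPairs, Val.ofList]
    · rintro d y d' hd ρ t ⟨ht, hv⟩ hF
      have hmeet : ρ.tab .meet .nil = τ1.tab .meet .nil := by
        rw [hF.tab _ (by decide)]; simp
      simp only [wp_seq, wp_get]
      refine wp_forList (fun p => .cons (.state p) (.weight (outWeight cl trans p y)))
        ((lp.filter fun p => outWeight cl trans p y ≠ 0).reverse)
        (by simp only [Expr.eval, Store.reg_setReg, if_true, Store.tab_setReg, hmeet, hv1,
              encPairs_nzList])
        (fun dd τ t => t ≤ 29 * dd.length ∧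
          ∀ p ∈ lp, (τ.tab .sig .nil).val (.state p) =
            encPairs (if p ∈ dd then (meetKey y, outWeight cl trans p y) ::
                nzList meetKey (outWeight cl trans p) d
              else nzList meetKey (outWeight cl trans p) d)) ?_ ?_ ?_
      · refine ⟨by simp, ?_⟩
        intro p hp
        simpa using hv p hp
      · rintro dd p dd' hdd τ t' ⟨ht', hv'⟩ hF'
        have hnd' : ((lp.filter fun p => outWeight cl trans p y ≠ 0).reverse).Nodup :=
          List.nodup_reverse.2 (hnd.filter _)
        have hpdd : p ∉ dd := by
          rw [hdd, List.nodup_append] at hnd'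
          intro h
          exact hnd'.2.2 _ h _ (List.mem_cons_self) rfl
        have hplp : p ∈ lp := by
          have : p ∈ (lp.filter fun p => outWeight cl trans p y ≠ 0).reverse := by
            rw [hdd]; simp
          simp only [List.mem_reverse, List.mem_filter] at this
          exact this.1
        have hkey : τ.reg .key = meetKey y := by rw [hF'.reg _ (by decide)]; simp
        simp only [wp_seq, wp_get, wp_set, wp_put, Expr.eval, Store.reg_setReg, if_true,
          reduceCtorEq, if_false, Val.car, Val.cdr, Store.tab_setReg, hkey]
        refine ⟨by simp; omega, ?_⟩
        intro p' hp'
        by_cases hpp : p' = p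
        · subst hpp
          simp [LMap.val_put, hv' p' hp', hpdd, encPairs, Val.ofList]
        · simp [LMap.val_put, hv' p' hp', hpp]
      · rintro τ t' hF' ⟨ht', hv'⟩
        refine ⟨?_, ?_⟩
        · simp only [List.map_append, List.map_cons, List.map_nil, List.sum_append, List.sum_cons,
            List.sum_nil, List.length_reverse] at ht' ⊢
          simp [meetKey]
          simp at ht ht'
          omega
        · intro p hp
          rw [hv' p hp, nzList_append_singleton, insertNZ]
          by_cases h0 : outWeight cl trans p y = 0 <;> simp [h0, hp]
    · rintro τ t hF ⟨ht, hv⟩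
      have hb1 : ks.length ≤ (lp.map fun p => (outArcs trans p).length).sum := by
        have : (lp.flatMap fun p => (outArcs trans p).map fun e => (e.1, cl e.2.2)).length =
            (lp.map fun p => (outArcs trans p).length).sum := by
          simp [List.length_flatMap]
        rw [← this]
        refine (hknd.subperm fun y hy => ?_).length_le
        obtain ⟨p, hp, e, he, rfl⟩ := (hkmem y).1 hy
        exact List.mem_flatMap.2 ⟨p, hp, List.mem_map_of_mem he⟩
      have hb2 : (ks.map fun y => (lp.filter fun p => outWeight cl trans p y ≠ 0).length).sum ≤
          (lp.map fun p => (outArcs trans p).length).sum := by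
        rw [List.sum_length_filter_comm (fun p y => decide (outWeight cl trans p y ≠ 0)) lp ks]
        exact List.sum_le_sum fun p _ => length_filter_outWeight_le hknd p
      refine ⟨fun p => encPairs (nzList meetKey (outWeight cl trans p) ks), hv, ?_, ?_, ?_⟩
      · intro p hp p' hp'
        rw [encPairs_injective.eq_iff, nzList_eq_iff meetKey_injective]
        constructor
        · intro h y
          by_cases hy : y ∈ ks
          · exact h y hy
          -- A pair that is not a key of `meet` is reached by no arc from the class, so agreement on
          -- the keys is agreement everywhere.
          · have h1 : ∀ p ∈ lp, outWeight cl trans p y = 0 := by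
              intro p hp
              by_contra h0
              obtain ⟨e, he, h⟩ := exists_arc_of_outWeight_ne_zero h0
              exact hy ((hkmem y).2 ⟨p, hp, e, he, h⟩)
            rw [h1 p hp, h1 p' hp']
        · exact fun h y _ => h y
      · intro p
        have h1 := size_encPairs_le (B := 3)
          (nzList (meetKey : _ → Val K A Q) (outWeight cl trans p) ks) (by
          intro e he
          simp only [nzList, List.mem_map] at he
          obtain ⟨y, -, rfl⟩ := he
          simp [meetKey])
        have h2 : (nzList (meetKey : _ → Val K A Q) (outWeight cl trans p) ks).length ≤
            (outArcs trans p).length := by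
          simpa [nzList] using length_filter_outWeight_le (cl := cl) (trans := trans) hknd p
        beta_reduce
        omega
      · rw [List.sum_map_mul_left] at ht1
        rw [List.sum_map_add, List.sum_map_mul_left] at ht
        simp only [List.map_const', List.sum_replicate, smul_eq_mul, List.sum_map_add] at ht ht1 ⊢
        simp only [hashCost, Expr.cost, Expr.eval, Val.size, Store.reg_setTab, hC]
        omega

end Cmd

/-! ## Signatures in the Predecessor Class Split Algorithm -/

section FromWeight

variable {K : Type u} {A : Type v} {Q : Type w} [Semiring K] [DecidableEq Q]

/-- Sum of the weights of the arcs of `l` with other end `p`. -/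
def endWeight (l : List (Arc K A Q)) (p : AugState Q) : K :=
  ((l.filter fun e => e.2.2 = p).map fun e => e.2.1).sum

theorem endWeight_append_singleton (l : List (Arc K A Q)) (e : Arc K A Q) (p : AugState Q) :
    endWeight (l ++ [e]) p = if e.2.2 = p then endWeight l p + e.2.1 else endWeight l p := by
  unfold endWeight
  by_cases h : e.2.2 = p <;> simp [List.filter_append, h]

variable [DecidableEq A]

/-- The arcs of `E` with label `a`, the last first. -/
def labelled (E : List (Arc K A Q)) (a : Option A) : List (Arc K A Q) :=
  (E.filter fun e => e.1 = a).reverse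

/-- Sum of the weights of the arcs of `E` with label `a` and other end `p`. -/
def inWeight (E : List (Arc K A Q)) (p : AugState Q) (a : Option A) : K :=
  endWeight (labelled E a) p

theorem exists_arc_of_inWeight_ne_zero {E : List (Arc K A Q)} {p : AugState Q} {a : Option A}
    (h : inWeight E p a ≠ 0) : ∃ e ∈ E, e.2.2 = p ∧ e.1 = a := by
  by_contra hcon
  push Not at hcon
  apply h
  unfold inWeight endWeight labelled
  rw [List.filter_eq_nil_iff.2]
  · rfl
  · intro e he h'
    simp only [List.mem_reverse, List.mem_filter, decide_eq_true_eq] at he h'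
    exact hcon e he.1 h' he.2

theorem length_filter_inWeight_le [DecidableEq K] {as : List (Option A)} (has : as.Nodup)
    (E : List (Arc K A Q)) (p : AugState Q) :
    (as.filter fun a => inWeight E p a ≠ 0).length ≤ (E.filter fun e => e.2.2 = p).length := by
  rw [← List.length_map (as := E.filter fun e => e.2.2 = p) fun e => e.1]
  refine ((has.filter _).subperm fun a ha => ?_).length_le
  simp only [List.mem_filter, decide_eq_true_eq] at ha
  obtain ⟨e, he, hp, rfl⟩ := exists_arc_of_inWeight_ne_zero ha.2
  exact List.mem_map.2 ⟨e, by simp [he, hp], rfl⟩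

end FromWeight

namespace Cmd

variable {K : Type u} {A : Type v} {Q : Type w}

theorem letter_injective : Function.Injective (Val.letter : Option A → Val K A Q) :=
  fun _ _ h => by simpa using h

variable [DecidableEq K] [DecidableEq A] [DecidableEq Q] [Semiring K]
variable {σ : Store K A Q} {cl : AugState Q → ℕ} {f : ℕ}
  {trans : List (AugState Q × Option A × K × AugState Q)}

/-- Arcs are grouped by label first, so that for a fixed state all insertions of a label are
consecutive and special insertion applies. A state may remain among the keys of `sig` with an empty
list, after cancellation; the value `nil` thus stands for the zero signature, whether or not the
state is a key. -/
theorem wp_pcsaSignatures (hA : σ.Adj trans) (hwf : σ.WF)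
    (hnz : ∀ e ∈ trans, e.2.2.1 ≠ 0) {D : ℕ} (hD : σ.reg .D = .num D) {lq : List (AugState Q)}
    (hlq : (σ.tab .mem (.num D)).keys = lq.map .state)
    {E : List (Arc K A Q)} (hE : E = lq.flatMap (inArcs trans)) :
    pcsaSignatures.wp σ fun τ t => ∃ (s : AugState Q → Val K A Q) (lk : List (AugState Q)),
      (∀ p, (τ.tab .sig .nil).val (.state p) = s p) ∧
      (τ.tab .sig .nil).keys = lk.map .state ∧ lk.length ≤ E.length ∧
      (∀ p p', s p = s p' ↔ ∀ a, inWeight E p a = inWeight E p' a) ∧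
      (lk.map fun p => (s p).size).sum ≤ 5 * E.length ∧
      t ≤ 300 * (1 + lq.length + E.length) := by
  have hEnz : ∀ e ∈ E, e.2.1 ≠ 0 := by
    intro e he
    rw [hE, List.mem_flatMap] at he
    obtain ⟨q, -, he⟩ := he
    exact (arcs_weight_ne_zero hnz q).2 e he
  simp only [pcsaSignatures, block, wp_seq, wp_clear]
  refine wp_forKeys .state lq (by simpa [hD] using hlq)
    (fun d τ t => t ≤ (d.map fun q => 100 * (1 + (inArcs trans q).length)).sum ∧
      (∀ a, (τ.tab .meet .nil).val (.letter a) =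
        .ofList ((labelled (d.flatMap (inArcs trans)) a).map fun e =>
          .cons (.state e.2.2) (.weight e.2.1))) ∧
      (∀ z, z ∈ (τ.tab .meet .nil).keys ↔
        ∃ e ∈ d.flatMap (inArcs trans), z = .letter e.1)) ?_ ?_ ?_
  · exact ⟨by simp, by simp [labelled, Val.ofList], by simp⟩
  · rintro d q d' hd ρ t ⟨ht, hv, hk⟩ hF
    have hinn : ρ.tab .inn = σ.tab .inn := hF.tab _ (by decide)
    simp only [wp_seq, wp_get]
    refine wp_forList encArc (inArcs trans q) (by simp [hinn, hA.inn])
      (fun dd τ t => t ≤ 90 * dd.length ∧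
        (∀ a, (τ.tab .meet .nil).val (.letter a) =
          .ofList ((labelled (d.flatMap (inArcs trans) ++ dd) a).map fun e =>
            .cons (.state e.2.2) (.weight e.2.1))) ∧
        (∀ z, z ∈ (τ.tab .meet .nil).keys ↔
          ∃ e ∈ d.flatMap (inArcs trans) ++ dd, z = .letter e.1)) ?_ ?_ ?_
    · refine ⟨by simp, ?_, ?_⟩
      · intro a
        simpa using hv a
      · intro z
        simpa using hk z
    · rintro dd ⟨a, k, p⟩ dd' hdd τ t' ⟨ht', hv', hk'⟩ hF'
      simp only [wp_seq, wp_get, wp_set, wp_put, encArc, Expr.eval, Store.reg_setReg, if_true,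
        reduceCtorEq, if_false, Val.car, Val.cdr, Store.tab_setReg]
      refine ⟨by simp; omega, ?_, ?_⟩
      · intro a'
        by_cases ha : a' = a
        · subst ha
          simp [LMap.val_put, hv', labelled, Val.ofList]
        · have ha' : ¬ a = a' := fun h => ha h.symm
          simp [LMap.val_put, hv', labelled, ha, ha']
      · intro z
        simp only [Store.tab_setTab, and_self, if_true, LMap.mem_keys_put, Store.tab_setReg, hk',
          ← List.append_assoc]
        rw [or_comm]
        simp only [List.mem_append, List.mem_singleton, or_and_right, exists_or, exists_eq_left]
    · rintro τ t' hF' ⟨ht', hv', hk'⟩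
      refine ⟨by simp; omega, ?_, ?_⟩
      · simpa using hv'
      · intro z
        rw [hk']
        simp
  · rintro τ1 t1 hF1 ⟨ht1, hv1, hk1⟩
    rw [← hE] at hk1
    simp only [← hE] at hv1
    have hwf1 : τ1.WF := hF1.wf (hwf.setTab _ _ LMap.wf_empty)
    simp only [Expr.eval]
    obtain ⟨as, has⟩ := List.exists_eq_map_of_forall Val.letter (τ1.tab .meet .nil).keys (by
      intro z hz
      obtain ⟨e, -, rfl⟩ := (hk1 z).1 hz
      exact ⟨_, rfl⟩)
    have hand : as.Nodup := by
      have := (hwf1 .meet .nil).1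
      rw [has] at this
      exact this.of_map
    have hamem : ∀ a, a ∈ as ↔ ∃ e ∈ E, a = e.1 := by
      intro a
      have := hk1 (.letter a)
      rw [has, List.mem_map_of_injective letter_injective] at this
      simpa only [letter_injective.eq_iff] using this
    refine wp_forKeys .letter as (by simpa using has)
      (fun d τ t => t ≤ (d.map fun a => 30 + 60 * (labelled E a).length).sum ∧
        (∀ z ∈ (τ.tab .sig .nil).keys, ∃ e ∈ E, z = .state e.2.2) ∧
        ∀ p, (τ.tab .sig .nil).val (.state p) =
          encPairs (nzList .letter (inWeight E p) d)) ?_ ?_ ?_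
    · exact ⟨by simp, by simp, by simp [nzList, encPairs, Val.ofList]⟩
    · rintro d a d' hd ρ t ⟨ht, hs, hv⟩ hF
      have had : a ∉ d := by
        rw [hd, List.nodup_append] at hand
        intro h
        exact hand.2.2 _ h _ (List.mem_cons_self) rfl
      have hmeet : ρ.tab .meet .nil = τ1.tab .meet .nil := by
        rw [hF.tab _ (by decide)]; simp
      simp only [wp_seq, wp_get]
      refine wp_forList (fun e => .cons (.state e.2.2) (.weight e.2.1)) (labelled E a)
        (by simp only [Expr.eval, Store.reg_setReg, if_true, Store.tab_setReg, hmeet, hv1])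
        (fun dd τ t => t ≤ 59 * dd.length ∧
          (∀ z ∈ (τ.tab .sig .nil).keys, ∃ e ∈ E, z = .state e.2.2) ∧
          ∀ p, (τ.tab .sig .nil).val (.state p) =
            encPairs (insertNZ (.letter a) (endWeight dd p)
              (nzList .letter (inWeight E p) d))) ?_ ?_ ?_
      · refine ⟨by simp, hs, ?_⟩
        intro p
        simpa [endWeight, insertNZ] using hv p
      · rintro dd ⟨a', k, p⟩ dd' hdd τ t' ⟨ht', hs', hv'⟩ hF'
        have ha : τ.reg .a = .letter a := by rw [hF'.reg _ (by decide)]; simp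
        have heE : (a', k, p) ∈ E := by
          have : (a', k, p) ∈ labelled E a := by rw [hdd]; simp
          simp only [labelled, List.mem_reverse, List.mem_filter] at this
          exact this.1
        have hk0 : k ≠ 0 := hEnz _ heE
        simp only [wp_seq, wp_set, Expr.eval, Store.reg_setReg, if_true, reduceCtorEq, if_false,
          Val.car, Val.cdr]
        refine wp_mono (wp_specialInsert (y := .state p) (x := .letter a)
          (s := endWeight dd p) (k := k)
          (l := nzList .letter (inWeight E p) d) ?_ ?_ ?_ ?_ ?_ ?_ ?_ hk0) ?_
        · intro ρ hρ
          simp [hρ]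
        · intro ρ hρ
          simp [hρ, ha]
        · exact hv' p
        · intro e he
          simp only [nzList, List.mem_map, List.mem_reverse, List.mem_filter] at he
          obtain ⟨a'', ha'', rfl⟩ := he
          refine ⟨?_, rfl⟩
          simp only [ne_eq, Val.letter.injEq]
          rintro rfl
          exact had ha''.1
        · simp
        · simp
        · simp
        · rintro τ2 t2 - ⟨h1, h2⟩
          simp only [h1]
          refine ⟨?_, ?_, ?_⟩
          · simp at h2 ⊢; omega
          · intro z hz
            simp only [Store.tab_setTab, and_self, if_true, LMap.mem_keys_put,
              Store.tab_setReg] at hz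
            rcases hz with rfl | hz
            · exact ⟨_, heE, rfl⟩
            · exact hs' z hz
          · intro p'
            rw [endWeight_append_singleton]
            by_cases hp : p' = p
            · subst hp
              simp [LMap.val_put]
            · have hp' : ¬ p = p' := fun h => hp h.symm
              simp [LMap.val_put, hv', hp, hp']
      · rintro τ t' hF' ⟨ht', hs', hv'⟩
        refine ⟨?_, hs', ?_⟩
        · simp at ht ht' ⊢
          omega
        · intro p
          rw [hv' p, nzList_append_singleton, inWeight]
    · rintro τ t hF ⟨ht, hs, hv⟩
      have hwf2 : τ.WF := hF.wf (hwf1.setTab _ _ LMap.wf_empty)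
      obtain ⟨lk, hlk⟩ := List.exists_eq_map_of_forall Val.state (τ.tab .sig .nil).keys (by
        intro z hz
        obtain ⟨e, -, rfl⟩ := hs z hz
        exact ⟨_, rfl⟩)
      have hlknd : lk.Nodup := by
        have := (hwf2 .sig .nil).1
        rw [hlk] at this
        exact this.of_map
      have hlklen : lk.length ≤ E.length := by
        rw [← List.length_map (as := E) fun e => e.2.2]
        refine (hlknd.subperm fun p hp => ?_).length_le
        obtain ⟨e, he, h⟩ := hs (.state p) (by rw [hlk]; exact List.mem_map_of_mem hp)
        simp only [Val.state.injEq] at h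
        exact List.mem_map.2 ⟨e, he, h.symm⟩
      have hb1 : as.length ≤ E.length := by
        rw [← List.length_map (as := E) fun e => e.1]
        refine (hand.subperm fun a ha => ?_).length_le
        obtain ⟨e, he, rfl⟩ := (hamem a).1 ha
        exact List.mem_map_of_mem he
      have hb2 : (as.map fun a => (labelled E a).length).sum ≤ E.length := by
        simpa [labelled] using List.sum_fibers_le (fun e : Arc K A Q => e.1) (fun _ => 1) as hand E
      refine ⟨fun p => encPairs (nzList .letter (inWeight E p) as), lk, hv, hlk, hlklen, ?_, ?_, ?_⟩
      · intro p p'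
        rw [encPairs_injective.eq_iff, nzList_eq_iff letter_injective]
        constructor
        · intro h a
          by_cases ha : a ∈ as
          · exact h a ha
          · have h1 : ∀ p, inWeight E p a = 0 := by
              intro p
              by_contra h0
              obtain ⟨e, he, -, h⟩ := exists_arc_of_inWeight_ne_zero h0
              exact ha ((hamem a).2 ⟨e, he, h.symm⟩)
            rw [h1 p, h1 p']
        · exact fun h a _ => h a
      · have h1 : ∀ p, (encPairs (nzList (.letter : _ → Val K A Q) (inWeight E p) as)).size ≤
            1 + 4 * (E.filter fun e => e.2.2 = p).length := by
          intro p
          have h1 := size_encPairs_le (B := 1)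
            (nzList (.letter : _ → Val K A Q) (inWeight E p) as) (by
              intro e he
              simp only [nzList, List.mem_map] at he
              obtain ⟨y, -, rfl⟩ := he
              simp)
          have h2 : (nzList (.letter : _ → Val K A Q) (inWeight E p) as).length ≤
              (E.filter fun e => e.2.2 = p).length := by
            simpa [nzList] using length_filter_inWeight_le hand E p
          omega
        have h2 : (lk.map fun p => (E.filter fun e => e.2.2 = p).length).sum ≤ E.length := by
          simpa using List.sum_fibers_le (fun e : Arc K A Q => e.2.2) (fun _ => 1) lk hlknd E
        refine (List.sum_le_sum fun p _ => h1 p).trans ?_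
        rw [List.sum_map_add, List.sum_map_mul_left]
        simp only [List.map_const', List.sum_replicate, smul_eq_mul]
        omega
      · have h3 : (lq.map fun q => (inArcs trans q).length).sum = E.length := by
          rw [hE, List.length_flatMap]
        rw [List.sum_map_mul_left] at ht1
        rw [List.sum_map_add, List.sum_map_mul_left] at ht
        simp only [List.map_const', List.sum_replicate, smul_eq_mul, List.sum_map_add] at ht ht1 ⊢
        simp only [hashCost, Expr.cost, Expr.eval, Val.size, Store.reg_setTab, hD]
        omega

end Cmd

/-! ## The Domain Split Algorithm -/

namespace Cmd

variable {K : Type u} {A : Type v} {Q : Type w} [DecidableEq A] [DecidableEq Q] [Semiring K]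

/-- States of the same class have the same weights with respect to all labels and classes. -/
def Stable (trans : List (AugState Q × Option A × K × AugState Q)) (cl : AugState Q → ℕ) : Prop :=
  ∀ p p', cl p = cl p' → ∀ y, outWeight cl trans p y = outWeight cl trans p' y

/-- The relation `R` is finer than the initial partition, and related states have the same weights
with respect to every partition coarser than `R`. -/
structure IsCongruence (trans : List (AugState Q × Option A × K × AugState Q))
    (R : AugState Q → AugState Q → Prop) : Prop where
  init : ∀ p p', R p p' → initCls p = initCls p'
  weight : ∀ cl : AugState Q → ℕ, (∀ p p', R p p' → cl p = cl p') →
    ∀ p p', R p p' → ∀ y, outWeight cl trans p y = outWeight cl trans p' y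

/-- The partition lies between the initial partition and all congruences, and the classes below
`f`, with the possible exception of the initial class of the true states, are nonempty. -/
structure Between (trans : List (AugState Q × Option A × K × AugState Q)) (cl : AugState Q → ℕ)
    (f : ℕ) : Prop where
  init : ∀ p p', cl p = cl p' → initCls p = initCls p'
  coarse : ∀ R, IsCongruence trans R → ∀ p p', R p p' → cl p = cl p'
  nonempty : ∀ c < f, c = 1 ∨ ∃ p, cl p = c

variable {trans : List (AugState Q × Option A × K × AugState Q)} {cl cl' : AugState Q → ℕ}
  {f f' : ℕ}

theorem between_initCls : Between trans initCls 3 := by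
  refine ⟨fun _ _ h => h, fun R hR => hR.init, ?_⟩
  intro c hc
  interval_cases c
  · exact Or.inr ⟨.ini, rfl⟩
  -- The class 1 is empty when the automaton has no true state; hence the exception in `Between`.
  · exact Or.inl rfl
  · exact Or.inr ⟨.fin, rfl⟩

/-- By `hμ`, marks separate only states of a class with different weights. The current classes are
unions of blocks of any congruence, so congruent states have equal weights and receive equal marks.
-/
theorem Between.split {V : Type*} {μ : AugState Q → Option V} (h : Between trans cl f)
    (hS : SplitBy cl f μ cl' f')
    (hμ : ∀ p p', cl p = cl p' → (∀ y, outWeight cl trans p y = outWeight cl trans p' y) →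
      μ p = μ p') : Between trans cl' f' := by
  refine ⟨fun p p' hp => h.init p p' ((hS.ker p p').1 hp).1, ?_, ?_⟩
  · intro R hR p p' hp
    have h1 := h.coarse R hR
    exact (hS.ker p p').2 ⟨h1 p p' hp, hμ p p' (h1 p p' hp) (hR.weight cl h1 p p' hp)⟩
  · intro c hc
    by_cases hcf : c < f
    · rcases h.nonempty c hcf with h1 | ⟨p, rfl⟩
      · exact Or.inl h1
      · exact Or.inr (hS.old p)
    · exact Or.inr (hS.new c (by omega) hc)

/-- Every number below `f` is a value of `cl`, except possibly 1; this exception is the added unit.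
-/
theorem Between.le_length (h : Between trans cl f) {all : List (AugState Q)}
    (hall : ∀ p, p ∈ all) : f ≤ all.length + 1 := by
  have h1 : List.range f ⊆ 1 :: all.map cl := by
    intro c hc
    rcases h.nonempty c (List.mem_range.1 hc) with rfl | ⟨p, rfl⟩
    · simp
    · exact List.mem_cons_of_mem _ (List.mem_map_of_mem (hall p))
  simpa using (List.nodup_range.subperm h1).length_le

/-- Sum of `w` over the class `c`. -/
def classSum (all : List (AugState Q)) (cl : AugState Q → ℕ) (w : AugState Q → ℕ) (c : ℕ) : ℕ :=
  ((all.filter fun p => cl p = c).map w).sum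

/-- The stored order of the members depends on the history of the run; sums over the class do not,
and all costs are stated with `classSum`. -/
theorem _root_.Store.Part.exists_members {K : Type u} {A : Type v} {Q : Type w} [DecidableEq Q]
    {σ : Store K A Q} {cl : AugState Q → ℕ} {f : ℕ}
    (hσ : σ.Part cl f) (hwf : σ.WF) {all : List (AugState Q)} (hnd : all.Nodup)
    (hall : ∀ p, p ∈ all) (c : ℕ) : ∃ lp : List (AugState Q),
      (σ.tab .mem (.num c)).keys = lp.map .state ∧ lp.Nodup ∧ (∀ p, p ∈ lp ↔ cl p = c) ∧
      ∀ w : AugState Q → ℕ, (lp.map w).sum = classSum all cl w c := by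
  obtain ⟨lp, hlp⟩ := List.exists_eq_map_of_forall Val.state (σ.tab .mem (.num c)).keys (by
    intro z hz
    obtain ⟨p, rfl, -⟩ := (hσ.mem c z).1 hz
    exact ⟨p, rfl⟩)
  have h1 : lp.Nodup := by
    have := (hwf .mem (.num c)).1
    rw [hlp] at this
    exact this.of_map
  have h2 : ∀ p, p ∈ lp ↔ cl p = c := by
    intro p
    have := hσ.mem c (.state p)
    rw [hlp, List.mem_map_of_injective (fun _ _ h => by simpa using h)] at this
    rw [this]
    constructor
    · rintro ⟨p', h, hp'⟩
      simp only [Val.state.injEq] at h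
      rw [h, hp']
    · exact fun h => ⟨p, rfl, h⟩
  refine ⟨lp, hlp, h1, h2, fun w => ?_⟩
  refine (List.Perm.map w ?_).sum_eq
  rw [List.perm_ext_iff_of_nodup h1 (hnd.filter _)]
  intro p
  simp [h2, hall]

theorem sum_classSum_le {Q : Type w} (all : List (AugState Q)) (cl : AugState Q → ℕ) (w : AugState Q → ℕ)
    {cs : List ℕ} (hcs : cs.Nodup) : (cs.map (classSum all cl w)).sum ≤ (all.map w).sum :=
  List.sum_fibers_le cl w cs hcs all

variable [DecidableEq K] {σ : Store K A Q} {all : List (AugState Q)}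

/-- The queue contains only numbers of classes. -/
def QueueLT (M : LMap K A Q) (f : ℕ) : Prop := ∀ z ∈ M.keys, ∃ c < f, z = .num c

theorem wp_enqueue {c : Expr} {C : ℕ} {B : List (AugState Q)} (hc : c.eval σ.reg = .num C)
    (hg : σ.reg .g = .ofList (B.map .state)) :
    (enqueue c).wp σ fun τ t => t ≤ 10 + 2 * c.cost ∧ τ.reg = σ.reg ∧
      ((τ = σ ∧ B.length ≤ 1) ∨ τ.tab .que .nil = (σ.tab .que .nil).put (.num C) .nil) := by
  simp only [enqueue, wp_ite, wp_skip, wp_put, Test.holds, Expr.eval, hg, hc]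
  match B with
  | [] => simp [Val.ofList]; omega
  | [b] => simp [Val.ofList]; omega
  | b :: b' :: B' => simp [Val.ofList, hc]; omega

/-- Only states of `C` are marked, so the other classes keep their members. The resulting classes
are queued again unless they are singletons, which can neither be split nor violate stability. -/
theorem wp_dsaIteration (hσ : σ.Part cl f) (hA : σ.Adj trans) (hwf : σ.WF)
    (hnz : ∀ e ∈ trans, e.2.2.1 ≠ 0) (hnd : all.Nodup) (hall : ∀ p, p ∈ all)
    {C : ℕ} (hC : σ.reg .C = .num C) (hQ : QueueLT (σ.tab .que .nil) f) :
    dsaIteration.wp σ fun τ t => ∃ (cl' : AugState Q → ℕ) (f' : ℕ)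
      (μ : AugState Q → Option (Val K A Q)),
      τ.Part cl' f' ∧ SplitBy cl f μ cl' f' ∧ (∀ p, cl p ≠ C → μ p = none) ∧
      (∀ p p', cl p = C → cl p' = C → (μ p = μ p' ↔
        ∀ y, outWeight cl trans p y = outWeight cl trans p' y)) ∧
      QueueLT (τ.tab .que .nil) f' ∧
      (∀ z ∈ (σ.tab .que .nil).keys, z ≠ .num C → z ∈ (τ.tab .que .nil).keys) ∧
      (∀ p p', p ≠ p' → cl p = C → cl' p = cl' p' → .num (cl' p) ∈ (τ.tab .que .nil).keys) ∧
      ((f' = f ∧ τ.reg .split = σ.reg .split) ∨ (f < f' ∧ τ.reg .split = .num 1)) ∧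
      t ≤ 1000 * (1 + classSum all cl (fun p => 1 + (outArcs trans p).length) C) := by
  obtain ⟨lp, hlp, hlnd, hlmem, hlsum⟩ := hσ.exists_members hwf hnd hall C
  rw [← hlsum]
  simp only [dsaIteration, block, wp_seq, wp_del, Expr.eval, hC]
  set σ1 := σ.setTab .que .nil ((σ.tab .que .nil).del (.num C)) with hσ1
  have hwf1 : σ1.WF := hwf.setTab _ _ ((hwf _ _).del _)
  have hP1 : σ1.Part cl f := hσ.congr (by funext i; simp [hσ1]) (by funext i; simp [hσ1]) rfl
  have hA1 : σ1.Adj trans := hA.congr (by funext i; simp [hσ1]) (by funext i; simp [hσ1])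
  refine wp_mono (wp_dsaSignatures hP1 hA1 hwf1 hnz (C := C) (by simp [hσ1, hC])
    (lp := lp) (by simpa [hσ1] using hlp) hlnd) ?_
  rintro σ2 t2 hF2 ⟨s, hsig, hseq, hsize, ht2⟩
  simp only [wp_clear]
  have hC2 : σ2.reg .C = .num C := by rw [hF2.reg _ (by decide)]; exact hC
  have hmem2 : σ2.tab .mem = σ.tab .mem := by
    rw [hF2.tab _ (by decide)]; funext i; simp [hσ1]
  refine wp_forKeys .state lp (by simp [hC2, hmem2, hlp])
    (fun d τ t => τ.Buckets cl d s ∧ t ≤ (d.map fun p => 40 + 2 * (s p).size).sum) ?_ ?_ ?_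
  · exact ⟨⟨by simp, by simp [Val.ofList]⟩, by simp⟩
  · rintro d p d' hd ρ t ⟨hB, ht⟩ hF
    have hplp : p ∈ lp := by rw [hd]; simp
    have hsig' : ρ.tab .sig .nil = σ2.tab .sig .nil := by rw [hF.tab _ (by decide)]; simp
    simp only [wp_seq, wp_get]
    refine wp_mono (wp_toBucket (cl := cl) (ps := d) (s := s) (p := p) ⟨?_, ?_⟩ ?_ ?_ ?_) ?_
    · simpa using hB.keys
    · simpa using hB.val
    · simp
    · simp only [Store.reg_setReg, reduceCtorEq, if_false]
      rw [hF.reg _ (by decide), (hlmem p).1 hplp]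
      simpa using hC2
    · simp [hsig', hsig p hplp]
    · rintro τ t' - ⟨h1, h2⟩
      refine ⟨h1, ?_⟩
      simp only [List.map_append, List.sum_append, List.map_cons, List.map_nil, List.sum_cons,
        List.sum_nil, hashCost, Expr.cost, Expr.eval, Store.reg_setReg, if_true, Val.size]
      omega
  · rintro σ3 t3 hF3 ⟨hB3, ht3⟩
    have hque3 : σ3.tab .que .nil = (σ.tab .que .nil).del (.num C) := by
      rw [hF3.tab _ (by decide)]
      simp only [Store.tab_setTab, reduceCtorEq, false_and, if_false]
      rw [hF2.tab _ (by decide)]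
      simp [hσ1]
    have hspl3 : σ3.reg .split = σ.reg .split := by
      rw [hF3.reg _ (by decide)]
      simp only [Store.reg_setTab]
      rw [hF2.reg _ (by decide)]
      simp [hσ1]
    have hP3 : σ3.Part cl f := by
      refine hP1.congr ?_ ?_ ?_
      · rw [hF3.tab _ (by decide)]
        funext i
        simp only [Store.tab_setTab, reduceCtorEq, false_and, if_false]
        rw [hF2.tab _ (by decide)]
      · rw [hF3.tab _ (by decide)]
        funext i
        simp only [Store.tab_setTab, reduceCtorEq, false_and, if_false]
        rw [hF2.tab _ (by decide)]
      · rw [hF3.reg _ (by decide)]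
        simp only [Store.reg_setTab]
        rw [hF2.reg _ (by decide)]
    have hwf3 : σ3.WF := hF3.wf ((hF2.wf hwf1).setTab _ _ LMap.wf_empty)
    refine wp_mono (wp_splitBuckets hP3 hwf3 hB3
      (by intro r; cases r <;> decide) (by intro T; cases T <;> decide)
      (by intro r; cases r <;> decide) (by intro T; cases T <;> decide)
      (fun cl' f' μ M sp => QueueLT M f' ∧
        (∀ z ∈ (σ3.tab .que .nil).keys, z ∈ M.keys) ∧
        (∀ p p', p ≠ p' → μ p ≠ none → cl' p = cl' p' → .num (cl' p) ∈ M.keys) ∧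
        ((f' = f ∧ sp = σ.reg .split) ∨ (f < f' ∧ sp = .num 1))) ?_ ?_ ?_ hlnd) ?_
    · refine ⟨?_, fun _ h => h, by simp, Or.inl ⟨rfl, hspl3⟩⟩
      intro z hz
      rw [hque3, (hwf _ _).mem_keys_del] at hz
      exact hQ z hz.2
    · rintro ρ cl' f' μ D v B hS ⟨j1, j2, j3, j4⟩ hlt hCD hg hne hBnd hB hBC -
      refine wp_mono (wp_enqueue (C := D) (B := B) (by simpa using hCD) hg) ?_
      rintro τ t - ⟨ht, hr, h⟩
      refine ⟨by simpa using ht.trans (by simp), ?_⟩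
      rw [hr]
      -- If the class is not queued it has at most one state, so it contains no two distinct states.
      rcases h with ⟨rfl, hlen⟩ | h
      · refine ⟨j1, j2, ?_, j4⟩
        intro p p' hpp hp hcl
        by_cases hpB : p ∈ B
        · have hp'B : p' ∈ B := (hB p').1 (hcl ▸ (hB p).2 hpB)
          match B, hlen with
          | [b], _ => simp_all
        · exact j3 p p' hpp (by simpa [markWith, hpB] using hp) hcl
      · rw [h]
        refine ⟨?_, ?_, ?_, j4⟩
        · intro z hz
          rw [LMap.mem_keys_put] at hz
          rcases hz with rfl | hz
          · obtain ⟨b, hb⟩ := List.exists_mem_of_ne_nil B hne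
            exact ⟨D, (hB b).2 hb ▸ hlt b, rfl⟩
          · exact j1 z hz
        · intro z hz
          rw [LMap.mem_keys_put]
          exact Or.inr (j2 z hz)
        · intro p p' hpp hp hcl
          rw [LMap.mem_keys_put]
          by_cases hpB : p ∈ B
          · left; rw [(hB p).2 hpB]
          · right; exact j3 p p' hpp (by simpa [markWith, hpB] using hp) hcl
    · rintro ρ cl' f' μ D v B r hS ⟨j1, j2, j3, j4⟩ hlt hCD hD hg hne hBnd hBC hBC' hrB hrC -
      simp only [wp_seq, wp_set, Expr.eval]
      refine wp_mono (wp_enqueue (σ := ρ.setReg .split (.num 1)) (C := f') (B := B)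
        (by simpa using hD) (by simpa using hg)) ?_
      rintro τ t - ⟨ht, hr, h⟩
      have hle := hS.le
      have hsp : (f' + 1 = f ∧ τ.reg .split = σ.reg .split) ∨
          (f < f' + 1 ∧ τ.reg .split = .num 1) := by
        right
        refine ⟨by omega, ?_⟩
        rw [hr]; simp
      refine ⟨?_, ?_⟩
      · simp only [Expr.cost] at ht ⊢
        omega
      rcases h with ⟨rfl, hlen⟩ | h
      · refine ⟨?_, j2, ?_, hsp⟩
        · intro z hz
          obtain ⟨c, hc, rfl⟩ := j1 z hz
          exact ⟨c, by omega, rfl⟩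
        intro p p' hpp hp hcl
        by_cases hpB : p ∈ B
        · have hp'B : p' ∈ B := by
            by_contra hp'B
            simp only [hpB, hp'B, if_true, if_false] at hcl
            exact (hlt p').ne hcl.symm
          match B, hlen with
          | [b], _ => simp_all
        · have hp'B : p' ∉ B := by
            intro hp'B
            simp only [hpB, hp'B, if_true, if_false] at hcl
            exact (hlt p).ne hcl
          simp only [hpB, hp'B, if_false] at hcl ⊢
          exact j3 p p' hpp (by simpa [markWith, hpB] using hp) hcl
      · rw [h]
        refine ⟨?_, ?_, ?_, hsp⟩
        · intro z hz
          rw [LMap.mem_keys_put] at hz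
          rcases hz with rfl | hz
          · exact ⟨f', by omega, rfl⟩
          · obtain ⟨c, hc, rfl⟩ := j1 z hz
            exact ⟨c, by omega, rfl⟩
        · intro z hz
          rw [LMap.mem_keys_put]
          exact Or.inr (j2 z hz)
        · intro p p' hpp hp hcl
          rw [LMap.mem_keys_put]
          by_cases hpB : p ∈ B
          · left; simp [hpB]
          · right
            have hp'B : p' ∉ B := by
              intro hp'B
              simp only [hpB, hp'B, if_true, if_false] at hcl
              exact (hlt p).ne hcl
            simp only [hpB, hp'B, if_false] at hcl ⊢
            exact j3 p p' hpp (by simpa [markWith, hpB] using hp) hcl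
    · rintro τ t4 hF4 ⟨cl', f', hP, hS, ⟨j1, j2, j3, j4⟩, ht4⟩
      refine ⟨cl', f', _, hP, hS, ?_, ?_, j1, ?_, ?_, j4, ?_⟩
      · intro p hp
        simp [hlmem, hp]
      · intro p p' hp hp'
        simp only [hlmem, hp, hp', if_true, Option.some.injEq]
        exact hseq p ((hlmem p).2 hp) p' ((hlmem p').2 hp')
      · intro z hz hzC
        refine j2 z ?_
        rw [hque3, (hwf _ _).mem_keys_del]
        exact ⟨hzC, hz⟩
      · intro p p' hpp hp hcl
        exact j3 p p' hpp (by simp [hlmem, hp]) hcl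
      · have h1 : (lp.map fun p => (s p).size).sum ≤
            (lp.map fun p => 6 * (1 + (outArcs trans p).length)).sum :=
          List.sum_le_sum fun p _ => (hsize p).trans (by omega)
        rw [List.sum_map_mul_left] at h1
        rw [List.sum_map_add, List.sum_map_mul_left] at ht3
        rw [List.sum_map_add] at ht4
        have h2 : lp.length ≤ (lp.map fun p => 1 + (outArcs trans p).length).sum := by
          rw [List.sum_map_add]; simp
        simp only [List.map_const', List.sum_replicate, smul_eq_mul] at ht3 ht4
        simp only [hashCost, Expr.cost, Expr.eval, Val.size, Store.reg_setTab, hC, hC2]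
        omega

/-- Every class with at least two states is in the queue. -/
def QueueFull (M : LMap K A Q) (cl : AugState Q → ℕ) : Prop :=
  ∀ p p', p ≠ p' → cl p = cl p' → .num (cl p) ∈ M.keys

/-- During the round the signatures refer to a partition that may change. If there was no split, it
did not change: all classes with two states were tested against the final partition, which is
therefore stable. Otherwise a new class number was issued. -/
theorem wp_dsaRound (hσ : σ.Part cl f) (hA : σ.Adj trans) (hwf : σ.WF)
    (hnz : ∀ e ∈ trans, e.2.2.1 ≠ 0) (hnd : all.Nodup) (hall : ∀ p, p ∈ all)
    (hQ : QueueLT (σ.tab .que .nil) f) (hQ' : QueueFull (σ.tab .que .nil) cl)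
    (hb : Between trans cl f) (hspl : σ.reg .split = .nil) :
    (forKeys .C .que .nil dsaIteration).wp σ fun τ t => ∃ (cl' : AugState Q → ℕ) (f' : ℕ),
      τ.Part cl' f' ∧ QueueLT (τ.tab .que .nil) f' ∧ QueueFull (τ.tab .que .nil) cl' ∧
      Between trans cl' f' ∧
      ((f' = f ∧ τ.reg .split = .nil ∧ Stable trans cl') ∨ (f < f' ∧ τ.reg .split = .num 1)) ∧
      t ≤ 1100 * (1 + f + (all.map fun p => 1 + (outArcs trans p).length).sum) := by
  obtain ⟨cs, hcs⟩ := List.exists_eq_map_of_forall Val.num (σ.tab .que .nil).keys (by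
    intro z hz
    obtain ⟨c, -, rfl⟩ := hQ z hz
    exact ⟨c, rfl⟩)
  have hcnd : cs.Nodup := by
    have := (hwf .que .nil).1
    rw [hcs] at this
    exact this.of_map
  have hclt : ∀ c ∈ cs, c < f := by
    intro c hc
    obtain ⟨c', hc', h⟩ := hQ (.num c) (by rw [hcs]; exact List.mem_map_of_mem hc)
    simp only [Val.num.injEq] at h
    rwa [h]
  -- An old class not yet treated still has its initial members. The costs can therefore be
  -- expressed with the partition at the beginning of the round, where the classes of `cs` are
  -- disjoint.
  refine wp_forKeys .num cs (by simpa using hcs)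
    (fun d τ t => (∃ (cl' : AugState Q → ℕ) (f' : ℕ), f ≤ f' ∧
      τ.Part cl' f' ∧ QueueLT (τ.tab .que .nil) f' ∧ QueueFull (τ.tab .que .nil) cl' ∧
      Between trans cl' f' ∧ (∀ c < f, c ∉ d → ∀ p, cl' p = c ↔ cl p = c) ∧
      ((f' = f ∧ cl' = cl ∧ τ.reg .split = .nil ∧ ∀ c ∈ d, ∀ p p', cl p = c → cl p' = c →
        ∀ y, outWeight cl trans p y = outWeight cl trans p' y) ∨
      (f < f' ∧ τ.reg .split = .num 1))) ∧
      t ≤ (d.map fun c => 1010 * (1 +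
        classSum all cl (fun p => 1 + (outArcs trans p).length) c)).sum) ?_ ?_ ?_
  · exact ⟨⟨cl, f, le_rfl, hσ, hQ, hQ', hb, by simp, Or.inl ⟨rfl, rfl, hspl, by simp⟩⟩, by simp⟩
  · rintro d C d' hd ρ t ⟨⟨cl1, f1, hle, hP, hq, hq', hb1, hsame, hs⟩, ht⟩ hF
    have hCf : C < f := hclt C (by rw [hd]; simp)
    have hCd : C ∉ d := by
      rw [hd, List.nodup_append] at hcnd
      intro h
      exact hcnd.2.2 _ h _ (List.mem_cons_self) rfl
    refine wp_mono (wp_dsaIteration (σ := ρ.setReg .C (.num C)) (trans := trans) (all := all)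
      (C := C) (hP.congr rfl rfl (by simp))
      ((hA.congr (hF.tab _ (by decide)) (hF.tab _ (by decide))).congr rfl rfl)
      ((hF.wf hwf).setReg _ _) hnz hnd hall (by simp) hq) ?_
    rintro τ t' - ⟨cl2, f2, μ, hP2, hS, hμ0, hμ, k1, k2, k3, k4, ht'⟩
    simp only [Store.tab_setReg] at k2
    have hμb : ∀ p p', cl1 p = cl1 p' →
        (∀ y, outWeight cl1 trans p y = outWeight cl1 trans p' y) → μ p = μ p' := by
      intro p p' h1 h2
      by_cases hp : cl1 p = C
      · exact (hμ p p' hp (h1 ▸ hp)).2 h2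
      · rw [hμ0 p hp, hμ0 p' (h1 ▸ hp)]
    refine ⟨⟨cl2, f2, hle.trans hS.le, hP2, k1, ?_, hb1.split hS hμb, ?_, ?_⟩, ?_⟩
    · intro p p' hpp hcl
      by_cases hp : cl1 p = C
      · exact k3 p p' hpp hp hcl
      · rw [hS.unmarked p (hμ0 p hp)]
        refine k2 _ (hq' p p' hpp ((hS.ker p p').1 hcl).1) ?_
        simpa using hp
    · intro c hc hcd p
      simp only [List.mem_append, List.mem_singleton, not_or] at hcd
      rw [← hsame c hc hcd.1 p]
      rcases hS.moved p with h | h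
      · rw [h]
      · constructor
        · intro h'; omega
        · intro h'
          rw [hS.unmarked p (hμ0 p (by rw [h']; exact hcd.2)), h']
    · rcases k4 with ⟨rfl, hsp⟩ | ⟨hlt, hsp⟩
      -- A moved state would have a number at least `f2`, which is not yet in use.
      · have hcl : cl2 = cl1 := by
          funext p
          rcases hS.moved p with h | h
          · exact h
          · have := hP2.lt p; omega
        simp only [Store.reg_setReg, reduceCtorEq, if_false] at hsp
        rcases hs with ⟨h1, rfl, h3, h4⟩ | ⟨h1, h2⟩
        · refine Or.inl ⟨h1, hcl, by rw [hsp, h3], ?_⟩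
          intro c hc p p' hp hp'
          simp only [List.mem_append, List.mem_singleton] at hc
          rcases hc with hc | rfl
          · exact h4 c hc p p' hp hp'
          · refine (hμ p p' hp hp').1 ?_
            refine ((hS.ker p p').1 ?_).2
            rw [hcl, hp, hp']
        · exact Or.inr ⟨h1, by rw [hsp, h2]⟩
      · exact Or.inr ⟨by omega, hsp⟩
    · have hcs' : classSum all cl1 (fun p => 1 + (outArcs trans p).length) C =
          classSum all cl (fun p => 1 + (outArcs trans p).length) C := by
        unfold classSum
        congr 2
        refine List.filter_congr fun p _ => ?_
        simp only [hsame C hCf hCd p]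
      rw [hcs'] at ht'
      simp only [List.map_append, List.sum_append, List.map_cons, List.map_nil, List.sum_cons,
        List.sum_nil]
      omega
  · rintro τ t hF ⟨⟨cl1, f1, hle, hP, hq, hq', hb1, hsame, hs⟩, ht⟩
    refine ⟨cl1, f1, hP, hq, hq', hb1, ?_, ?_⟩
    · rcases hs with ⟨h1, rfl, h3, h4⟩ | ⟨h1, h2⟩
      · refine Or.inl ⟨h1, h3, ?_⟩
        intro p p' hpp
        by_cases h : p = p'
        · subst h; exact fun _ => rfl
        · have := hQ' p p' h hpp
          rw [hcs] at this
          obtain ⟨c, hc, h⟩ := List.mem_map.1 this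
          simp only [Val.num.injEq] at h
          exact h4 c hc p p' h.symm (hpp ▸ h.symm)
      · exact Or.inr ⟨h1, h2⟩
    · have h1 : cs.length ≤ f := by
        rw [← List.length_range (n := f)]
        exact (hcnd.subperm fun c hc => List.mem_range.2 (hclt c hc)).length_le
      have h2 := sum_classSum_le all cl (fun p => 1 + (outArcs trans p).length) hcnd
      rw [List.sum_map_mul_left, List.sum_map_add] at ht
      simp only [List.map_const', List.sum_replicate, smul_eq_mul] at ht
      change _ ≤ _ * (_ + (List.map (classSum all cl _) cs).sum) at ht
      simp only [hashCost, Expr.cost, Expr.eval, Val.size]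
      omega

end Cmd

/-! ### The computed quotient, and the total time of the Domain Split Algorithm -/

namespace Cmd

variable {K : Type u} {A : Type v} {Q : Type w} [DecidableEq A] [DecidableEq Q] [Semiring K]

/-- The store represents a stable partition between the initial one and all congruences, and the
transitions of the quotient, read off a representative of every class. -/
structure Computed (trans : List (AugState Q × Option A × K × AugState Q)) (τ : Store K A Q)
    (cl : AugState Q → ℕ) : Prop where
  cls : ∀ p, (τ.tab .cls .nil).val (.state p) = .num (cl p)
  init : ∀ p p', cl p = cl p' → initCls p = initCls p'
  coarse : ∀ R, IsCongruence trans R → ∀ p p', R p p' → cl p = cl p'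
  stable : Stable trans cl
  edge : ∀ p, (p = .ini ∨ ∃ q, p = .tru q) → ∀ a d,
    ((τ.tab .edg .nil).val (edgeKey (cl p) a d)).toWeight = outWeight cl trans p (a, d)

/-- All the states of the augmented automaton. -/
def allStates {Q : Type w} (states : List Q) : List (AugState Q) :=
  .ini :: .fin :: states.map .tru

theorem nodup_allStates {Q : Type w} {states : List Q} (h : states.Nodup) :
    (allStates states).Nodup := by
  simp only [allStates, List.nodup_cons, List.mem_cons, reduceCtorEq, List.mem_map, and_false,
    exists_false, or_self, not_false_eq_true, true_and]
  exact h.map fun _ _ h => by simpa using h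

theorem mem_allStates {Q : Type w} {states : List Q} (h : ∀ q, q ∈ states) (p : AugState Q) :
    p ∈ allStates states := by
  cases p <;> simp [allStates, h]

@[simp] theorem length_allStates {Q : Type w} (states : List Q) :
    (allStates states).length = states.length + 2 := by
  simp [allStates]

theorem sum_outArcs_le {K : Type u} {A : Type v} {Q : Type w} [DecidableEq Q]
    (trans : List (AugState Q × Option A × K × AugState Q))
    {all : List (AugState Q)} (hnd : all.Nodup) :
    (all.map fun p => 1 + (outArcs trans p).length).sum ≤ all.length + trans.length := by
  have := List.sum_fibers_le (fun e : AugState Q × Option A × K × AugState Q => e.1)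
    (fun _ => 1) all hnd trans
  rw [List.sum_map_add]
  simpa [outArcs] using this

theorem sum_inArcs_le {K : Type u} {A : Type v} {Q : Type w} [DecidableEq Q]
    (trans : List (AugState Q × Option A × K × AugState Q))
    {all : List (AugState Q)} (hnd : all.Nodup) :
    (all.map fun p => 1 + (inArcs trans p).length).sum ≤ all.length + trans.length := by
  have := List.sum_fibers_le (fun e : AugState Q × Option A × K × AugState Q => e.2.2.2)
    (fun _ => 1) all hnd trans
  rw [List.sum_map_add]
  simpa [inArcs] using this

variable [DecidableEq K] {trans : List (AugState Q × Option A × K × AugState Q)}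
  {states : List Q} {σ : Store K A Q} {cl : AugState Q → ℕ} {f : ℕ}

theorem wp_emit_computed (hσ : σ.Part cl f) (hA : σ.Adj trans)
    (hr : σ.reg .states = .ofList (states.map fun q => .state (.tru q)))
    (hdon : σ.tab .don .nil = LMap.empty) (hedg : σ.tab .edg .nil = LMap.empty)
    (hnd : states.Nodup) (hs : ∀ q, q ∈ states) (hb : Between trans cl f)
    (hst : Stable trans cl) :
    emit.wp σ fun τ t => Computed trans τ cl ∧
      t ≤ 200 * (3 + states.length + trans.length) := by
  refine wp_mono (wp_emit hσ hA hr hdon hedg) ?_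
  rintro τ t - ⟨h1, h2, h3⟩
  refine ⟨⟨h1.cls, hb.init, hb.coarse, hst, ?_⟩, ?_⟩
  · intro p hp a d
    obtain ⟨p', hp', h⟩ := h2 p (by
      rcases hp with h | ⟨q, rfl⟩
      · exact Or.inl h
      · exact Or.inr ⟨q, hs q, rfl⟩)
    rw [h]
    -- Stability makes the choice of the representative `p'` immaterial.
    exact hst p' p hp' (a, d)
  · have := sum_outArcs_le trans (nodup_allStates hnd)
    rw [length_allStates] at this
    simp only [allStates, List.map_cons, List.sum_cons, List.map_map, Function.comp_def] at this
    omega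

theorem wp_dsa (hnd : states.Nodup) (hs : ∀ q, q ∈ states) (hnz : ∀ e ∈ trans, e.2.2.1 ≠ 0) :
    dsa.wp (inputStore states trans) fun τ t => (∃ cl, Computed trans τ cl) ∧
      t ≤ 10000 * ((states.length + 2) * (states.length + 2 + trans.length)) := by
  simp only [dsa, block, wp_seq]
  refine wp_mono (wp_build states trans hs) ?_
  rintro σ1 t1 hF1 ⟨hP1, hA1, ht1⟩
  simp only [wp_put, wp_set, Expr.eval]
  have hque1 : σ1.tab .que .nil = LMap.empty := by rw [hF1.tab _ (by decide)]; rfl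
  set σ2 := (σ1.setTab .que .nil ((σ1.tab .que .nil).put (.num 1) .nil)).setReg .split (.num 1)
    with hσ2
  set N := states.length + 2 with hN
  -- A bound for one round with its test and the reset of the flag: `f ≤ N + 1`, and the states and
  -- arcs together number at most `N + trans.length`.
  set R := 1200 * (2 + 2 * N + trans.length) with hR
  have hsum : ((allStates states).map fun p => 1 + (outArcs trans p).length).sum ≤
      N + trans.length := by
    have := sum_outArcs_le trans (nodup_allStates hnd)
    rwa [length_allStates] at this
  -- The counter `k` is the number of rounds still allowed. While the flag is set, `k = N + 2 - f`
  -- is positive because `f ≤ N + 1`; new classes lower it through `f`, and the last round, without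
  -- split, uses one more unit.
  refine wp_mono (wp_loop (fun k τ t => ∃ (cl : AugState Q → ℕ) (f : ℕ), τ.Part cl f ∧
      τ.Adj trans ∧ τ.WF ∧ QueueLT (τ.tab .que .nil) f ∧ QueueFull (τ.tab .que .nil) cl ∧
      Between trans cl f ∧
      ((τ.reg .split = .nil ∧ Stable trans cl ∧ k + f = N + 1) ∨
        (τ.reg .split = .num 1 ∧ k + f = N + 2)) ∧ t + k * R ≤ (N - 1) * R)
    (P := fun τ t => ∃ (cl : AugState Q → ℕ) (f : ℕ), τ.Part cl f ∧
      τ.Adj trans ∧ Between trans cl f ∧ Stable trans cl ∧ t ≤ (N - 1) * R + 3)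
    ?_ (N - 1) σ2 0 ?_ ?_) ?_
  · rintro k τ t ⟨cl, f, hP, hA, hwf, q1, q2, hb, hk, ht⟩ htest
    have hsplit : τ.reg .split = .num 1 ∧ k + f = N + 2 := by
      rcases hk with ⟨h, -⟩ | h
      · simp [h] at htest
      · exact h
    simp only [wp_seq, wp_set, Expr.eval]
    refine wp_mono (wp_dsaRound (σ := τ.setReg .split .nil) (trans := trans)
      (all := allStates states) (hP.congr rfl rfl (by simp)) (hA.congr rfl rfl) (hwf.setReg _ _)
      hnz (nodup_allStates hnd) (mem_allStates hs) q1 q2 hb (by simp)) ?_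
    rintro ρ t' hF ⟨cl', f', hP', q1', q2', hb', hs', ht'⟩
    have hf := hb.le_length (mem_allStates hs)
    have hf' := hb'.le_length (mem_allStates hs)
    rw [length_allStates] at hf hf'
    have hcost : 1 + Expr.nil.cost + t' + 3 ≤ R := by
      simp only [Expr.cost, hR]
      omega
    refine ⟨if f' = f then k - 1 else k - (f' - f), ?_, cl', f', hP',
      hA.congr (hF.tab _ (by decide)) (hF.tab _ (by decide)), hF.wf hwf, q1', q2', hb', ?_, ?_⟩
    · rcases hs' with ⟨rfl, -⟩ | ⟨h, -⟩
      · simp; omega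
      · simp [h.ne']; omega
    · rcases hs' with ⟨rfl, h1, h2⟩ | ⟨h, h1⟩
      · simp only [if_true]
        exact Or.inl ⟨h1, h2, by omega⟩
      · simp only [h.ne', if_false]
        exact Or.inr ⟨h1, by omega⟩
    · have hk' : (if f' = f then k - 1 else k - (f' - f)) + 1 ≤ k := by
        rcases hs' with ⟨rfl, -⟩ | ⟨h, -⟩
        · simp; omega
        · simp [h.ne']; omega
      have := Nat.mul_le_mul_right R hk'
      rw [add_mul, one_mul] at this
      simp only [Test.cost, Expr.cost] at hcost ⊢
      omega
  · refine ⟨initCls, 3, hP1.congr (by funext i; simp [hσ2]) (by funext i; simp [hσ2])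
      (by simp [hσ2]), hA1.congr (by funext i; simp [hσ2]) (by funext i; simp [hσ2]), ?_, ?_, ?_,
      between_initCls, Or.inr ⟨by simp [hσ2], by omega⟩, by simp⟩
    · exact ((hF1.wf (wf_inputStore _ _)).setTab _ _
        ((hF1.wf (wf_inputStore _ _) _ _).put _ _)).setReg _ _
    · intro z hz
      simp [hσ2, hque1] at hz
      exact ⟨1, by omega, hz⟩
    -- Initially only the class of the true states can have two elements.
    · intro p p' hpp hcl
      cases p <;> cases p' <;> simp_all [initCls]
  · rintro k τ t ⟨cl, f, hP, hA, hwf, q1, q2, hb, hk, ht⟩ htest t'' ht''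
    rcases hk with ⟨-, h, -⟩ | ⟨h, -⟩
    · refine ⟨cl, f, hP, hA, hb, h, ?_⟩
      simp at ht''
      omega
    · simp [h] at htest
  · rintro τ t hF ⟨cl, f, hP, hA, hb, hst, ht⟩
    have hother : ∀ T, T ≠ .que → build.writesTab T = false →
        (loop (.not (.isNil (.reg .split))) (block [set .split .nil,
          forKeys .C .que .nil dsaIteration])).writesTab T = false →
        τ.tab T .nil = LMap.empty := by
      intro T hT h1 h2
      rw [hF.tab T h2]
      simp only [hσ2, Store.tab_setReg, Store.tab_setTab, hT, false_and, if_false]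
      rw [hF1.tab T h1]
      rfl
    refine wp_mono (wp_emit_computed hP hA (states := states) ?_
      (hother _ (by decide) (by decide) (by decide)) (hother _ (by decide) (by decide) (by decide))
      hnd hs hb hst) ?_
    · rw [hF.reg _ (by decide)]
      simp only [hσ2, Store.reg_setReg, Store.reg_setTab, reduceCtorEq, if_false]
      rw [hF1.reg _ (by decide)]
      rfl
    · rintro τ' t' - ⟨h1, h2⟩
      refine ⟨⟨cl, h1⟩, ?_⟩
      simp only [hashCost, Expr.cost, Expr.eval, Val.size]
      have h3 : (N - 1) * R + R ≤ N * R := by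
        have : N - 1 + 1 ≤ N := by omega
        calc (N - 1) * R + R = (N - 1 + 1) * R := by ring
          _ ≤ N * R := Nat.mul_le_mul_right R this
      have h4 : R ≤ 3600 * (N + trans.length) := by omega
      have h5 : N * R ≤ 3600 * (N * (N + trans.length)) := by
        calc N * R ≤ N * (3600 * (N + trans.length)) := Nat.mul_le_mul_left N h4
          _ = _ := by ring
      have h6 : 2 * (N + trans.length) ≤ N * (N + trans.length) :=
        Nat.mul_le_mul_right _ (by omega)
      omega

end Cmd

/-! ## The Predecessor Class Split Algorithm -/

theorem List.sum_map_filter_eq {α M : Type*} [AddCommMonoid M] (P : α → Bool) (g : α → M)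
    (l : List α) : ((l.filter P).map g).sum = (l.map fun x => if P x then g x else 0).sum := by
  induction l with
  | nil => rfl
  | cons x l ih => by_cases h : P x <;> simp [h, ih]

theorem List.sum_map_fiber_ite {α β M : Type*} [DecidableEq β] [AddCommMonoid M] (d : α → β)
    (g : α → M) {m : List β} (hm : m.Nodup) (l : List α) :
    (m.map fun y => (l.map fun x => if d x = y then g x else 0).sum).sum =
      (l.map fun x => if d x ∈ m then g x else 0).sum := by
  induction m with
  | nil => simp
  | cons y m ih =>
    rw [List.nodup_cons] at hm
    rw [List.map_cons, List.sum_cons, ih hm.2, ← List.sum_map_add]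
    congr 1
    refine List.map_congr_left fun x _ => ?_
    by_cases h : d x = y
    · have : d x ∉ m := h ▸ hm.1
      simp [h, h ▸ this]
    · simp [h]

namespace Cmd

variable {K : Type u} {A : Type v} {Q : Type w} [DecidableEq A] [DecidableEq Q] [Semiring K]
variable {trans : List (AugState Q × Option A × K × AugState Q)} {cl cl' : AugState Q → ℕ}
  {f f' : ℕ}

/-- The weight from `p` into the class `D` is one sum over the transitions, read from the
destinations on the left and from the source on the right. No subtraction of weights is involved, so
any semiring will do. -/
theorem inWeight_eq_outWeight {lq : List (AugState Q)} (hnd : lq.Nodup) {D : ℕ}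
    (hlq : ∀ q, q ∈ lq ↔ cl q = D) (p : AugState Q) (a : Option A) :
    inWeight (lq.flatMap (inArcs trans)) p a = outWeight cl trans p (a, D) := by
  have h1 : ∀ E : List (Arc K A Q), inWeight E p a =
      (E.map fun e => if e.1 = a ∧ e.2.2 = p then e.2.1 else 0).sum := by
    intro E
    unfold inWeight endWeight labelled
    rw [List.filter_reverse, List.map_reverse, List.sum_reverse, List.filter_filter,
      List.sum_map_filter_eq]
    congr 1
    refine List.map_congr_left fun e _ => ?_
    simp [and_comm]
  have h2 : ∀ q, ((inArcs trans q).map fun e => if e.1 = a ∧ e.2.2 = p then e.2.1 else 0).sum =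
      (trans.map fun e => if e.2.2.2 = q then
        (if e.2.1 = a ∧ e.1 = p then e.2.2.1 else 0) else 0).sum := by
    intro q
    unfold inArcs
    rw [List.map_reverse, List.sum_reverse, List.map_map, List.sum_map_filter_eq]
    simp
  rw [h1, List.map_flatMap, List.flatMap_def, List.sum_flatten, List.map_map]
  simp only [Function.comp_def, h2]
  rw [List.sum_map_fiber_ite _ _ hnd]
  unfold outWeight arcWeight outArcs
  rw [List.filter_reverse, List.map_reverse, List.sum_reverse, List.filter_map, List.map_map,
    List.filter_filter, List.sum_map_filter_eq]
  congr 1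
  refine List.map_congr_left fun e _ => ?_
  simp only [hlq, Function.comp_def]
  by_cases h3 : cl e.2.2.2 = D <;> by_cases h4 : e.2.1 = a <;> by_cases h5 : e.1 = p <;>
    simp [h3, h4, h5]

theorem outWeight_eq_zero {c : ℕ} (h : ∀ e ∈ trans, cl e.2.2.2 ≠ c) (p : AugState Q)
    (a : Option A) : outWeight cl trans p (a, c) = 0 := by
  by_contra h0
  obtain ⟨e, he, h1⟩ := exists_arc_of_outWeight_ne_zero h0
  simp only [outArcs, List.mem_reverse, List.mem_map, List.mem_filter] at he
  obtain ⟨e', he', rfl⟩ := he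
  simp only [Prod.mk.injEq] at h1
  exact h e' he'.1 h1.2.symm

theorem outWeight_congr {c : ℕ} (h : ∀ q, cl q = c ↔ cl' q = c) (p : AugState Q)
    (a : Option A) : outWeight cl trans p (a, c) = outWeight cl' trans p (a, c) := by
  unfold outWeight arcWeight
  simp only [h]

variable [DecidableEq K] {σ : Store K A Q} {all : List (AugState Q)}

/-- States outside the signature map have the zero signature and stay unmarked, so the whole
partition is split although only predecessors of `D` are visited. Both parts of a split class are
queued: in a semiring, the weights into one part cannot be deduced from those into the class and the
other part. Each move issues one number and adds at most two keys, whence the inequality on the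
length of the queue. -/
theorem wp_pcsaIteration (hσ : σ.Part cl f) (hA : σ.Adj trans) (hwf : σ.WF)
    (hnz : ∀ e ∈ trans, e.2.2.1 ≠ 0) (hnd : all.Nodup) (hall : ∀ p, p ∈ all)
    {D : ℕ} {M : LMap K A Q} (hD : (σ.tab .que .nil).keys.headD .nil = .num D)
    (hM : M = (σ.tab .que .nil).del (.num D)) (hQ : QueueLT (σ.tab .que .nil) f) :
    pcsaIteration.wp σ fun τ t => ∃ (cl' : AugState Q → ℕ) (f' : ℕ)
      (μ : AugState Q → Option (Val K A Q)),
      τ.Part cl' f' ∧ SplitBy cl f μ cl' f' ∧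
      (∀ p p', μ p = μ p' ↔ ∀ a, outWeight cl trans p (a, D) = outWeight cl trans p' (a, D)) ∧
      QueueLT (τ.tab .que .nil) f' ∧
      (∀ z ∈ M.keys, z ∈ (τ.tab .que .nil).keys) ∧
      (∀ c, f ≤ c → c < f' → .num c ∈ (τ.tab .que .nil).keys) ∧
      (∀ p, cl' p ≠ cl p → .num (cl p) ∈ (τ.tab .que .nil).keys) ∧
      (∀ c < f, .num c ∈ (τ.tab .que .nil).keys →
        .num c ∈ M.keys ∨ ∃ p, cl p = c ∧ cl' p ≠ c) ∧
      (τ.tab .que .nil).keys.length + 2 * f ≤ M.keys.length + 2 * f' ∧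
      t ≤ 2000 * (1 + classSum all cl (fun p => 1 + (inArcs trans p).length) D) := by
  obtain ⟨lq, hlq, hlnd, hlmem, hlsum⟩ := hσ.exists_members hwf hnd hall D
  rw [← hlsum]
  have hMwf : M.WF := hM ▸ (hwf _ _).del _
  simp only [pcsaIteration, block, wp_seq, wp_pop, Expr.eval, hD, ← hM]
  set σ1 := (σ.setTab .que .nil M).setReg .D (.num D) with hσ1
  have hwf1 : σ1.WF := (hwf.setTab _ _ hMwf).setReg _ _
  have hA1 : σ1.Adj trans := hA.congr (by funext i; simp [hσ1]) (by funext i; simp [hσ1])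
  obtain ⟨E, hE⟩ : ∃ E, E = lq.flatMap (inArcs trans) := ⟨_, rfl⟩
  refine wp_mono (wp_pcsaSignatures hA1 hwf1 hnz (D := D) (by simp [hσ1])
    (lq := lq) (by simpa [hσ1] using hlq) hE) ?_
  rintro σ2 t2 hF2 ⟨s, lk, hsig, hlk, hlklen, hseq, hsize, ht2⟩
  have hwf2 : σ2.WF := hF2.wf hwf1
  have hknd : lk.Nodup := by
    have := (hwf2 .sig .nil).1
    rw [hlk] at this
    exact this.of_map
  have hsnil : ∀ p, p ∉ lk → s p = .nil := by
    intro p hp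
    rw [← hsig]
    refine (hwf2 .sig .nil).2 _ ?_
    rw [hlk, List.mem_map_of_injective (fun _ _ h => by simpa using h)]
    exact hp
  have hP2 : σ2.Part cl f := by
    refine hσ.congr ?_ ?_ ?_
    · rw [hF2.tab _ (by decide)]; funext i; simp [hσ1]
    · rw [hF2.tab _ (by decide)]; funext i; simp [hσ1]
    · rw [hF2.reg _ (by decide)]; simp [hσ1]
  simp only [wp_clear]
  refine wp_forKeys .state lk (by simp [hlk])
    (fun d τ t => τ.Buckets cl (d.filter fun p => s p ≠ .nil) s ∧
      t ≤ (d.map fun p => 50 + 2 * (s p).size).sum) ?_ ?_ ?_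
  · exact ⟨⟨by simp, by simp [Val.ofList]⟩, by simp⟩
  · rintro d p d' hd ρ t ⟨hB, ht⟩ hF
    have hsig' : ρ.tab .sig .nil = σ2.tab .sig .nil := by rw [hF.tab _ (by decide)]; simp
    have hcls' : ρ.tab .cls .nil = σ2.tab .cls .nil := by rw [hF.tab _ (by decide)]; simp
    simp only [wp_seq, wp_get, wp_ite, Test.holds, Expr.eval, Store.reg_setReg, if_true,
      Store.tab_setReg, hsig', hsig, wp_skip]
    by_cases hs : s p = .nil
    · simp only [hs, decide_true, if_true]
      refine ⟨⟨?_, ?_⟩, ?_⟩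
      · simpa [List.filter_append, hs] using hB.keys
      · simpa [List.filter_append, hs] using hB.val
      · simp only [List.map_append, List.sum_append, List.map_cons, List.map_nil, List.sum_cons,
          List.sum_nil, hashCost, Test.cost, Expr.cost, Expr.eval, Store.reg_setReg, if_true,
          Val.size]
        omega
    · simp only [hs, decide_false, Bool.false_eq_true, if_false, reduceCtorEq]
      refine wp_mono (wp_toBucket (cl := cl) (ps := d.filter fun p => s p ≠ .nil) (s := s) (p := p)
        ⟨?_, ?_⟩ ?_ ?_ ?_) ?_
      · simpa using hB.keys
      · simpa using hB.val
      · simp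
      · simp [hcls', hP2.cls]
      · simp
      · rintro τ t' - ⟨h1, h2⟩
        refine ⟨by simpa [List.filter_append, hs] using h1, ?_⟩
        simp only [List.map_append, List.sum_append, List.map_cons, List.map_nil, List.sum_cons,
          List.sum_nil, hashCost, Test.cost, Expr.cost, Expr.eval, Store.reg_setReg, if_true,
          Val.size, reduceCtorEq, if_false]
        omega
  · rintro σ3 t3 hF3 ⟨hB3, ht3⟩
    have hque3 : σ3.tab .que .nil = M := by
      rw [hF3.tab _ (by decide)]
      simp only [Store.tab_setTab, reduceCtorEq, false_and, if_false]
      rw [hF2.tab _ (by decide)]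
      simp [hσ1]
    have hP3 : σ3.Part cl f := by
      refine hP2.congr ?_ ?_ ?_
      · rw [hF3.tab _ (by decide)]
        funext i
        simp
      · rw [hF3.tab _ (by decide)]
        funext i
        simp
      · rw [hF3.reg _ (by decide)]
        simp
    have hwf3 : σ3.WF := hF3.wf (hwf2.setTab _ _ LMap.wf_empty)
    refine wp_mono (wp_splitBuckets hP3 hwf3 hB3
      (by intro r; cases r <;> decide) (by intro T; cases T <;> decide)
      (by intro r; cases r <;> decide) (by intro T; cases T <;> decide)
      (fun cl' f' μ M' _ => QueueLT M' f' ∧ (∀ z ∈ M.keys, z ∈ M'.keys) ∧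
        (∀ c, f ≤ c → c < f' → .num c ∈ M'.keys) ∧
        (∀ p, cl' p ≠ cl p → .num (cl p) ∈ M'.keys) ∧
        (∀ c < f, .num c ∈ M'.keys → .num c ∈ M.keys ∨ ∃ p, cl p = c ∧ cl' p ≠ c) ∧
        M'.keys.length + 2 * f ≤ M.keys.length + 2 * f') ?_ ?_ ?_ (hknd.filter _)) ?_
    · rw [hque3]
      refine ⟨?_, fun _ h => h, fun c h h' => absurd h (by omega), fun p h => absurd rfl h,
        fun c _ h => Or.inl h, le_rfl⟩
      intro z hz
      rw [hM, (hwf _ _).mem_keys_del] at hz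
      exact hQ z hz.2
    · rintro ρ cl' f' μ C v B hS hJ hlt - - - - - - -
      simp only [wp_skip]
      exact ⟨by omega, hJ⟩
    · rintro ρ cl' f' μ C v B r hS ⟨j1, j2, j3, j4, j5, j6⟩ hlt hC hD' - hne - hBC hBC' hrB hrC -
      have hle := hS.le
      simp only [wp_seq, wp_put, Expr.eval, hD', hC, Store.reg_setTab, Store.tab_setTab, and_self,
        if_true]
      refine ⟨by simp [hD', hC], ?_, ?_, ?_, ?_, ?_, ?_⟩
      · intro z hz
        simp only [LMap.mem_keys_put] at hz
        rcases hz with rfl | rfl | hz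
        · exact ⟨C, by have := hlt r; omega, rfl⟩
        · exact ⟨f', by omega, rfl⟩
        · obtain ⟨c, hc, rfl⟩ := j1 z hz
          exact ⟨c, by omega, rfl⟩
      · intro z hz
        simp only [LMap.mem_keys_put]
        exact Or.inr (Or.inr (j2 z hz))
      · intro c hc hc'
        simp only [LMap.mem_keys_put]
        by_cases hcf : c = f'
        · right; left; rw [hcf]
        · right; right; exact j3 c hc (by omega)
      · intro p hp
        simp only [LMap.mem_keys_put]
        by_cases hpB : p ∈ B
        · left; rw [hBC p hpB]
        · right; right
          exact j4 p (by simpa [hpB] using hp)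
      · intro c hc hz
        simp only [LMap.mem_keys_put, Val.num.injEq] at hz
        rcases hz with rfl | rfl | hz
        · right
          obtain ⟨b, hb⟩ := List.exists_mem_of_ne_nil B hne
          exact ⟨b, hBC b hb, by simp only [hb, if_true]; omega⟩
        · omega
        · rcases j5 c hc hz with h | ⟨p, hp, hp'⟩
          · exact Or.inl h
          · refine Or.inr ⟨p, hp, ?_⟩
            split_ifs
            · omega
            · exact hp'
      · have h1 := LMap.length_keys_put_le (ρ.tab .que .nil) (.num f') .nil
        have h2 := LMap.length_keys_put_le ((ρ.tab .que .nil).put (.num f') .nil) (.num C) .nil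
        omega
    · rintro τ t4 hF4 ⟨cl', f', hP, hS, ⟨j1, j2, j3, j4, j5, j6⟩, ht4⟩
      refine ⟨cl', f', _, hP, hS, ?_, j1, j2, j3, j4, j5, j6, ?_⟩
      · intro p p'
        -- The marked states are exactly those with a signature other than `nil`, so equality of
        -- marks is equality of signatures, also between unmarked states.
        have hmark : ∀ p, (if p ∈ lk.filter (fun p => s p ≠ .nil) then some (s p) else none) =
            if s p = .nil then none else some (s p) := by
          intro p
          by_cases hp : s p = .nil
          · simp [hp]
          · have : p ∈ lk := by
              by_contra h
              exact hp (hsnil p h)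
            simp [hp, this]
        have hμ : (if s p = .nil then none else some (s p)) =
            (if s p' = .nil then none else some (s p')) ↔ s p = s p' := by
          by_cases h1 : s p = .nil <;> by_cases h2 : s p' = .nil <;> simp [h1, h2]
          exact fun h => h2 h.symm
        rw [hmark, hmark, hμ, hseq]
        simp only [hE, inWeight_eq_outWeight hlnd hlmem]
      · have h1 : (lq.map fun p => 1 + (inArcs trans p).length).sum = lq.length + E.length := by
          rw [hE, List.length_flatMap, List.sum_map_add]
          simp
        rw [h1]
        have h2 : ((lk.filter fun p => s p ≠ .nil).map fun p => 200 + (s p).size).sum ≤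
            (lk.map fun p => 200 + (s p).size).sum :=
          (List.filter_sublist.map _).sum_le_sum (by simp)
        have h3 : (lk.map fun p => 200 + (s p).size).sum =
            200 * lk.length + (lk.map fun p => (s p).size).sum := by
          rw [List.sum_map_add]
          simp [mul_comm]
        rw [List.sum_map_add, List.sum_map_mul_left] at ht3
        simp only [List.map_const', List.sum_replicate, smul_eq_mul] at ht3
        simp only [hashCost, Expr.cost, Expr.eval, Val.size]
        omega

end Cmd

/-! ### Amortised analysis of the Predecessor Class Split Algorithm -/

namespace Cmd

variable {K : Type u} {A : Type v} {Q : Type w} [DecidableEq K] [DecidableEq A] [DecidableEq Q]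

/-- The number of states in the class of `q`, plus one if this class is in the queue. -/
def rank (all : List (AugState Q)) (cl : AugState Q → ℕ) (M : LMap K A Q) (q : AugState Q) : ℕ :=
  (all.filter fun p => cl p = cl q).length + if .num (cl q) ∈ M.keys then 1 else 0

/-- The potential of a partition and a queue, which bounds the remaining number of steps. -/
def potential (all : List (AugState Q)) (w : AugState Q → ℕ) (cl : AugState Q → ℕ) (f : ℕ)
    (M : LMap K A Q) : ℕ :=
  (all.map fun q => w q * rank all cl M q).sum + (M.keys.length + 2 * (all.length + 1 - f))

variable {all : List (AugState Q)} {cl cl' : AugState Q → ℕ} {f f' : ℕ}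

/-- If the class of `q` loses a state, its size drops by at least one, which compensates for a
possible insertion into the queue. If it loses none, it keeps its number, and it is queued
afterwards only if it was queued before. -/
theorem rank_le_of_splitBy {V : Type*} {μ : AugState Q → Option V} {M M' : LMap K A Q}
    (hall : ∀ p, p ∈ all) (hlt : ∀ p, cl p < f) (hS : SplitBy cl f μ cl' f')
    (hM : ∀ c < f, .num c ∈ M'.keys → .num c ∈ M.keys ∨ ∃ p, cl p = c ∧ cl' p ≠ c)
    (q : AugState Q) : rank all cl' M' q ≤ rank all cl M q := by
  have hsub : ∀ p, cl' p = cl' q → cl p = cl q := fun p hp => ((hS.ker p q).1 hp).1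
  have hsublist : (all.filter fun p => cl' p = cl' q) =
      (all.filter fun p => cl p = cl q).filter fun p => cl' p = cl' q := by
    rw [List.filter_filter]
    refine List.filter_congr fun p _ => ?_
    by_cases h : cl' p = cl' q
    · simp [h, hsub p h]
    · simp [h]
  by_cases hex : ∃ p, cl p = cl q ∧ cl' p ≠ cl' q
  · obtain ⟨p, hp, hp'⟩ := hex
    have h1 : (all.filter fun p => cl' p = cl' q).length <
        (all.filter fun p => cl p = cl q).length := by
      rw [hsublist]
      exact List.length_filter_lt_length_iff_exists.2 ⟨p, by simp [hall, hp], by simp [hp']⟩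
    unfold rank
    split_ifs <;> omega
  · push Not at hex
    -- The old number is still used by some state, which cannot have received a fresh number; it
    -- comes from the class of `q`, all of which moved together.
    have hcl : cl' q = cl q := by
      obtain ⟨p, hp⟩ := hS.old q
      rcases hS.moved p with h | h
      · rw [← hex p (by rw [← h, hp]), hp]
      · have := hlt q
        omega
    have h1 : (all.filter fun p => cl' p = cl' q).length ≤
        (all.filter fun p => cl p = cl q).length := by
      rw [hsublist]
      exact List.length_filter_le _ _
    have h2 : .num (cl' q) ∈ M'.keys → .num (cl q) ∈ M.keys := by
      intro h
      rw [hcl] at h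
      rcases hM (cl q) (hlt q) h with h | ⟨p, hp, hp'⟩
      · exact h
      · exact absurd (hex p hp) (by rw [hcl]; exact hp')
    unfold rank
    split_ifs
    · omega
    · exact absurd (h2 ‹_›) ‹_›
    · omega
    · omega

/-- Removing `D` from the queue lowers the rank of each of its states by one, which releases
`classSum all cl w D`; the split raises no rank. The second term of the potential releases the
additional unit even when `D` is empty: the queue loses a key, and two units of its last summand pay
for each new class. The bound `hf'` keeps the truncated subtraction exact. -/
theorem potential_del_split {V : Type*} {μ : AugState Q → Option V} {M M' : LMap K A Q}
    (hMwf : M.WF) {D : ℕ} (hD : .num D ∈ M.keys) (w : AugState Q → ℕ)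
    (hall : ∀ p, p ∈ all) (hlt : ∀ p, cl p < f) (hS : SplitBy cl f μ cl' f')
    (hM : ∀ c < f, .num c ∈ M'.keys →
      .num c ∈ (M.del (.num D)).keys ∨ ∃ p, cl p = c ∧ cl' p ≠ c)
    (hlen : M'.keys.length + 2 * f ≤ (M.del (.num D)).keys.length + 2 * f')
    (hf' : f' ≤ all.length + 1) :
    potential all w cl' f' M' + (1 + classSum all cl w D) ≤ potential all w cl f M := by
  have h1 : (M.del (.num D)).keys.length + 1 = M.keys.length := by
    simp only [LMap.del]
    rw [List.length_erase_of_mem hD]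
    have := List.length_pos_of_mem hD
    omega
  have h2 : (all.map fun q => w q * rank all cl' M' q).sum + classSum all cl w D ≤
      (all.map fun q => w q * rank all cl M q).sum := by
    unfold classSum
    rw [List.sum_map_filter_eq, ← List.sum_map_add]
    refine List.sum_le_sum fun q _ => ?_
    have h3 := rank_le_of_splitBy hall hlt hS hM q
    have h4 : rank all cl (M.del (.num D)) q + (if cl q = D then 1 else 0) ≤ rank all cl M q := by
      unfold rank
      simp only [hMwf.mem_keys_del, ne_eq, Val.num.injEq]
      by_cases h : cl q = D
      · simp [h, hD]
      · simp [h]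
    have h5 : w q * (rank all cl' M' q + if cl q = D then 1 else 0) ≤ w q * rank all cl M q :=
      Nat.mul_le_mul_left _ (by omega)
    by_cases h : cl q = D
    · simpa [h, mul_add] using h5
    · simpa [h] using h5
  have hle := hS.le
  unfold potential
  omega

theorem potential_le (w : AugState Q → ℕ) (M : LMap K A Q) :
    potential all w cl f M ≤ (all.map w).sum * (all.length + 1) +
      (M.keys.length + 2 * (all.length + 1)) := by
  unfold potential
  have h1 : (all.map fun q => w q * rank all cl M q).sum ≤
      (all.map fun q => w q * (all.length + 1)).sum := by
    refine List.sum_le_sum fun q _ => Nat.mul_le_mul_left _ ?_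
    unfold rank
    have := List.length_filter_le (fun p => decide (cl p = cl q)) all
    split_ifs <;> omega
  rw [List.sum_map_mul_right] at h1
  omega

variable [Semiring K] {trans : List (AugState Q × Option A × K × AugState Q)} {states : List Q}

/-- The invariant is that equivalent states have equal weights into every class which is not in the
queue; with an empty queue this is stability. The potential bounds the number of iterations and,
multiplied by `R`, their total time. -/
theorem wp_pcsa (hnd : states.Nodup) (hs : ∀ q, q ∈ states) (hnz : ∀ e ∈ trans, e.2.2.1 ≠ 0)
    (hini : ∀ e ∈ trans, e.2.2.2 ≠ .ini) :
    pcsa.wp (inputStore states trans) fun τ t => (∃ cl, Computed trans τ cl) ∧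
      t ≤ 10000 * ((states.length + 2) * (states.length + 2 + trans.length)) := by
  simp only [pcsa, block, wp_seq]
  refine wp_mono (wp_build states trans hs) ?_
  rintro σ1 t1 hF1 ⟨hP1, hA1, ht1⟩
  have hwf1 : σ1.WF := hF1.wf (wf_inputStore _ _)
  simp only [wp_put, Expr.eval]
  have hque1 : σ1.tab .que .nil = LMap.empty := by rw [hF1.tab _ (by decide)]; rfl
  obtain ⟨σ2, hσ2⟩ : ∃ σ2, σ2 = (σ1.setTab .que .nil ((σ1.tab .que .nil).put (.num 1) .nil)).setTab
      .que .nil (((σ1.setTab .que .nil ((σ1.tab .que .nil).put (.num 1) .nil)).tab .que .nil).put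
        (.num 2) .nil) := ⟨_, rfl⟩
  have hque2 : ∀ z, z ∈ (σ2.tab .que .nil).keys ↔ z = .num 2 ∨ z = .num 1 := by
    intro z
    simp [hσ2, hque1]
  have hlen2 : (σ2.tab .que .nil).keys.length ≤ 2 := by
    simp [hσ2, hque1, LMap.put]
  rw [← hσ2]
  set N := states.length + 2 with hN
  set w : AugState Q → ℕ := fun p => 1 + (inArcs trans p).length with hw
  have hlenN : (allStates states).length = N := length_allStates states
  have hsum : ((allStates states).map w).sum ≤ N + trans.length := by
    have := sum_inArcs_le trans (nodup_allStates hnd)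
    rwa [length_allStates] at this
  set R := 2010 with hR
  set k0 := potential (allStates states) w initCls 3 (σ2.tab .que .nil) with hk0
  refine wp_mono (wp_loop (fun k τ t => ∃ (cl : AugState Q → ℕ) (f : ℕ), τ.Part cl f ∧
      τ.Adj trans ∧ τ.WF ∧ QueueLT (τ.tab .que .nil) f ∧ Between trans cl f ∧
      (∀ c, .num c ∉ (τ.tab .que .nil).keys → ∀ p p', cl p = cl p' → ∀ a,
        outWeight cl trans p (a, c) = outWeight cl trans p' (a, c)) ∧
      k = potential (allStates states) w cl f (τ.tab .que .nil) ∧ t + R * k ≤ R * k0)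
    (P := fun τ t => ∃ (cl : AugState Q → ℕ) (f : ℕ), τ.Part cl f ∧
      τ.Adj trans ∧ Between trans cl f ∧ Stable trans cl ∧ t ≤ R * k0 + 10)
    ?_ k0 σ2 0 ?_ ?_) ?_
  · rintro k τ t ⟨cl, f, hP, hA, hwf, hQ, hb, hst, rfl, ht⟩ htest
    have hne : (τ.tab .que .nil).keys ≠ [] := by simpa using htest
    obtain ⟨z, hz⟩ : ∃ z, z = (τ.tab .que .nil).keys.headD .nil := ⟨_, rfl⟩
    have hzmem : z ∈ (τ.tab .que .nil).keys := by
      rw [hz]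
      cases h : (τ.tab .que .nil).keys with
      | nil => exact absurd h hne
      | cons z' l => simp
    obtain ⟨D, hD, rfl⟩ := hQ z hzmem
    refine wp_mono (wp_pcsaIteration hP hA hwf hnz (nodup_allStates hnd) (mem_allStates hs)
      hz.symm rfl hQ) ?_
    rintro ρ t' hF ⟨cl', f', μ, hP', hS, hμ, q1, q2, q3, q4, q5, q6, ht'⟩
    have hb' : Between trans cl' f' := hb.split hS fun p p' _ h => (hμ p p').2 fun a => h _
    have hf' : f' ≤ (allStates states).length + 1 := hb'.le_length (mem_allStates hs)
    have hpot := potential_del_split (hwf _ _) hzmem w (mem_allStates hs) hP.lt hS q5 q6 hf'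
    change t' ≤ 2000 * (1 + classSum (allStates states) cl w D) at ht'
    refine ⟨_, ?_, cl', f', hP', hA.congr (hF.tab _ (by decide)) (hF.tab _ (by decide)),
      hF.wf hwf, q1, hb', ?_, rfl, ?_⟩
    · omega
    -- Outside the queue, `c` is either an unused number, into which all weights vanish, or an old
    -- class that was not split. In the latter case its weights are unchanged; they agree by the
    -- marks if `c = D`, and by the previous invariant otherwise.
    · intro c hc p p' hpp a
      by_cases hcf' : f' ≤ c
      · rw [outWeight_eq_zero (fun e _ => by have := hP'.lt e.2.2.2; omega),
          outWeight_eq_zero (fun e _ => by have := hP'.lt e.2.2.2; omega)]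
      · have hcf : c < f := by
          by_contra h
          exact hc (q3 c (by omega) (by omega))
        have hiff : ∀ q, cl' q = c ↔ cl q = c := by
          intro q
          constructor
          · intro h
            rcases hS.moved q with h' | h'
            · rw [← h', h]
            · omega
          · intro h
            by_contra h'
            refine hc ?_
            rw [← h]
            exact q4 q (by rw [h]; exact h')
        rw [outWeight_congr hiff, outWeight_congr hiff]
        obtain ⟨h1, h2⟩ := (hS.ker p p').1 hpp
        by_cases hcD : c = D
        · rw [hcD]
          exact (hμ p p').1 h2 a
        · refine hst c (fun h => hc (q2 _ ?_)) p p' h1 a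
          rw [(hwf _ _).mem_keys_del]
          exact ⟨by simpa using hcD, h⟩
    · have := Nat.mul_le_mul_left R hpot
      rw [mul_add] at this
      simp only [Test.cost, hashCost, Expr.cost, Expr.eval, Val.size]
      omega
  · refine ⟨initCls, 3, hP1.congr (by funext i; simp [hσ2]) (by funext i; simp [hσ2])
      (by simp [hσ2]), hA1.congr (by funext i; simp [hσ2]) (by funext i; simp [hσ2]), ?_, ?_,
      between_initCls, ?_, hk0, by simp⟩
    · rw [hσ2]
      refine Store.WF.setTab (hwf1.setTab _ _ ((hwf1 _ _).put _ _)) _ _ ?_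
      exact LMap.WF.put (Store.WF.setTab hwf1 _ _ ((hwf1 _ _).put _ _) _ _) _ _
    · intro z hz
      rcases (hque2 z).1 hz with rfl | rfl
      · exact ⟨2, by omega, rfl⟩
      · exact ⟨1, by omega, rfl⟩
    -- The class `{i}` need not be queued at first, since no transition enters `i`; the numbers
    -- above 2 are unused.
    · intro c hc p p' _ a
      have hc' : ∀ e ∈ trans, initCls e.2.2.2 ≠ c := by
        intro e he h
        rw [hque2] at hc
        have h1 := hini e he
        cases hq : e.2.2.2 with
        | ini => exact h1 hq
        | tru q => rw [hq] at h; simp [← h, initCls] at hc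
        | fin => rw [hq] at h; simp [← h, initCls] at hc
      rw [outWeight_eq_zero hc', outWeight_eq_zero hc']
  · rintro k τ t ⟨cl, f, hP, hA, hwf, hQ, hb, hst, hk, ht⟩ htest t'' ht''
    have hemp : (τ.tab .que .nil).keys = [] := by simpa using htest
    refine ⟨cl, f, hP, hA, hb, ?_, ?_⟩
    · rintro p p' hpp ⟨a, c⟩
      exact hst c (by simp [hemp]) p p' hpp a
    · simp only [Test.cost, hashCost, Expr.cost, Expr.eval, Val.size] at ht''
      omega
  · rintro τ t hF ⟨cl, f, hP, hA, hb, hst, ht⟩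
    have hother : ∀ T, T ≠ .que → build.writesTab T = false →
        (loop (.not (.isEmpty .que .nil)) pcsaIteration).writesTab T = false →
        τ.tab T .nil = LMap.empty := by
      intro T hT h1 h2
      rw [hF.tab T h2]
      simp only [hσ2, Store.tab_setTab, hT, false_and, if_false]
      rw [hF1.tab T h1]
      rfl
    refine wp_mono (wp_emit_computed hP hA (states := states) ?_
      (hother _ (by decide) (by decide) (by decide)) (hother _ (by decide) (by decide) (by decide))
      hnd hs hb hst) ?_
    · rw [hF.reg _ (by decide)]
      simp only [hσ2, Store.reg_setTab]
      rw [hF1.reg _ (by decide)]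
      rfl
    · rintro τ' t' - ⟨h1, h2⟩
      refine ⟨⟨cl, h1⟩, ?_⟩
      simp only [hashCost, Expr.cost, Expr.eval, Val.size]
      -- A rank is at most `N + 1`, and the sum of the `w` is at most `N + trans.length`; the rest
      -- bounds the second term of the potential.
      have h3 : k0 ≤ (N + trans.length) * (N + 1) + (2 + 2 * (N + 1)) := by
        have := potential_le (all := allStates states) (cl := initCls) (f := 3) w (σ2.tab .que .nil)
        have h4 := Nat.mul_le_mul_right (N + 1) hsum
        rw [hlenN] at this
        omega
      have h5 : (N + trans.length) * (N + 1) = N * (N + trans.length) + (N + trans.length) := by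
        ring
      have h6 : 2 * (N + trans.length) ≤ N * (N + trans.length) :=
        Nat.mul_le_mul_right _ (by omega)
      omega

end Cmd

/-! ## The minimal quotient -/

namespace KAutomaton

section Morphisms

variable {K : Type u} {A : Type v} {Q : Type*} {R : Type*} {S : Type*} [Semiring K]
  [Fintype Q] [Fintype R] [DecidableEq R] [Fintype S] [DecidableEq S]
  {𝒜 : KAutomaton K A Q} {ℬ : KAutomaton K A R} {𝒞 : KAutomaton K A S}

theorem isMorphism_iff {φ : Q → R} : IsMorphism 𝒜 ℬ φ ↔ Function.Surjective φ ∧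
    (∀ r, (∑ q, if φ q = r then 𝒜.I q else 0) = ℬ.I r) ∧
    (∀ a p r, (∑ q, if φ q = r then 𝒜.E a p q else 0) = ℬ.E a (φ p) r) ∧
    ∀ p, 𝒜.T p = ℬ.T (φ p) := by
  have h1 : ∀ r, (𝒜.I ᵥ* amalgamation K φ) r = ∑ q, if φ q = r then 𝒜.I q else 0 := by
    intro r; simp [Matrix.vecMul, dotProduct, amalgamation]
  have h2 : ∀ a p r, (𝒜.E a * amalgamation K φ) p r = ∑ q, if φ q = r then 𝒜.E a p q else 0 := by
    intro a p r; simp [Matrix.mul_apply, amalgamation]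
  have h3 : ∀ a p r, (amalgamation K φ * ℬ.E a) p r = ℬ.E a (φ p) r := by
    intro a p r; simp [Matrix.mul_apply, amalgamation]
  have h4 : ∀ p, (amalgamation K φ *ᵥ ℬ.T) p = ℬ.T (φ p) := by
    intro p; simp [Matrix.mulVec, dotProduct, amalgamation]
  constructor
  · rintro ⟨hs, hi, ht, hf⟩
    refine ⟨hs, fun r => ?_, fun a p r => ?_, fun p => ?_⟩
    · rw [← h1, hi]
    · rw [← h2, ht, h3]
    · rw [← h4, ← hf]
  · rintro ⟨hs, hi, ht, hf⟩
    refine ⟨hs, ?_, fun a => ?_, ?_⟩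
    · funext r; rw [h1, hi]
    · ext p r; rw [h2, h3, ht]
    · funext p; rw [h4, hf]

/-- Summation over the fibres of a map. -/
theorem sum_ite_fiber (φ : Q → R) (P : R → Prop) [DecidablePred P] (g : Q → K) :
    (∑ q, if P (φ q) then g q else 0) = ∑ r, if P r then ∑ q, (if φ q = r then g q else 0) else 0 := by
  have h : ∀ r, (if P r then ∑ q, (if φ q = r then g q else 0) else 0) =
      ∑ q, if φ q = r then (if P (φ q) then g q else 0) else 0 := by
    intro r
    by_cases hr : P r
    · simp only [hr, if_true]
      refine Finset.sum_congr rfl fun q _ => ?_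
      by_cases hq : φ q = r
      · simp [hq, hr]
      · simp [hq]
    · simp only [hr, if_false]
      symm
      refine Finset.sum_eq_zero fun q _ => ?_
      by_cases hq : φ q = r
      · simp [hq, hr]
      · simp [hq]
  simp only [h]
  rw [Finset.sum_comm]
  simp

/-- The fibres of `ψ ∘ φ` are unions of fibres of `φ`, so sums over the former in `𝒜` are sums over
the fibres of `ψ` in `𝒞`; surjectivity of `φ` gives each state of `𝒞` a preimage at which to
evaluate. -/
theorem IsMorphism.of_comp {φ : Q → S} {ψ : S → R} (hφ : IsMorphism 𝒜 𝒞 φ)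
    (h : IsMorphism 𝒜 ℬ (ψ ∘ φ)) : IsMorphism 𝒞 ℬ ψ := by
  rw [isMorphism_iff] at hφ h ⊢
  obtain ⟨s1, i1, e1, t1⟩ := hφ
  obtain ⟨s2, i2, e2, t2⟩ := h
  refine ⟨s2.of_comp, ?_, ?_, ?_⟩
  · intro r
    rw [← i2 r]
    simp only [← i1, Function.comp_apply]
    exact (sum_ite_fiber φ (fun s => ψ s = r) 𝒜.I).symm
  · intro a s r
    obtain ⟨p, rfl⟩ := s1 s
    have := e2 a p r
    simp only [Function.comp_apply] at this
    rw [← this]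
    simp only [← e1]
    exact (sum_ite_fiber φ (fun s => ψ s = r) (𝒜.E a p)).symm
  · intro s
    obtain ⟨p, rfl⟩ := s1 s
    rw [← t1, t2]
    rfl

end Morphisms

/-! ### From the final partition to the minimal quotient -/

variable {K : Type u} {A : Type v} {Q : Type w} [Semiring K] {𝒜 : KAutomaton K A Q}
  {states : List Q} {trans : List (AugState Q × Option A × K × AugState Q)}
  {cl : AugState Q → ℕ}

theorem IsListing.length_trans_le (h : 𝒜.IsListing states trans) :
    trans.length ≤ 𝒜.numTransitions + 2 * states.length := by
  set g : Q × A × Q → AugState Q × Option A × K × AugState Q :=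
    fun e => (.tru e.1, some e.2.1, 𝒜.E e.2.1 e.1 e.2.2, .tru e.2.2) with hg
  have hginj : Function.Injective g := by
    rintro ⟨p, a, q⟩ ⟨p', a', q'⟩ he
    simp only [hg, Prod.mk.injEq, AugState.tru.injEq, Option.some.injEq] at he
    rw [he.1, he.2.1, he.2.2.2]
  -- The alphabet may be infinite; it is the list that makes the set of transitions finite, so that
  -- `Set.ncard` is its true cardinality.
  have hfin : {e : Q × A × Q | 𝒜.E e.2.1 e.1 e.2.2 ≠ 0}.Finite := by
    refine ((List.finite_toSet trans).preimage hginj.injOn).subset ?_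
    rintro ⟨p, a, q⟩ he
    exact (h.mem_trans _ _ _ _).2 ⟨rfl, he⟩
  have hsub : trans ⊆ hfin.toFinset.toList.map g ++
      (states.map (fun q => (.ini, none, 𝒜.I q, .tru q)) ++
        states.map fun q => (.tru q, none, 𝒜.T q, .fin)) := by
    rintro ⟨p, a, k, q⟩ he
    obtain ⟨rfl, h0⟩ := (h.mem_trans _ _ _ _).1 he
    simp only [List.mem_append, List.mem_map, Finset.mem_toList, Set.Finite.mem_toFinset,
      Set.mem_ofPred_eq]
    match p, a, q, h0 with
    | .tru p, some a, .tru q, h0 => exact Or.inl ⟨(p, a, q), h0, rfl⟩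
    | .ini, none, .tru q, _ => exact Or.inr (Or.inl ⟨q, h.mem_states q, rfl⟩)
    | .tru p, none, .fin, _ => exact Or.inr (Or.inr ⟨p, h.mem_states p, rfl⟩)
    | .ini, some _, _, h0 => exact absurd rfl h0
    | .ini, none, .ini, h0 => exact absurd rfl h0
    | .ini, none, .fin, h0 => exact absurd rfl h0
    | .fin, _, _, h0 => exact absurd rfl h0
    | .tru _, none, .ini, h0 => exact absurd rfl h0
    | .tru _, none, .tru _, h0 => exact absurd rfl h0
    | .tru _, some _, .ini, h0 => exact absurd rfl h0
    | .tru _, some _, .fin, h0 => exact absurd rfl h0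
  have := (h.trans_nodup.subperm hsub).length_le
  rw [numTransitions, Set.ncard_eq_toFinset_card _ hfin]
  simp only [List.length_append, List.length_map, Finset.length_toList] at this
  omega

theorem augE_ini (p : AugState Q) (a : Option A) : 𝒜.augE p a .ini = 0 := by
  cases p <;> cases a <;> rfl

variable [Fintype Q] [DecidableEq Q]

theorem IsListing.sum_states (h : 𝒜.IsListing states trans) (g : Q → K) :
    (states.map g).sum = ∑ q, g q := by
  rw [← List.sum_toFinset g h.states_nodup]
  congr 1
  ext q
  simp [h.mem_states]

variable [DecidableEq K] [DecidableEq A]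

/-- The listed transitions from `p` with label `a` are a permutation of the nonzero entries of that
row, and zero entries do not affect a sum. This links the lists of the programs to the matrices of
the automaton. -/
theorem IsListing.outWeight_eq_sum (h : 𝒜.IsListing states trans) (cl : AugState Q → ℕ)
    (p : AugState Q) (a : Option A) (c : ℕ) : Cmd.outWeight cl trans p (a, c) =
      (if cl .ini = c then 𝒜.augE p a .ini else 0) + ((if cl .fin = c then 𝒜.augE p a .fin else 0) +
        ∑ q, if cl (.tru q) = c then 𝒜.augE p a (.tru q) else 0) := by
  have h1 : ((trans.filter fun e => e.1 = p ∧ e.2.1 = a)).Perm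
      (((Cmd.allStates states).filter fun q => 𝒜.augE p a q ≠ 0).map
        fun q => (p, a, 𝒜.augE p a q, q)) := by
    rw [List.perm_ext_iff_of_nodup (h.trans_nodup.filter _)]
    · rintro ⟨p', a', k, q⟩
      simp only [List.mem_filter, List.mem_map, decide_eq_true_eq, h.mem_trans,
        Cmd.mem_allStates h.mem_states, true_and, Prod.mk.injEq]
      constructor
      · rintro ⟨⟨rfl, hk⟩, rfl, rfl⟩
        exact ⟨q, hk, rfl, rfl, rfl, rfl⟩
      · rintro ⟨q', hk, rfl, rfl, rfl, rfl⟩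
        exact ⟨⟨rfl, hk⟩, rfl, rfl⟩
    · refine ((Cmd.nodup_allStates h.states_nodup).filter _).map ?_
      intro q q' hq
      simp only [Prod.mk.injEq] at hq
      exact hq.2.2.2
  have h2 : Cmd.outWeight cl trans p (a, c) =
      ((trans.filter fun e => e.1 = p ∧ e.2.1 = a).map
        fun e => if cl e.2.2.2 = c then e.2.2.1 else 0).sum := by
    unfold Cmd.outWeight arcWeight outArcs
    rw [List.filter_reverse, List.map_reverse, List.sum_reverse, List.filter_map, List.map_map,
      List.filter_filter, List.sum_map_filter_eq, List.sum_map_filter_eq]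
    congr 1
    refine List.map_congr_left fun e _ => ?_
    simp only [Function.comp_def]
    by_cases h3 : cl e.2.2.2 = c <;> by_cases h4 : e.2.1 = a <;> by_cases h5 : e.1 = p <;>
      simp [h3, h4, h5]
  rw [h2, (h1.map _).sum_eq, List.map_map, List.sum_map_filter_eq]
  have h3 : ((Cmd.allStates states).map fun q => if decide (𝒜.augE p a q ≠ 0) = true then
      ((fun e : AugState Q × Option A × K × AugState Q =>
        if cl e.2.2.2 = c then e.2.2.1 else 0) ∘ fun q => (p, a, 𝒜.augE p a q, q)) q else 0) =
      (Cmd.allStates states).map fun q => if cl q = c then 𝒜.augE p a q else 0 := by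
    refine List.map_congr_left fun q _ => ?_
    by_cases h0 : 𝒜.augE p a q = 0 <;> simp [h0]
  rw [h3, Cmd.allStates, List.map_cons, List.map_cons, List.sum_cons, List.sum_cons, List.map_map,
    h.sum_states]
  rfl

/-- For the marker, related states have equal final weights. For a true letter, the sum over a class
of `cl` is grouped by fibres of `φ`, and the weight into each fibre is a coefficient of `𝒞`, which
depends only on the image of the source. -/
theorem IsListing.isCongruence (h : 𝒜.IsListing states trans) {S : Type*} [Fintype S]
    [DecidableEq S] {𝒞 : KAutomaton K A S} {φ : Q → S} (hφ : IsMorphism 𝒜 𝒞 φ) :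
    Cmd.IsCongruence trans fun p p' => p = p' ∨
      ∃ q q', p = .tru q ∧ p' = .tru q' ∧ φ q = φ q' := by
  classical
  rw [isMorphism_iff] at hφ
  obtain ⟨-, -, he, ht⟩ := hφ
  constructor
  · rintro p p' (rfl | ⟨q, q', rfl, rfl, -⟩) <;> rfl
  · rintro cl hcl p p' (rfl | ⟨q, q', rfl, rfl, hq⟩) ⟨a, c⟩
    · rfl
    rw [h.outWeight_eq_sum, h.outWeight_eq_sum]
    cases a with
    | none => simp [augE, ht, hq]
    | some a =>
      -- Since `cl` is constant on the fibres of `φ`, membership in the class `c` depends only on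
      -- the image by `φ`.
      have hP : ∀ x, cl (.tru x) = c ↔ ∃ y, φ y = φ x ∧ cl (.tru y) = c := by
        intro x
        constructor
        · exact fun hx => ⟨x, rfl, hx⟩
        · rintro ⟨y, hy, hc⟩
          rw [← hc]
          exact hcl _ _ (Or.inr ⟨x, y, rfl, rfl, hy.symm⟩)
      have hsum : ∀ q, (∑ x, if cl (.tru x) = c then 𝒜.E a q x else 0) =
          ∑ s, if ∃ y, φ y = s ∧ cl (.tru y) = c then 𝒞.E a (φ q) s else 0 := by
        intro q
        rw [Finset.sum_congr rfl fun x _ => if_congr (hP x) rfl rfl]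
        simp only [← he]
        exact sum_ite_fiber φ (fun s => ∃ y, φ y = s ∧ cl (.tru y) = c) (𝒜.E a q)
      simp only [augE, ite_self, zero_add]
      rw [hsum, hsum, hq]

variable {τ : Store K A Q}

/-- An emitted edge is the weight from a state to a class. Augmented weights with a true letter, or
with source `i`, vanish unless the destination is a true state, and marker weights from a true state
vanish unless it is `t`; so this weight is the matrix sum or the final weight required. -/
theorem IsListing.isMorphism_outMap (h : 𝒜.IsListing states trans)
    (hτ : Cmd.Computed trans τ cl) : 𝒜.IsMorphism τ.outAutomaton τ.outMap := by
  have hcls : ∀ p, τ.classOf p = .num (cl p) := hτ.cls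
  have hout : ∀ q q', τ.outMap q = τ.outMap q' ↔ cl (.tru q) = cl (.tru q') := by
    intro q q'
    simp [Store.outMap, hcls]
  have hval : ∀ q, (τ.outMap q).1 = .num (cl (.tru q)) := fun q => hcls _
  have hfin : ∀ q, cl (.tru q) ≠ cl .fin := fun q hq => by
    have := hτ.init _ _ hq
    simp [Cmd.initCls] at this
  have hini : cl .ini ≠ cl .fin := fun hq => by
    have := hτ.init _ _ hq
    simp [Cmd.initCls] at this
  have hedge : ∀ p, (p = .ini ∨ ∃ q, p = .tru q) → ∀ a d,
      τ.edge (.num (cl p)) a (.num d) = Cmd.outWeight cl trans p (a, d) :=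
    fun p hp a d => hτ.edge p hp a d
  have hsurj : Function.Surjective τ.outMap := by
    rintro ⟨z, q, rfl⟩
    exact ⟨q, rfl⟩
  rw [isMorphism_iff]
  refine ⟨hsurj, ?_, ?_, ?_⟩
  · intro r
    obtain ⟨q, rfl⟩ := hsurj r
    simp only [hout, Store.outAutomaton, hval, hcls]
    rw [hedge _ (Or.inl rfl), h.outWeight_eq_sum]
    simp [augE]
  · intro a p r
    obtain ⟨q, rfl⟩ := hsurj r
    simp only [hout, Store.outAutomaton, hval]
    rw [hedge _ (Or.inr ⟨p, rfl⟩), h.outWeight_eq_sum]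
    simp [augE]
  · intro p
    simp only [Store.outAutomaton, hval, hcls]
    rw [hedge _ (Or.inr ⟨p, rfl⟩), h.outWeight_eq_sum]
    simp [augE]

theorem IsListing.isMinimalQuotient_outAutomaton (h : 𝒜.IsListing states trans)
    (hτ : Cmd.Computed trans τ cl) : 𝒜.IsMinimalQuotient τ.outAutomaton := by
  have hmor := h.isMorphism_outMap hτ
  have huniv : ∀ (S : Type w) [Fintype S] [DecidableEq S] (𝒞 : KAutomaton K A S),
      IsQuotient 𝒜 𝒞 → IsQuotient 𝒞 τ.outAutomaton := by
    rintro S _ _ 𝒞 ⟨φ, hφ⟩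
    -- The factor is defined by choosing preimages. Two states with the same image by `φ` are
    -- congruent, hence in the same final class, so the choice has no effect.
    have hψ : (fun s => τ.outMap (Function.surjInv hφ.1 s)) ∘ φ = τ.outMap := by
      funext q
      have h1 : φ (Function.surjInv hφ.1 (φ q)) = φ q := Function.surjInv_eq hφ.1 (φ q)
      have h2 := hτ.coarse _ (h.isCongruence hφ) _ _ (Or.inr ⟨_, _, rfl, rfl, h1⟩)
      refine Subtype.ext ?_
      change τ.classOf (.tru _) = τ.classOf (.tru q)
      rw [Store.classOf, Store.classOf, hτ.cls, hτ.cls, h2]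
    exact ⟨_, hφ.of_comp (by rw [hψ]; exact hmor)⟩
  refine ⟨⟨_, hmor⟩, huniv, ?_⟩
  intro S _ _ 𝒞 h𝒞
  obtain ⟨ψ, hψ⟩ := huniv S 𝒞 h𝒞
  exact Fintype.card_le_of_surjective ψ hψ.1

end KAutomaton

theorem theorem5p1 :
    ∃ c : ℕ, ∀ {K : Type u} {A : Type v} {Q : Type w} [Semiring K] [Fintype Q]
      [DecidableEq K] [DecidableEq A] [DecidableEq Q] (𝒜 : KAutomaton K A Q)
      (states : List Q) (trans : List (AugState Q × Option A × K × AugState Q)),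
      𝒜.IsListing states trans →
      ∀ algorithm ∈ [Cmd.dsa, Cmd.pcsa], ∃ (σ : Store K A Q) (time : ℕ),
        algorithm.Halts (inputStore states trans) σ time ∧
        𝒜.IsMinimalQuotient σ.outAutomaton ∧
        𝒜.IsMorphism σ.outAutomaton σ.outMap ∧
        time ≤ c * max 1 (Fintype.card Q * (𝒜.numTransitions + Fintype.card Q)) := by
  -- For `n ≥ 1` this is `10000 * 3 * 5`, from `n + 2 ≤ 3 * n` and, as the augmented automaton has
  -- at most `m + 2 * n` transitions, `n + 2 + (m + 2 * n) ≤ 5 * (m + n)`.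
  refine ⟨150000, ?_⟩
  intro K A Q _ _ _ _ _ 𝒜 states trans h algorithm halg
  have hnz : ∀ e ∈ trans, e.2.2.1 ≠ 0 := fun e he => ((h.mem_trans _ _ _ _).1 he).2
  have hini : ∀ e ∈ trans, e.2.2.2 ≠ .ini := by
    rintro ⟨p, a, k, q⟩ he rfl
    obtain ⟨rfl, h0⟩ := (h.mem_trans _ _ _ _).1 he
    exact h0 (KAutomaton.augE_ini p a)
  have hwp : algorithm.wp (inputStore states trans) fun τ t =>
      (∃ cl, Cmd.Computed trans τ cl) ∧
        t ≤ 10000 * ((states.length + 2) * (states.length + 2 + trans.length)) := by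
    simp only [List.mem_cons, List.not_mem_nil, or_false] at halg
    rcases halg with rfl | rfl
    · exact Cmd.wp_dsa h.states_nodup h.mem_states hnz
    · exact Cmd.wp_pcsa h.states_nodup h.mem_states hnz hini
  obtain ⟨τ, t, hrun, ⟨cl, hτ⟩, ht⟩ := hwp
  refine ⟨τ, t, hrun, h.isMinimalQuotient_outAutomaton hτ, h.isMorphism_outMap hτ, ht.trans ?_⟩
  have hcard : states.length = Fintype.card Q := by
    rw [← List.toFinset_card_of_nodup h.states_nodup, ← Finset.card_univ]
    congr 1
    ext q
    simp [h.mem_states]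
  have hlen := h.length_trans_le
  rw [hcard] at hlen ⊢
  -- Without states the product vanishes, but the programs still take a bounded time, at most
  -- `40000`; this is what the maximum with 1 is for.
  rcases Nat.eq_zero_or_pos (Fintype.card Q) with h0 | hpos
  · have hempty : IsEmpty Q := Fintype.card_eq_zero_iff.1 h0
    have hm : 𝒜.numTransitions = 0 := by
      rw [KAutomaton.numTransitions, Set.eq_empty_of_isEmpty {e : Q × A × Q | _}, Set.ncard_empty]
    have : trans.length = 0 := by omega
    rw [h0, this]
    simp
  · refine le_trans ?_ (Nat.mul_le_mul_left _ (le_max_right _ _))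
    have h1 : Fintype.card Q + 2 ≤ 3 * Fintype.card Q := by omega
    have h2 : Fintype.card Q + 2 + trans.length ≤ 5 * (𝒜.numTransitions + Fintype.card Q) := by
      omega
    calc 10000 * ((Fintype.card Q + 2) * (Fintype.card Q + 2 + trans.length))
        ≤ 10000 * (3 * Fintype.card Q * (5 * (𝒜.numTransitions + Fintype.card Q))) :=
          Nat.mul_le_mul_left _ (Nat.mul_le_mul h1 h2)
      _ = 150000 * (Fintype.card Q * (𝒜.numTransitions + Fintype.card Q)) := by ring
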